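/- **Notation.** Let $\mathrm{Sig}_n=\{\lambda\in\mathbb Z^n:\lambda_1\ge\dots\ge\lambda_n\}$, let $\mathrm{Sig}_n^+$ be the subset with $\lambda_n\ge 0$, $|\lambda|=\sum_i\lambda_i$, $m_a(\lambda)=\#\{i:\lambda_i=a\}$, and write $\nu\prec_Q\lambda$ if $\lambda_1\ge\nu_1\ge\lambda_2\ge\nu_2\ge\dots\ge\lambda_n\ge\nu_n$. For $s\in(-1,1)$ let $$P_\lambda(x_1,\dots,x_n;s)=\frac1{V_\lambda(s)}\sum_{\sigma\in S_n}\sigma\Big(x_1^{\lambda_1}\cdots x_n^{\lambda_n}\prod_{i<j}\frac{x_i-sx_j}{x_i-x_j}\Big),\qquad V_\lambda(s)=\prod_{a\in\mathbb Z}\prod_{j=1}^{m_a(\lambda)}\frac{1-s^j}{1-s}$$ be the Hall–Littlewood (Laurent) polynomial, and for $\lambda,\nu\in\mathrm{Sig}_n$ let $$Q_{\lambda/\nu}(x_1,\dots,x_r;s)=\sum_{\nu=\lambda^{(0)}\prec_Q\dots\prec_Q\lambda^{(r)}=\lambda}\ \prod_{i=1}^r\varphi_{\lambda^{(i)}/\lambda^{(i-1)}}(s)\,x_i^{|\lambda^{(i)}|-|\lambda^{(i-1)}|},\qquad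 \varphi_{\lambda/\nu}(s)=\prod_{a:\,m_a(\lambda)=m_a(\nu)+1}(1-s^{m_a(\lambda)}).$$ For an infinite sequence $\psi=(c_1,c_2,\dots)$ put $Q_{\lambda/\nu}(\psi;s)=\lim_{r\to\infty}Q_{\lambda/\nu}(c_1,\dots,c_r;s)$ (a finite sequence is padded with zeros), and $Q_\lambda=Q_{\lambda/(0,\dots,0)}$. For $\theta\in\mathbb R^n$ let $$\Pi_s(\theta;\psi)=\sum_{\lambda\in\mathrm{Sig}_n^+}P_\lambda(\theta;s)Q_\lambda(\psi;s),$$ where "$\Pi_s(\theta;\psi)<\infty$" means that this series converges absolutely. The Hall–Littlewood measure with parameter $s$ and specializations $\theta,\psi$ gives $\lambda\in\mathrm{Sig}_n^+$ the mass $P_\lambda(\theta;s)Q_\lambda(\psi;s)/\Pi_s(\theta;\psi)$. Let $t\in(-1,1)$. Define $c^{\mathrm{alt},\lambda}_{\mu,\nu}(t)$ ($\mu\in\mathrm{Sig}_{2n}$, $\nu\in\mathrm{Sig}_n$) and $c^{\mathrm{her},\lambda}_{\mu,\nu}(t)$ ($\mu,\nu\in\mathrm{Sig}_n$) as the coefficients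 of the expansions $$P_\mu(x_1,x_1t,\dots,x_n,x_nt;t)\,P_\nu(x_1,\dots,x_n;t^2)=\sum_{\lambda\in\mathrm{Sig}_n}c^{\mathrm{alt},\lambda}_{\mu,\nu}(t)\,P_\lambda(x_1,\dots,x_n;t^2),$$ $$P_\mu(x_1^2,\dots,x_n^2;t^2)\,P_\nu(x_1,\dots,x_n;-t)=\sum_{\lambda\in\mathrm{Sig}_n}c^{\mathrm{her},\lambda}_{\mu,\nu}(t)\,P_\lambda(x_1,\dots,x_n;-t).$$ Let $\theta=(a_1,\dots,a_n)\in\mathbb R^n$. The product convolutions are the random signatures with $$\mathbf P(\mu\boxtimes^{\mathrm{alt}}_\theta\nu=\lambda)=\frac{c^{\mathrm{alt},\lambda}_{\mu,\nu}(t)P_\lambda(\theta;t^2)}{P_\mu(\theta';t)P_\nu(\theta;t^2)},\quad \theta'=(a_1,a_1t,\dots,a_n,a_nt);\qquad \mathbf P(\mu\boxtimes^{\mathrm{her}}_\theta\nu=\lambda)=\frac{c^{\mathrm{her},\lambda}_{\mu,\nu}(t)P_\lambda(\theta;-t)}{P_\mu(\theta';t^2)P_\nu(\theta;-t)},\quad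 \theta'=(a_1^2,\dots,a_n^2).$$ In an iterated product convolution $\mu_\tau\boxtimes_\theta\cdots\boxtimes_\theta\mu_1\boxtimes_\theta\nu$, $0\le\tau\le k$, the input $\mu_{\tau+1}$ is independent of the values at times $0,\dots,\tau$, and given these values and $\mu_{\tau+1}$ the next value is drawn from the product convolution of $\mu_{\tau+1}$ with the value at time $\tau$. **Theorem.** 1. (Alternating case) Let $\psi,\psi_1,\dots,\psi_k$ be finite or absolutely summable infinite sequences of real numbers with $\Pi_{t^2}(\theta;\psi)<\infty$, $\Pi_t(\theta';\psi_i)<\infty$ and $\Pi_{t^2}(\theta;\psi_i)<\infty$ for all $i$, where $\theta'=(a_1,a_1t,\dots,a_n,a_nt)$. Assume that the denominators of the product convolution do not vanish: $P_\mu(\theta';t)\ne0$ for $\mu\in\mathrm{Sig}_{2n}^+$ and $P_\nu(\theta;t^2)\neq0$ for $\nu\in\mathrm{Sig}_n^+$. Let $\nu\in\mathrm{Sig}_n^+$ be distributed by the Hall–Littlewood measure with parameter $t^2$ and specializations $\theta,\psi$, and $\mu_i\in\mathrm{Sig}_{2n}^+$ by the Hall–Littlewood measure with parameter $t$ and specializations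 $\theta',\psi_i$, $1\le i\le k$. Then for all $\lambda^{(0)},\dots,\lambda^{(k)}\in\mathrm{Sig}_n$, $$\mathbf P\big(\mu_\tau\boxtimes_\theta\cdots\boxtimes_\theta\mu_1\boxtimes^{\mathrm{alt}}_\theta\nu=\lambda^{(\tau)}\ \ \forall\,0\le\tau\le k\big)=\frac{Q_{\lambda^{(0)}}(\psi;t^2)\,\prod_{i=1}^kQ_{\lambda^{(i)}/\lambda^{(i-1)}}(\psi_i;t^2)\;P_{\lambda^{(k)}}(\theta;t^2)}{\Pi_{t^2}(\theta;\psi)\prod_{i=1}^k\Pi_{t^2}(\theta;\psi_i)}.$$ 2. (Hermitian case) Let $\psi=(b_1^2,b_2^2,\dots)$ and $\psi_i=((b^{(i)}_1)^2,(b^{(i)}_2)^2,\dots)$, $1\le i\le k$, be finite or summable infinite sequences of squares of real numbers, and $\psi_i^*=(b^{(i)}_1,-b^{(i)}_1,b^{(i)}_2,-b^{(i)}_2,\dots)$. Let $\theta'=(a_1^2,\dots,a_n^2)$ and assume $\Pi_{-t}(\theta;\psi)<\infty$, $\Pi_{t^2}(\theta';\psi_i)<\infty$ and $\Pi_{-t}(\theta;\psi_i^*)<\infty$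 for all $i$, and that $P_\mu(\theta';t^2)\neq0$ and $P_\nu(\theta;-t)\ne0$ for all $\mu,\nu\in\mathrm{Sig}_n^+$. Let $\nu\in\mathrm{Sig}_n^+$ be distributed by the Hall–Littlewood measure with parameter $-t$ and specializations $\theta,\psi$, and $\mu_i\in\mathrm{Sig}_n^+$ by the Hall–Littlewood measure with parameter $t^2$ and specializations $\theta',\psi_i$, $1\le i\le k$. Then for all $\lambda^{(0)},\dots,\lambda^{(k)}\in\mathrm{Sig}_n$, $$\mathbf P\big(\mu_\tau\boxtimes_\theta\cdots\boxtimes_\theta\mu_1\boxtimes^{\mathrm{her}}_\theta\nu=\lambda^{(\tau)}\ \ \forall\,0\le\tau\le k\big)=\frac{Q_{\lambda^{(0)}}(\psi;-t)\,\prod_{i=1}^kQ_{\lambda^{(i)}/\lambda^{(i-1)}}(\psi_i^*;-t)\;P_{\lambda^{(k)}}(\theta;-t)}{\Pi_{-t}(\theta;\psi)\prod_{i=1}^k\Pi_{-t}(\theta;\psi_i^*)}.$$ Moreover, both identities hold at the level of masses without any positivity: if the left side is replaced by the sum over all nonnegative $\mu_1,\dots,\mu_k$ of (mass of $\lambda^{(0)}$)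 $\cdot\prod_i$ (mass of $\mu_i$) $\cdot$ (the quotient defining $\mathbf P(\mu_i\boxtimes_\theta\lambda^{(i-1)}=\lambda^{(i)})$), the identity is true also when some of these numbers are negative. -/

import Mathlib

open MeasureTheory ProbabilityTheory Filter Topology

noncomputable section

namespace HallLittlewood

/-- Integer signatures of length `n`: weakly decreasing `n`-tuples of integers. -/
abbrev Signature (n : ℕ) : Type := {f : Fin n → ℤ // Antitone f}

namespace Signature

/-- The signature `(0, …, 0)`. -/
def zero (n : ℕ) : Signature n := ⟨fun _ => 0, antitone_const⟩

/-- All parts are nonnegative. -/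
def IsNonneg {n : ℕ} (lam : Signature n) : Prop := ∀ i, 0 ≤ lam.1 i

/-- The sum of the parts. -/
def size {n : ℕ} (lam : Signature n) : ℤ := ∑ i, lam.1 i

/-- The number of parts equal to `a`. -/
def mult {n : ℕ} (lam : Signature n) (a : ℤ) : ℕ :=
  (Finset.univ.filter fun i => lam.1 i = a).card

/-- The set of integers that occur as parts. -/
def parts {n : ℕ} (lam : Signature n) : Finset ℤ := Finset.univ.image lam.1

/-- `InterlacesQ nu lam`: the relation `nu ≺_Q lam`, that is
`lam₁ ≥ nu₁ ≥ lam₂ ≥ nu₂ ≥ ⋯ ≥ lamₙ ≥ nuₙ`. -/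
def InterlacesQ {n : ℕ} (nu lam : Signature n) : Prop :=
  (∀ i, nu.1 i ≤ lam.1 i) ∧ ∀ i j : Fin n, (i : ℕ) + 1 = j → lam.1 j ≤ nu.1 i

end Signature

/-! ### Hall-Littlewood polynomials -/

/-- `V_m(t) = (1 - t)(1 - t²)⋯(1 - t^m) / (1 - t)^m`. -/
def hlV (t : ℝ) (m : ℕ) : ℝ := (∏ j ∈ Finset.range m, (1 - t ^ (j + 1))) / (1 - t) ^ m

/-- `V_lam(t)`, the product of `V_{m_a(lam)}(t)` over all integers `a`; since `V_0 = 1`, only the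
parts of `lam` matter. -/
def hlVSig {n : ℕ} (t : ℝ) (lam : Signature n) : ℝ := ∏ a ∈ lam.parts, hlV t (lam.mult a)

/-- The symmetrization formula for the Hall-Littlewood polynomial, meaningful at points with
pairwise distinct coordinates. -/
def hlSymmetrization {n : ℕ} (t : ℝ) (lam : Signature n) (x : Fin n → ℝ) : ℝ :=
  (hlVSig t lam)⁻¹ * ∑ σ : Equiv.Perm (Fin n),
    (∏ i, x (σ i) ^ lam.1 i) *
      ∏ i, ∏ j ∈ Finset.Ioi i, (x (σ i) - t * x (σ j)) / (x (σ i) - x (σ j))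

/-- The value `P_lam(x₁, …, xₙ; t)` of the Hall-Littlewood polynomial. The symmetrization formula
is a Laurent polynomial in `x`, so its value at a point with repeated coordinates is the limit of
its values at points with pairwise distinct coordinates. -/
def hlP {n : ℕ} (t : ℝ) (lam : Signature n) (x : Fin n → ℝ) : ℝ :=
  limUnder (𝓝[{y | Function.Injective y}] x) (hlSymmetrization t lam)

/-- The branching coefficient `φ_{lam/nu}(t)`: the product of `1 - t^{m_a(lam)}` over the integers
`a` with `m_a(lam) = m_a(nu) + 1`; such an `a` is a part of `lam`. -/
def branchPhi {n : ℕ} (t : ℝ) (lam nu : Signature n) : ℝ :=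
  ∏ a ∈ lam.parts.filter (fun a => lam.mult a = nu.mult a + 1), (1 - t ^ lam.mult a)

/-- Gelfand-Tsetlin patterns `nu = T₀ ≺_Q T₁ ≺_Q ⋯ ≺_Q T_r = lam`. -/
def GTQ {n : ℕ} (r : ℕ) (lam nu : Signature n) : Type :=
  {T : Fin (r + 1) → Signature n //
    T 0 = nu ∧ T (Fin.last r) = lam ∧ ∀ i : Fin r, (T i.castSucc).InterlacesQ (T i.succ)}

/-- The skew Hall-Littlewood polynomial `Q_{lam/nu}(x₁, …, x_r; t)`, a finite sum over
Gelfand-Tsetlin patterns. -/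
def skewQFin {n : ℕ} (t : ℝ) {r : ℕ} (x : Fin r → ℝ) (lam nu : Signature n) : ℝ :=
  ∑ᶠ T : GTQ r lam nu, ∏ i : Fin r,
    (branchPhi t (T.1 i.succ) (T.1 i.castSucc) *
      x i ^ ((T.1 i.succ).size - (T.1 i.castSucc).size))

/-- `Q_{lam/nu}(ψ; t)` for an infinite sequence `ψ`: since `Q_{lam/nu}` is a polynomial in the power
sums, this is the limit of the values at the truncations of `ψ`. A finite sequence is represented
by the sequence obtained from it by appending zeros. -/
def skewQ {n : ℕ} (t : ℝ) (ψ : ℕ → ℝ) (lam nu : Signature n) : ℝ :=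
  limUnder atTop fun r : ℕ => skewQFin t (fun i : Fin r => ψ i) lam nu

/-- `Q_lam(ψ; t) = Q_{lam/(0, …, 0)}(ψ; t)`. -/
def hlQ {n : ℕ} (t : ℝ) (ψ : ℕ → ℝ) (lam : Signature n) : ℝ := skewQ t ψ lam (Signature.zero n)

/-! ### Hall-Littlewood measures -/

/-- Finiteness of `Π_t(θ; ψ) = ∑ P_lam(θ; t) Q_lam(ψ; t)`, the sum over nonnegative signatures. -/
def CauchyFinite {n : ℕ} (t : ℝ) (θ : Fin n → ℝ) (ψ : ℕ → ℝ) : Prop :=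
  Summable fun lam : {lam : Signature n // lam.IsNonneg} => hlP t lam.1 θ * hlQ t ψ lam.1

/-- The Cauchy kernel `Π_t(θ; ψ) = ∑ P_lam(θ; t) Q_lam(ψ; t)`. -/
def cauchyKernel {n : ℕ} (t : ℝ) (θ : Fin n → ℝ) (ψ : ℕ → ℝ) : ℝ :=
  ∑' lam : {lam : Signature n // lam.IsNonneg}, hlP t lam.1 θ * hlQ t ψ lam.1

/-- The mass `P_lam(θ; t) Q_lam(ψ; t) / Π_t(θ; ψ)` that the Hall-Littlewood measure gives to the
nonnegative signature `lam`. -/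
def hlMass {n : ℕ} (t : ℝ) (θ : Fin n → ℝ) (ψ : ℕ → ℝ) (lam : Signature n) : ℝ :=
  hlP t lam θ * hlQ t ψ lam / cauchyKernel t θ ψ

/-- The random signature `Y` is distributed by the Hall-Littlewood measure with parameter `t` and
specializations `θ, ψ`, which lives on nonnegative signatures. -/
def HasHLLaw {Ω : Type*} [MeasurableSpace Ω] (P : Measure Ω) {n : ℕ} (Y : Ω → Signature n)
    (t : ℝ) (θ : Fin n → ℝ) (ψ : ℕ → ℝ) : Prop :=
  (∀ lam : Signature n, lam.IsNonneg → P.real {ω | Y ω = lam} = hlMass t θ ψ lam) ∧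
  ∀ lam : Signature n, ¬ lam.IsNonneg → P.real {ω | Y ω = lam} = 0

/-- The mass that the Hall-Littlewood process with parameter `t` and specializations
`ψ, ψs 0, …, ψs (k - 1)` and `θ` gives to the sequence `l 0, l 1, …, l k`. -/
def hlProcessMass {n k : ℕ} (t : ℝ) (θ : Fin n → ℝ) (ψ : ℕ → ℝ) (ψs : Fin k → ℕ → ℝ)
    (l : Fin (k + 1) → Signature n) : ℝ :=
  hlQ t ψ (l 0) * (∏ i : Fin k, skewQ t (ψs i) (l i.succ) (l i.castSucc)) *
      hlP t (l (Fin.last k)) θ /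
    (cauchyKernel t θ ψ * ∏ i : Fin k, cauchyKernel t θ (ψs i))

/-! ### Changes of specialization -/

/-- `(a₁, a₁ t, a₂, a₂ t, …, aₙ, aₙ t)`. -/
def altDouble {n : ℕ} (t : ℝ) (a : Fin n → ℝ) : Fin (2 * n) → ℝ :=
  fun j => a ⟨(j : ℕ) / 2, by have := j.2; omega⟩ * t ^ ((j : ℕ) % 2)

/-- `(b₁, -b₁, b₂, -b₂, …)`. -/
def starSeq (b : ℕ → ℝ) : ℕ → ℝ := fun j => (-1) ^ j * b (j / 2)

/-! ### Mixed Littlewood-Richardson coefficients and product convolutions -/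

/-- `c` is the family of coefficients of the expansion of
`P_mu(x₁, x₁t, …, xₙ, xₙt; t) P_nu(x₁, …, xₙ; t²)` in the `P_lam(x₁, …, xₙ; t²)`. -/
def IsAltLR {n : ℕ} (t : ℝ) (mu : Signature (2 * n)) (nu : Signature n)
    (c : Signature n →₀ ℝ) : Prop :=
  ∀ x : Fin n → ℝ, (∀ i, x i ≠ 0) →
    hlP t mu (altDouble t x) * hlP (t ^ 2) nu x = c.sum fun lam a => a * hlP (t ^ 2) lam x

/-- `c` is the family of coefficients of the expansion of
`P_mu(x₁², …, xₙ²; t²) P_nu(x₁, …, xₙ; -t)` in the `P_lam(x₁, …, xₙ; -t)`. -/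
def IsHerLR {n : ℕ} (t : ℝ) (mu nu : Signature n) (c : Signature n →₀ ℝ) : Prop :=
  ∀ x : Fin n → ℝ, (∀ i, x i ≠ 0) →
    hlP (t ^ 2) mu (fun i => x i ^ 2) * hlP (-t) nu x = c.sum fun lam a => a * hlP (-t) lam x

open Classical in
/-- The alternating Littlewood-Richardson coefficients. -/
def altLR {n : ℕ} (t : ℝ) (mu : Signature (2 * n)) (nu : Signature n) : Signature n →₀ ℝ :=
  if h : ∃ c, IsAltLR t mu nu c then h.choose else 0

open Classical in
/-- The Hermitian Littlewood-Richardson coefficients. -/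
def herLR {n : ℕ} (t : ℝ) (mu nu : Signature n) : Signature n →₀ ℝ :=
  if h : ∃ c, IsHerLR t mu nu c then h.choose else 0

/-- The probability that the alternating product convolution of `mu` and `nu` equals `lam`. -/
def altConv {n : ℕ} (t : ℝ) (θ : Fin n → ℝ) (mu : Signature (2 * n)) (nu lam : Signature n) : ℝ :=
  altLR t mu nu lam * hlP (t ^ 2) lam θ / (hlP t mu (altDouble t θ) * hlP (t ^ 2) nu θ)

/-- The probability that the Hermitian product convolution of `mu` and `nu` equals `lam`. -/
def herConv {n : ℕ} (t : ℝ) (θ : Fin n → ℝ) (mu nu lam : Signature n) : ℝ :=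
  herLR t mu nu lam * hlP (-t) lam θ / (hlP (t ^ 2) mu (fun i => θ i ^ 2) * hlP (-t) nu θ)

/-- `X 0, …, X k` are the successive values of a random operation with one-step probabilities
`K mu nu lam` (the probability that the operation applied to `mu` and `nu` gives `lam`) with
inputs `μ 0, …, μ (k - 1)`: the input `μ i` is independent of the history `X 0, …, X i`, and given
that history and the value of `μ i`, the conditional law of `X (i + 1)` is `K (μ i) (X i)`. -/
structure IsIteratedOperation {Ω : Type*} [MeasurableSpace Ω] (P : Measure Ω) {m n k : ℕ}
    (K : Signature m → Signature n → Signature n → ℝ)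
    (μ : Fin k → Ω → Signature m) (X : Fin (k + 1) → Ω → Signature n) : Prop where
  measurable_input : ∀ i, Measurable (μ i)
  measurable_value : ∀ i, Measurable (X i)
  indep : ∀ i : Fin k,
    IndepFun (μ i) (fun ω (j : Set.Iic i.castSucc) => X j.1 ω) P
  step : ∀ (i : Fin k) (l : Fin (k + 1) → Signature n) (mu : Signature m) (lam : Signature n),
    P.real {ω | (∀ j ≤ i.castSucc, X j ω = l j) ∧ μ i ω = mu ∧ X i.succ ω = lam} =
      P.real {ω | (∀ j ≤ i.castSucc, X j ω = l j) ∧ μ i ω = mu} * K mu (l i.castSucc) lam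

end HallLittlewood

end

open HallLittlewood

/-!
The proof treats both cases at once. Each comes from a substitution `x ↦ Dm x` under which the
Cauchy kernel does not change. In the alternating case, the telescoping product
`(1 - t x y)/(1 - x y) · (1 - t² x y)/(1 - t x y) = (1 - t² x y)/(1 - x y)` gives
`Π_t(x, x t; ψ) = Π_{t²}(x; ψ)`; in the Hermitian case, the product of
`(1 + t x y)/(1 - x y)` and `(1 - t x y)/(1 + x y)` is `(1 - t² x² y²)/(1 - x² y²)`, which gives
`Π_{-t}(x; ψ*) = Π_{t²}(x²; ψ)`. The structure `KernelChange` records what is common to the two.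

In the skew Cauchy identity `∑_lam Q_{lam/nu}(c) P_lam(x) = Π(x; c) P_nu(x)`, the factor `Π(x; c)`
is the kernel at `Dm x`, which expands as `∑_mu Q_mu P_mu(Dm x)`. The product
`P_mu(Dm x) P_nu(x)` is by definition the sum of the `P_lam(x)` with the mixed
Littlewood-Richardson coefficients `c^lam_{mu,nu}`. Comparing coefficients gives
`∑_mu Q_mu c^lam_{mu,nu} = Q_{lam/nu}` (`KernelChange.sum_truncQ_mul_coeffs`, and
`KernelChange.exists_finset_sum_hlQ` in the limit of infinitely many variables). By homogeneity the
sum over `mu` is finite for given `nu` and `lam`. Hence averaging a product convolution over a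
Hall-Littlewood distributed input gives the transition mass of the Hall-Littlewood process
(`KernelChange.exists_finset_sum_hlMass`), the factors `P_{lam⁽ⁱ⁾}(θ)` telescope along a path
(`hlMass_mul_prod_stepMass`), and independence of the inputs gives the joint law
(`KernelChange.law_eq`).

The skew Cauchy identity (`sum_skewQFin_mul_hlP`) follows by iteration from the Pieri rule
(`coeff_rowSer_mul_hlSymmetrization`). For the unnormalized symmetrizations the Pieri rule is
proved by induction on the number of variables, removing the first part of the signature
(`rowSer_mul_symSum`). The tool is that symmetrization kills functions of the form `(y₁ - s y₀) f`
with `f` symmetric in `y₀, y₁` (`symSum_eq_of_swap`), which moves the kernel from the first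
variable to the next one. The Pieri rule also shows, by triangularity, that `P_lam` is a polynomial
in the one-row functions (`exists_eval_rowSer`), so that it is continuous and `hlP` is its value
also at points with repeated coordinates, and so that products `P_mu(Dm x) P_nu(x)` do expand
(`KernelChange.exists_expansion`). Uniqueness of the coefficients is linear independence of the
`P_lam`, proved by setting one variable to zero (`eq_zero_of_sum_hlSymmetrization`).

The sequence `ψ* = (b₁, -b₁, b₂, -b₂, …)` need not be summable. Along truncations of even length
`Q_{lam/nu}` converges because it is a finite combination of the functions `Q_mu(b₁², b₂², …)`, and
a single further variable `b_j → 0` does not change the limit (`tendsto_truncQ_of_even`).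
-/

open scoped PowerSeries

noncomputable section

namespace HallLittlewood

/-! ### Symmetrization with the Hall-Littlewood kernel -/

/-- The kernel `∏_{i < j} (y_i - s y_j) / (y_i - y_j)`. -/
def crossProd (s : ℝ) {n : ℕ} (y : Fin n → ℝ) : ℝ :=
  ∏ i, ∏ j ∈ Finset.Ioi i, (y i - s * y j) / (y i - y j)

/-- The Hall-Littlewood symmetrization `∑_σ σ(F(x) ∏_{i < j} (x_i - s x_j) / (x_i - x_j))` of a
function `F` with values in a real vector space. -/
def symSum (s : ℝ) {M : Type*} [AddCommGroup M] [Module ℝ M] {n : ℕ} (x : Fin n → ℝ)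
    (F : (Fin n → ℝ) → M) : M :=
  ∑ σ : Equiv.Perm (Fin n), crossProd s (x ∘ σ) • F (x ∘ σ)

/-- The variables other than `x p`, in the order obtained by exchanging `x 0` and `x p`. -/
def dropVar {n : ℕ} (p : Fin (n + 1)) (x : Fin (n + 1) → ℝ) : Fin n → ℝ :=
  fun i => x (Equiv.swap 0 p i.succ)

/-- The Laurent monomial with exponents `e`. -/
def monomialZ {n : ℕ} (e : Fin n → ℤ) (y : Fin n → ℝ) : ℝ := ∏ i, y i ^ e i

theorem crossProd_succ (s : ℝ) {n : ℕ} (y : Fin (n + 1) → ℝ) :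
    crossProd s y =
      (∏ j : Fin n, (y 0 - s * y j.succ) / (y 0 - y j.succ)) * crossProd s (y ∘ Fin.succ) := by
  simp only [crossProd, Fin.prod_univ_succ, Fin.prod_Ioi_zero, Fin.prod_Ioi_succ,
    Function.comp_apply]

theorem dropVar_injective {n : ℕ} (p : Fin (n + 1)) {x : Fin (n + 1) → ℝ}
    (hx : Function.Injective x) : Function.Injective (dropVar p x) := fun _ _ h =>
  Fin.succ_injective _ ((Equiv.swap 0 p).injective (hx h))

theorem prod_eq_mul_prod_dropVar {M : Type*} [CommMonoid M] {n : ℕ} (p : Fin (n + 1))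
    (x : Fin (n + 1) → ℝ) (h : ℝ → M) : ∏ i, h (x i) = h (x p) * ∏ i, h (dropVar p x i) := by
  rw [← Equiv.prod_comp (Equiv.swap 0 p) (fun i => h (x i)), Fin.prod_univ_succ]
  simp [dropVar]

section

variable {M : Type*} [AddCommGroup M] [Module ℝ M]

/-- Splitting the symmetrization according to the variable that takes the first place. -/
theorem symSum_succ (s : ℝ) {n : ℕ} (x : Fin (n + 1) → ℝ) (F : (Fin (n + 1) → ℝ) → M) :
    symSum s x F = ∑ p, (∏ j, (x p - s * dropVar p x j) / (x p - dropVar p x j)) •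
      symSum s (dropVar p x) fun y => F (Fin.cons (x p) y) := by
  unfold symSum
  rw [← Equiv.sum_comp Equiv.Perm.decomposeFin.symm, Fintype.sum_prod_type]
  refine Finset.sum_congr rfl fun p _ => ?_
  rw [Finset.smul_sum]
  refine Finset.sum_congr rfl fun e _ => ?_
  have h : x ∘ (Equiv.Perm.decomposeFin.symm (p, e)) = Fin.cons (x p) (dropVar p x ∘ e) := by
    funext i
    refine Fin.cases ?_ (fun i => ?_) i
    · simp
    · simp [dropVar]
  rw [h, crossProd_succ, ← mul_smul]
  congr 2
  simp only [Fin.cons_zero, Fin.cons_succ, Function.comp_apply]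
  exact Equiv.prod_comp e fun j => (x p - s * dropVar p x j) / (x p - dropVar p x j)

theorem symSum_congr (s : ℝ) {n : ℕ} {x : Fin n → ℝ} {F G : (Fin n → ℝ) → M}
    (h : ∀ σ : Equiv.Perm (Fin n), F (x ∘ σ) = G (x ∘ σ)) : symSum s x F = symSum s x G := by
  unfold symSum
  exact Finset.sum_congr rfl fun σ _ => by rw [h σ]

theorem symSum_sum (s : ℝ) {ι : Type*} (S : Finset ι) {n : ℕ} (x : Fin n → ℝ)
    (F : ι → (Fin n → ℝ) → M) :
    symSum s x (fun y => ∑ a ∈ S, F a y) = ∑ a ∈ S, symSum s x (F a) := by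
  simp only [symSum, Finset.smul_sum]
  exact Finset.sum_comm

theorem map_symSum {N : Type*} [AddCommGroup N] [Module ℝ N] (f : M →ₗ[ℝ] N) (s : ℝ) {n : ℕ}
    (x : Fin n → ℝ) (F : (Fin n → ℝ) → M) :
    f (symSum s x F) = symSum s x fun y => f (F y) := by
  simp [symSum, map_sum]

theorem symSum_mul_left {A : Type*} [CommRing A] [Algebra ℝ A] (s : ℝ) {n : ℕ} (x : Fin n → ℝ)
    (a : A) (F : (Fin n → ℝ) → A) : symSum s x (fun y => a * F y) = a * symSum s x F := by
  simp [symSum, Finset.mul_sum]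

/-- Symmetrizing kills what is symmetric up to the factor `y₁ - s y₀` in the first two variables:
two functions whose difference pairs off under the exchange of these variables have the same
symmetrization. -/
theorem symSum_eq_of_swap (s : ℝ) {n : ℕ} {x : Fin (n + 2) → ℝ} (hx : Function.Injective x)
    {F G : (Fin (n + 2) → ℝ) → M}
    (h : ∀ y : Fin (n + 2) → ℝ, y 0 ≠ y 1 →
      (y 0 - s * y 1) • F y - (y 1 - s * y 0) • F (y ∘ Equiv.swap 0 1) =
        (y 0 - s * y 1) • G y - (y 1 - s * y 0) • G (y ∘ Equiv.swap 0 1)) :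
    symSum s x F = symSum s x G := by
  have key : ∀ H : (Fin (n + 2) → ℝ) → M, (2 : ℝ) • symSum s x H =
      ∑ σ : Equiv.Perm (Fin (n + 2)), (crossProd s (x ∘ σ) • H (x ∘ σ) +
        crossProd s ((x ∘ σ) ∘ Equiv.swap 0 1) • H ((x ∘ σ) ∘ Equiv.swap 0 1)) := by
    intro H
    rw [two_smul, Finset.sum_add_distrib]
    congr 1
    unfold symSum
    rw [← Equiv.sum_comp (Equiv.mulRight (Equiv.swap (0 : Fin (n + 2)) 1))]
    rfl
  have h2 : (2 : ℝ) • symSum s x F = (2 : ℝ) • symSum s x G := by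
    rw [key, key]
    refine Finset.sum_congr rfl fun σ _ => ?_
    set y := x ∘ σ with hy
    have hy01 : y 0 ≠ y 1 := fun h0 => by
      have := σ.injective (hx h0)
      simp at this
    -- Exchanging `y 0` and `y 1` changes only the factor of the kernel at the pair `(0, 1)`; the rest,
    -- divided by `y 0 - y 1`, is the common factor `r`, up to the sign of that denominator.
    obtain ⟨r, h0, h1⟩ : ∃ r : ℝ, crossProd s y = (y 0 - s * y 1) * r ∧
        crossProd s (y ∘ Equiv.swap 0 1) = -((y 1 - s * y 0) * r) := by
      have hsub : y 0 - y 1 ≠ 0 := sub_ne_zero.mpr hy01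
      have hsub' : y 1 - y 0 ≠ 0 := sub_ne_zero.mpr hy01.symm
      have hsw : ∀ j : Fin n, Equiv.swap (0 : Fin (n + 2)) 1 j.succ.succ = j.succ.succ := fun j =>
        Equiv.swap_apply_of_ne_of_ne (Fin.succ_ne_zero _)
          (fun h => Fin.succ_ne_zero j (Fin.succ_injective _ h))
      refine ⟨(y 0 - y 1)⁻¹ * (∏ j : Fin n, (y 0 - s * y j.succ.succ) / (y 0 - y j.succ.succ)) *
        (∏ j : Fin n, (y 1 - s * y j.succ.succ) / (y 1 - y j.succ.succ)) *
        crossProd s ((y ∘ Fin.succ) ∘ Fin.succ), ?_, ?_⟩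
      · rw [crossProd_succ, crossProd_succ, Fin.prod_univ_succ]
        simp only [Function.comp_apply, Fin.succ_zero_eq_one]
        field_simp
      · rw [crossProd_succ, crossProd_succ, Fin.prod_univ_succ]
        have : (((y ∘ Equiv.swap 0 1) ∘ Fin.succ) ∘ Fin.succ) = (y ∘ Fin.succ) ∘ Fin.succ := by
          funext j; simp [hsw]
        rw [this]
        simp only [Function.comp_apply, Fin.succ_zero_eq_one, hsw, Equiv.swap_apply_left,
          Equiv.swap_apply_right]
        have e : (y 1 - y 0)⁻¹ = -(y 0 - y 1)⁻¹ := by rw [← neg_sub, inv_neg]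
        rw [div_eq_mul_inv (y 1 - s * y 0), e]
        ring
    rw [h0, h1]
    have := congrArg (fun m => r • m) (h y hy01)
    simp only [smul_sub, smul_smul] at this
    rw [neg_smul, neg_smul, ← sub_eq_add_neg, ← sub_eq_add_neg, mul_comm _ r, mul_comm _ r]
    exact this
  exact smul_right_injective M (two_ne_zero' ℝ) h2

end

/-! ### The weight of a horizontal strip -/

/-- The number of entries of `v` that are equal to `a`. -/
def count {n : ℕ} (v : Fin n → ℤ) (a : ℤ) : ℕ := (Finset.univ.filter fun i => v i = a).card

/-- The contribution of a value of multiplicity `p` in `lam` and `q` in `nu` to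
`φ_{lam/nu} V_nu / V_lam`. -/
def localWeight (s : ℝ) (p q : ℕ) : ℝ := (if p = q + 1 then 1 - s ^ p else 1) * hlV s q / hlV s p

/-- The weight `φ_{lam/nu} V_nu / V_lam`, as a product over the values that occur. The two
tuples may have different lengths, which lets the top entries be split off one at a time. -/
def stripWeight (s : ℝ) {m n : ℕ} (l : Fin m → ℤ) (v : Fin n → ℤ) : ℝ :=
  ∏ a ∈ Finset.univ.image l ∪ Finset.univ.image v, localWeight s (count l a) (count v a)

theorem one_sub_pow_ne_zero {s : ℝ} (hs : |s| < 1) (m : ℕ) : 1 - s ^ (m + 1) ≠ 0 := by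
  intro h
  have h1 : |s ^ (m + 1)| < 1 := by
    rw [abs_pow]; exact pow_lt_one₀ (abs_nonneg s) hs (Nat.succ_ne_zero m)
  rw [← sub_eq_zero.mp h] at h1
  simp at h1

theorem one_sub_ne_zero {s : ℝ} (hs : |s| < 1) : 1 - s ≠ 0 := by
  simpa using one_sub_pow_ne_zero hs 0

theorem hlV_ne_zero {s : ℝ} (hs : |s| < 1) (m : ℕ) : hlV s m ≠ 0 :=
  div_ne_zero (Finset.prod_ne_zero_iff.mpr fun j _ => one_sub_pow_ne_zero hs j)
    (pow_ne_zero _ (one_sub_ne_zero hs))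

theorem hlV_zero (s : ℝ) : hlV s 0 = 1 := by simp [hlV]

theorem hlV_succ {s : ℝ} (m : ℕ) :
    hlV s (m + 1) = hlV s m * ((1 - s ^ (m + 1)) / (1 - s)) := by
  rw [hlV, hlV, Finset.prod_range_succ, pow_succ (1 - s), mul_div_mul_comm]

theorem localWeight_self {s : ℝ} (hs : |s| < 1) (p : ℕ) : localWeight s p p = 1 := by
  simp [localWeight, hlV_ne_zero hs]

theorem localWeight_succ_left {s : ℝ} (hs : |s| < 1) (q : ℕ) :
    localWeight s (q + 1) q = 1 - s := by
  have h1 := hlV_ne_zero hs q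
  have h2 := one_sub_ne_zero hs
  have h3 := one_sub_pow_ne_zero hs q
  rw [localWeight, if_pos rfl, hlV_succ]
  field_simp

theorem localWeight_succ_right {s : ℝ} (hs : |s| < 1) (p : ℕ) :
    localWeight s p (p + 1) = (1 - s ^ (p + 1)) / (1 - s) := by
  have h1 := hlV_ne_zero hs p
  rw [localWeight, if_neg (by omega), hlV_succ]
  field_simp

theorem count_eq_zero {n : ℕ} {v : Fin n → ℤ} {a : ℤ} (h : ∀ i, v i ≠ a) : count v a = 0 := by
  simpa [count, Finset.filter_eq_empty_iff] using h

theorem count_cons {n : ℕ} (p : ℤ) (v : Fin n → ℤ) (a : ℤ) :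
    count (Fin.cons p v : Fin (n + 1) → ℤ) a = (if p = a then 1 else 0) + count v a := by
  simp only [count, Finset.card_filter, Fin.sum_univ_succ, Fin.cons_zero, Fin.cons_succ]

theorem count_cons_self {n : ℕ} (p : ℤ) (v : Fin n → ℤ) :
    count (Fin.cons p v : Fin (n + 1) → ℤ) p = count v p + 1 := by
  rw [count_cons, if_pos rfl, add_comm]

theorem count_cons_of_ne {n : ℕ} {p a : ℤ} (h : p ≠ a) (v : Fin n → ℤ) :
    count (Fin.cons p v : Fin (n + 1) → ℤ) a = count v a := by
  rw [count_cons, if_neg h, zero_add]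

theorem stripWeight_eq_prod {s : ℝ} (hs : |s| < 1) {m n : ℕ} (l : Fin m → ℤ) (v : Fin n → ℤ)
    {S : Finset ℤ} (hl : ∀ i, l i ∈ S) (hv : ∀ i, v i ∈ S) :
    stripWeight s l v = ∏ a ∈ S, localWeight s (count l a) (count v a) := by
  refine Finset.prod_subset (fun a ha => ?_) fun a _ ha => ?_
  · simp only [Finset.mem_union, Finset.mem_image, Finset.mem_univ, true_and] at ha
    rcases ha with ⟨i, rfl⟩ | ⟨i, rfl⟩
    exacts [hl i, hv i]
  · simp only [Finset.mem_union, Finset.mem_image, Finset.mem_univ, true_and, not_or,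
      not_exists] at ha
    rw [count_eq_zero ha.1, count_eq_zero ha.2, localWeight_self hs]

theorem stripWeight_congr {s : ℝ} (hs : |s| < 1) {m n m' n' : ℕ} {l : Fin m → ℤ} {v : Fin n → ℤ}
    {l' : Fin m' → ℤ} {v' : Fin n' → ℤ}
    (h : ∀ a, localWeight s (count l a) (count v a) = localWeight s (count l' a) (count v' a)) :
    stripWeight s l v = stripWeight s l' v' := by
  classical
  set S : Finset ℤ := (Finset.univ.image l ∪ Finset.univ.image v) ∪
    (Finset.univ.image l' ∪ Finset.univ.image v') with hS
  rw [stripWeight_eq_prod hs l v (S := S) (by simp [hS]) (by simp [hS]),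
    stripWeight_eq_prod hs l' v' (S := S) (by simp [hS]) (by simp [hS])]
  exact Finset.prod_congr rfl fun a _ => h a

/-- The entries of `k` lie between consecutive entries of `v`. -/
def Between {n : ℕ} (k : Fin n → ℤ) (v : Fin (n + 1) → ℤ) : Prop :=
  ∀ i, v i.succ ≤ k i ∧ k i ≤ v i.castSucc

theorem Between.count_le {n : ℕ} {k : Fin n → ℤ} {v : Fin (n + 1) → ℤ} (h : Between k v) {p : ℤ}
    (hp : ∀ i, v i ≤ p) : count k p ≤ count v p := by
  refine Finset.card_le_card_of_injOn Fin.castSucc (fun i hi => ?_)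
    (Fin.castSucc_injective n).injOn
  simp only [Finset.coe_filter, Finset.mem_univ, true_and, Set.mem_ofPred_eq] at hi ⊢
  have := (h i).2
  have := hp i.castSucc
  omega

theorem Between.count_le_succ {n : ℕ} {k : Fin n → ℤ} {v : Fin (n + 1) → ℤ} (h : Between k v)
    {p : ℤ} (hp : ∀ i, v i ≤ p) : count v p ≤ count k p + 1 := by
  have h1 : v = Fin.cons (v 0) (Fin.tail v) := (Fin.cons_self_tail v).symm
  rw [h1, count_cons]
  have h2 : count (Fin.tail v) p ≤ count k p := by
    refine Finset.card_le_card fun i hi => ?_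
    simp only [Finset.mem_filter, Finset.mem_univ, true_and] at hi ⊢
    have h3 : v i.succ = p := hi
    have h4 := h i
    have h5 := hp i.castSucc
    omega
  split_ifs <;> omega

/-- Adding the same top entry to both tuples does not change the weight. -/
theorem stripWeight_cons_cons {s : ℝ} (hs : |s| < 1) {n : ℕ} {p : ℤ} {k v : Fin n → ℤ}
    (hc : count k p = count v p ∨ count k p = count v p + 1) :
    stripWeight s (Fin.cons p k : Fin (n + 1) → ℤ) (Fin.cons p v : Fin (n + 1) → ℤ) =
      stripWeight s k v := by
  refine stripWeight_congr hs fun a => ?_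
  by_cases ha : p = a
  · subst ha
    rw [count_cons_self, count_cons_self]
    rcases hc with hc | hc
    · rw [hc, localWeight_self hs, localWeight_self hs]
    · rw [hc, localWeight_succ_left hs, localWeight_succ_left hs]
  · rw [count_cons_of_ne ha, count_cons_of_ne ha]

/-- A new top entry of `lam` contributes the factor `1 - s`. -/
theorem stripWeight_cons_left {s : ℝ} (hs : |s| < 1) {m n : ℕ} {a : ℤ} {k : Fin m → ℤ}
    {v : Fin n → ℤ} (hk : ∀ i, k i ≠ a) (hv : ∀ i, v i ≠ a) :
    stripWeight s (Fin.cons a k : Fin (m + 1) → ℤ) v = (1 - s) * stripWeight s k v := by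
  classical
  set S : Finset ℤ := insert a (Finset.univ.image k ∪ Finset.univ.image v) with hS
  have haS : a ∈ S := by simp [hS]
  rw [stripWeight_eq_prod hs _ v (S := S) (fun i => by
      refine Fin.cases ?_ (fun i => ?_) i <;> simp [hS]) (by simp [hS]),
    stripWeight_eq_prod hs k v (S := S) (by simp [hS]) (by simp [hS]),
    ← Finset.mul_prod_erase _ _ haS, ← Finset.mul_prod_erase _ _ haS, count_cons_self,
    count_eq_zero hk, count_eq_zero hv, localWeight_self hs, localWeight_succ_left hs, one_mul]
  congr 1
  refine Finset.prod_congr rfl fun b hb => ?_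
  rw [count_cons_of_ne (Finset.ne_of_mem_erase hb).symm]

/-- The recursion for the weight when a new top entry of `nu` is put on the strip: the second
term is present only if the top entry of `lam` is equal to it. -/
theorem stripWeight_cons_right {s : ℝ} (hs : |s| < 1) {n : ℕ} {k : Fin n → ℤ}
    {v : Fin (n + 1) → ℤ} (hv : Antitone v) (hkv : Between k v) {p b : ℤ} (hvp : v 0 ≤ p)
    (hpb : p ≤ b) :
    stripWeight s (Fin.cons p k : Fin (n + 1) → ℤ) (Fin.cons b v : Fin (n + 2) → ℤ) =
      stripWeight s (Fin.cons p k : Fin (n + 1) → ℤ) v +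
        if p = b then s * stripWeight s k v else 0 := by
  classical
  have hvp' : ∀ i, v i ≤ p := fun i => (hv (Fin.zero_le i)).trans hvp
  have hkp' : ∀ i, k i ≤ p := fun i => (hkv i).2.trans (hvp' _)
  split_ifs with h
  · subst h
    set S : Finset ℤ := insert p (Finset.univ.image k ∪ Finset.univ.image v) with hS
    have hpS : p ∈ S := by simp [hS]
    rw [stripWeight_eq_prod hs _ _ (S := S)
        (fun i => by refine Fin.cases ?_ (fun i => ?_) i <;> simp [hS])
        (fun i => by refine Fin.cases ?_ (fun i => ?_) i <;> simp [hS]),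
      stripWeight_eq_prod hs _ v (S := S)
        (fun i => by refine Fin.cases ?_ (fun i => ?_) i <;> simp [hS]) (by simp [hS]),
      stripWeight_eq_prod hs k v (S := S) (by simp [hS]) (by simp [hS]),
      ← Finset.mul_prod_erase _ _ hpS, ← Finset.mul_prod_erase _ _ hpS,
      ← Finset.mul_prod_erase _ _ hpS, count_cons_self, count_cons_self]
    have e1 : ∀ w : Fin (n + 1) → ℤ, ∀ b ∈ S.erase p, localWeight s
        (count (Fin.cons p k : Fin (n + 1) → ℤ) b) (count w b) =
          localWeight s (count k b) (count w b) := fun w b hb => by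
      rw [count_cons_of_ne (Finset.ne_of_mem_erase hb).symm]
    have e2 : ∀ b ∈ S.erase p, localWeight s (count (Fin.cons p k : Fin (n + 1) → ℤ) b)
        (count (Fin.cons p v : Fin (n + 2) → ℤ) b) =
          localWeight s (count k b) (count v b) := fun b hb => by
      rw [count_cons_of_ne (Finset.ne_of_mem_erase hb).symm,
        count_cons_of_ne (Finset.ne_of_mem_erase hb).symm]
    rw [Finset.prod_congr rfl e2, Finset.prod_congr rfl (e1 v), ← mul_assoc, ← add_mul]
    congr 1
    have h1 := hkv.count_le hvp'
    have h2 := hkv.count_le_succ hvp'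
    have h3 := one_sub_ne_zero hs
    rcases (by omega : count v p = count k p ∨ count v p = count k p + 1) with h | h
    · rw [h, localWeight_self hs, localWeight_self hs, localWeight_succ_left hs]
      ring
    · rw [h, localWeight_self hs, localWeight_succ_right hs, localWeight_succ_right hs]
      field_simp
      ring
  · rw [add_zero]
    have hb : p < b := lt_of_le_of_ne hpb h
    refine stripWeight_congr hs fun a => ?_
    by_cases ha : b = a
    · subst ha
      have e1 : count v b = 0 := count_eq_zero fun i => ((hvp' i).trans_lt hb).ne
      have e2 : count k b = 0 := count_eq_zero fun i => ((hkp' i).trans_lt hb).ne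
      rw [count_cons_self, count_cons_of_ne h, e1, e2, localWeight_self hs,
        localWeight_succ_right hs]
      simp [one_sub_ne_zero hs]
    · rw [count_cons_of_ne ha]

/-! ### The Pieri rule for unnormalized Hall-Littlewood polynomials -/

/-- The geometric series `1 / (1 - y X)`. -/
def geomSer (y : ℝ) : ℝ⟦X⟧ := PowerSeries.mk fun k => y ^ k

/-- The series `y X / (1 - y X)`. -/
def tailSer (y : ℝ) : ℝ⟦X⟧ := PowerSeries.C y * PowerSeries.X * geomSer y

/-- The one-variable Cauchy kernel `(1 - s y X) / (1 - y X)`, in the form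
`1 + (1 - s) y X / (1 - y X)`. -/
def kernelSer (s y : ℝ) : ℝ⟦X⟧ := 1 + PowerSeries.C (1 - s) * tailSer y

/-- The kernel `∏_i (1 - s x_i X) / (1 - x_i X)`, the generating function of the one-row
Hall-Littlewood functions `q_d(x; s)`. -/
def rowSer (s : ℝ) {n : ℕ} (x : Fin n → ℝ) : ℝ⟦X⟧ := ∏ i, kernelSer s (x i)

theorem geomSer_eq (y : ℝ) : geomSer y = 1 + PowerSeries.C y * PowerSeries.X * geomSer y := by
  ext k
  rw [mul_assoc, map_add, PowerSeries.coeff_C_mul]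
  cases k with
  | zero => simp [geomSer]
  | succ k => simp [geomSer, PowerSeries.coeff_succ_X_mul, PowerSeries.coeff_one, pow_succ']

theorem coeff_tailSer (y : ℝ) (d : ℕ) :
    PowerSeries.coeff d (tailSer y) = if d = 0 then 0 else y ^ d := by
  rw [tailSer, mul_assoc, PowerSeries.coeff_C_mul]
  cases d with
  | zero => simp
  | succ d => simp [geomSer, PowerSeries.coeff_succ_X_mul, pow_succ']

theorem coeff_kernelSer (s y : ℝ) (d : ℕ) :
    PowerSeries.coeff d (kernelSer s y) = if d = 0 then 1 else (1 - s) * y ^ d := by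
  rw [kernelSer, map_add, PowerSeries.coeff_C_mul, coeff_tailSer, PowerSeries.coeff_one]
  split_ifs <;> simp

theorem kernelSer_mul (s y : ℝ) :
    kernelSer s y * (1 - PowerSeries.C y * PowerSeries.X) =
      1 - PowerSeries.C (s * y) * PowerSeries.X := by
  have h := geomSer_eq y
  rw [kernelSer, tailSer]
  simp only [map_sub, map_one, map_mul]
  linear_combination ((1 - PowerSeries.C s) * (PowerSeries.C y * PowerSeries.X)) * h

/-- The product `G(y₀) e(y₁)` of the kernel in the first variable and the tail in the second is
congruent to `s e(y₀)` modulo `y₁ - s y₀` times symmetric series. -/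
theorem kernelSer_tailSer_swap (s a b : ℝ) :
    PowerSeries.C (a - s * b) * (kernelSer s a * tailSer b - PowerSeries.C s * tailSer a) =
      PowerSeries.C (b - s * a) * (kernelSer s b * tailSer a - PowerSeries.C s * tailSer b) := by
  have key : ∀ a b : ℝ, kernelSer s a * tailSer b - PowerSeries.C s * tailSer a =
      PowerSeries.X * (geomSer a * geomSer b) * PowerSeries.C (b - s * a) := by
    intro a b
    have h := geomSer_eq a
    have h' := geomSer_eq b
    rw [kernelSer, tailSer, tailSer]
    simp only [map_sub, map_one, map_mul]
    linear_combination (-PowerSeries.C b * PowerSeries.X * geomSer b) * h +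
      (PowerSeries.C s * PowerSeries.C a * PowerSeries.X * geomSer a) * h'
  rw [key, key]
  ring

theorem zpow_add_of_nonneg (y : ℝ) {a b : ℤ} (ha : 0 ≤ a) (hb : 0 ≤ b) :
    y ^ (a + b) = y ^ a * y ^ b := by
  lift a to ℕ using ha
  lift b to ℕ using hb
  rw [← Nat.cast_add, zpow_natCast, zpow_natCast, zpow_natCast, pow_add]

/-- Expanding `y^a (A + B e(y))` up to the exponent `b`. -/
theorem zpow_mul_tailSer_expand (y A B : ℝ) {a b : ℤ} (ha : 0 ≤ a) (hab : a ≤ b) :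
    PowerSeries.C (y ^ a) * (PowerSeries.C A + PowerSeries.C B * tailSer y) =
      (∑ k ∈ Finset.Icc a b, PowerSeries.X ^ (k - a).toNat *
        PowerSeries.C (y ^ k * if k = a then A else B)) +
      PowerSeries.C B * PowerSeries.X ^ (b - a).toNat * PowerSeries.C (y ^ b) * tailSer y := by
  induction b, hab using Int.leInduction with
  | base => simp; ring
  | succ b hab ih =>
    have h1 : Finset.Icc a (b + 1) = insert (b + 1) (Finset.Icc a b) := by
      ext k; simp only [Finset.mem_insert, Finset.mem_Icc]; omega
    rw [h1, Finset.sum_insert (by simp), ih, if_neg (by omega),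
      (by omega : (b + 1 - a).toNat = (b - a).toNat + 1),
      zpow_add_of_nonneg y (ha.trans hab) zero_le_one, zpow_one]
    have h2 : tailSer y = PowerSeries.C y * PowerSeries.X * (1 + tailSer y) := by
      conv_lhs => rw [tailSer, geomSer_eq]
      rw [tailSer]
    simp only [map_mul, pow_succ]
    conv_lhs => rw [h2]
    ring

/-- The tuples that interlace with `v` from below: the possible lower parts of a signature that
differs from `v` by a horizontal strip. -/
def lowerBox {n : ℕ} (v : Fin (n + 1) → ℤ) : Finset (Fin n → ℤ) :=
  Fintype.piFinset fun i => Finset.Icc (v i.succ) (v i.castSucc)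

theorem mem_lowerBox {n : ℕ} {v : Fin (n + 1) → ℤ} {k : Fin n → ℤ} :
    k ∈ lowerBox v ↔ Between k v := by
  simp [lowerBox, Between, Fintype.mem_piFinset]

theorem sum_lowerBox_succ {M : Type*} [AddCommMonoid M] {n : ℕ} (v : Fin (n + 2) → ℤ)
    (f : (Fin (n + 1) → ℤ) → M) :
    ∑ k ∈ lowerBox v, f k =
      ∑ k ∈ lowerBox (Fin.tail v), ∑ a ∈ Finset.Icc (v 1) (v 0), f (Fin.cons a k) := by
  rw [← Finset.sum_product']
  symm
  refine Finset.sum_nbij' (fun q => Fin.cons q.2 q.1) (fun k => (Fin.tail k, k 0)) ?_ ?_ ?_ ?_ ?_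
  · rintro ⟨k, a⟩ h
    simp only [Finset.mem_product, mem_lowerBox, Finset.mem_Icc] at h ⊢
    intro i
    refine Fin.cases ?_ (fun i => ?_) i
    · simpa using h.2
    · simpa [Fin.tail] using h.1 i
  · intro k h
    simp only [Finset.mem_product, mem_lowerBox, Finset.mem_Icc] at h ⊢
    refine ⟨fun i => ?_, ?_⟩
    · simpa [Fin.tail] using h i.succ
    · simpa using h 0
  · rintro ⟨k, a⟩ _
    simp
  · intro k _
    exact Fin.cons_self_tail k
  · intros; rfl

theorem monomialZ_cons {n : ℕ} (a : ℤ) (e : Fin n → ℤ) (y : Fin (n + 1) → ℝ) :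
    monomialZ (Fin.cons a e) y = y 0 ^ a * monomialZ e (Fin.tail y) := by
  simp [monomialZ, Fin.prod_univ_succ, Fin.tail]

theorem monomialZ_succ {n : ℕ} (e : Fin (n + 1) → ℤ) (y : Fin (n + 1) → ℝ) :
    monomialZ e y = y 0 ^ e 0 * monomialZ (Fin.tail e) (Fin.tail y) := by
  simp [monomialZ, Fin.prod_univ_succ, Fin.tail]

/-- The generating function in `X` of the monomials `y^lam`, weighted by `stripWeight`, over all
`lam` with lower part `k` that differ from `v` by a horizontal strip. -/
def stripSer (s : ℝ) {n : ℕ} (v : Fin (n + 1) → ℤ) (k : Fin n → ℤ) (y : Fin (n + 1) → ℝ) :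
    ℝ⟦X⟧ :=
  PowerSeries.X ^ (∑ i, (k i - v i.succ)).toNat *
    (PowerSeries.C (monomialZ (Fin.cons (v 0) k) y) *
      (PowerSeries.C (stripWeight s (Fin.cons (v 0) k : Fin (n + 1) → ℤ) v) +
        PowerSeries.C (stripWeight s (Fin.cons (v 0 + 1) k : Fin (n + 1) → ℤ) v) *
          tailSer (y 0)))

/-- One step of the Pieri rule, adding a new first row to a horizontal strip: after
symmetrization the rows of the strip can be made to interlace with the new row. -/
theorem symSum_stripSer_step {s : ℝ} (hs : |s| < 1) {n : ℕ} {v : Fin (n + 2) → ℤ}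
    (hv : Antitone v) (h0 : ∀ i, 0 ≤ v i) {x : Fin (n + 2) → ℝ} (hx : Function.Injective x)
    {k : Fin n → ℤ} (hk : k ∈ lowerBox (Fin.tail v)) :
    symSum s x (fun y => kernelSer s (y 0) * PowerSeries.C (y 0 ^ v 0) *
        stripSer s (Fin.tail v) k (Fin.tail y)) =
      symSum s x fun y => ∑ a ∈ Finset.Icc (v 1) (v 0), stripSer s v (Fin.cons a k) y := by
  have hkb : Between k (Fin.tail v) := mem_lowerBox.mp hk
  have hv1 : Antitone (Fin.tail v) := fun i j hij => hv (Fin.succ_le_succ_iff.mpr hij)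
  have hv10 : v 1 ≤ v 0 := hv (Fin.zero_le 1)
  have hle : ∀ i, Fin.tail v i ≤ v 1 := fun i => hv1 (Fin.zero_le i)
  have hkle : ∀ i, k i ≤ v 1 := fun i => (hkb i).2.trans (hle _)
  set A := stripWeight s (Fin.cons (v 1) k : Fin (n + 1) → ℤ) (Fin.tail v) with hA
  set B := stripWeight s (Fin.cons (v 1 + 1) k : Fin (n + 1) → ℤ) (Fin.tail v) with hB
  have hBk : B = (1 - s) * stripWeight s k (Fin.tail v) :=
    stripWeight_cons_left hs (fun i => by have := hkle i; omega)
      (fun i => by have := hle i; omega)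
  set e := (∑ i, (k i - Fin.tail v i.succ)).toNat with he
  have hsum : 0 ≤ ∑ i, (k i - Fin.tail v i.succ) :=
    Finset.sum_nonneg fun i _ => sub_nonneg.mpr (hkb i).1
  -- the weights of the strips with new second row `a`
  have hW : ∀ a ∈ Finset.Icc (v 1) (v 0),
      stripWeight s (Fin.cons a k : Fin (n + 1) → ℤ) (Fin.tail v) = if a = v 1 then A else B := by
    intro a ha
    rw [Finset.mem_Icc] at ha
    split_ifs with h
    · rw [h]
    · rw [hBk]
      exact stripWeight_cons_left hs (fun i => by have := hkle i; omega)
        (fun i => by have := hle i; omega)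
  -- a first row that does not grow leaves the weight unchanged
  have hW0 : ∀ a ∈ Finset.Icc (v 1) (v 0),
      stripWeight s (Fin.cons (v 0) (Fin.cons a k : Fin (n + 1) → ℤ) : Fin (n + 2) → ℤ) v =
        if a = v 1 then A else B := by
    intro a ha
    rw [← hW a ha]
    rw [Finset.mem_Icc] at ha
    rw [← Fin.cons_self_tail v]
    refine stripWeight_cons_cons hs ?_
    rw [Fin.cons_zero, count_cons]
    split_ifs with h
    · have h1 := hkb.count_le (p := v 0) (fun i => (hle i).trans hv10)
      have h2 := hkb.count_le_succ (p := v 0) (fun i => (hle i).trans hv10)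
      omega
    · left
      rw [count_eq_zero fun i => ?_, count_eq_zero fun i => ?_]
      · have := hle i; omega
      · have := hkle i; omega
  -- a first row that grows; the term with `s * B` appears when the second row reaches `v 0`
  have hW1 : ∀ a ∈ Finset.Icc (v 1) (v 0),
      stripWeight s (Fin.cons (v 0 + 1) (Fin.cons a k : Fin (n + 1) → ℤ) : Fin (n + 2) → ℤ) v =
        (1 - s) * (if a = v 1 then A else B) + if a = v 0 then s * B else 0 := by
    intro a ha
    rw [← hW a ha]
    rw [Finset.mem_Icc] at ha
    rw [stripWeight_cons_left hs]
    · conv_lhs => rw [← Fin.cons_self_tail v]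
      rw [stripWeight_cons_right hs hv1 hkb ha.1 ha.2, hBk]
      split_ifs <;> ring
    · intro i
      refine Fin.cases ?_ (fun i => ?_) i
      · rw [Fin.cons_zero]; omega
      · rw [Fin.cons_succ]; have := hkle i; omega
    · intro i
      have := hv (Fin.zero_le i); omega
  set pre : (Fin (n + 2) → ℝ) → ℝ⟦X⟧ := fun y =>
    PowerSeries.C B * PowerSeries.X ^ (e + (v 0 - v 1).toNat) *
      PowerSeries.C ((y 0 ^ v 0 * y 1 ^ v 0) * monomialZ k (Fin.tail (Fin.tail y))) with hpre
  -- Expanding the tail in `y 1` up to exponent `v 0` produces the second rows `a ≤ v 0`. What is left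
  -- over has the second row longer than `v 0`; it is a multiple, symmetric in `y 0` and `y 1`, of an
  -- expression that the symmetrization kills.
  have hdiff : ∀ y : Fin (n + 2) → ℝ,
      kernelSer s (y 0) * PowerSeries.C (y 0 ^ v 0) * stripSer s (Fin.tail v) k (Fin.tail y) =
        (∑ a ∈ Finset.Icc (v 1) (v 0), stripSer s v (Fin.cons a k) y) +
        pre y * (kernelSer s (y 0) * tailSer (y 1) - PowerSeries.C s * tailSer (y 0)) := by
    intro y
    have hR : ∑ a ∈ Finset.Icc (v 1) (v 0), stripSer s v (Fin.cons a k) y =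
        (PowerSeries.X ^ e * PowerSeries.C (y 0 ^ v 0 * monomialZ k (Fin.tail (Fin.tail y))) *
          kernelSer s (y 0)) * (∑ a ∈ Finset.Icc (v 1) (v 0), PowerSeries.X ^ (a - v 1).toNat *
            PowerSeries.C (y 1 ^ a * if a = v 1 then A else B)) +
        pre y * (PowerSeries.C s * tailSer (y 0)) := by
      have hlast : pre y * (PowerSeries.C s * tailSer (y 0)) =
          ∑ a ∈ Finset.Icc (v 1) (v 0), if a = v 0 then
            pre y * (PowerSeries.C s * tailSer (y 0)) else 0 := by
        rw [Finset.sum_ite_eq', if_pos (Finset.right_mem_Icc.mpr hv10)]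
      rw [hlast, Finset.mul_sum, ← Finset.sum_add_distrib]
      refine Finset.sum_congr rfl fun a ha => ?_
      have hexp : (∑ i, ((Fin.cons a k : Fin (n + 1) → ℤ) i - v i.succ)).toNat =
          e + (a - v 1).toNat := by
        rw [Fin.sum_univ_succ]
        simp only [Fin.cons_zero, Fin.cons_succ, Fin.succ_zero_eq_one]
        have h2 : ∑ i, (k i - Fin.tail v i.succ) = ∑ i : Fin n, (k i - v i.succ.succ) := rfl
        rw [Finset.mem_Icc] at ha
        omega
      have hm : monomialZ (Fin.cons (v 0) (Fin.cons a k)) y =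
          y 0 ^ v 0 * (y 1 ^ a * monomialZ k (Fin.tail (Fin.tail y))) := by
        rw [monomialZ_cons, monomialZ_cons]; rfl
      rw [stripSer, hexp, hW0 a ha, hW1 a ha, hm, kernelSer, hpre]
      split_ifs with h1 h2 h2
      all_goals simp only [map_mul, map_add, map_sub, map_one, map_zero, pow_add, h2]
      all_goals ring
    have hL := zpow_mul_tailSer_expand (y 1) A B (h0 1) hv10
    have hm : monomialZ (Fin.cons (v 1) k) (Fin.tail y) =
        y 1 ^ v 1 * monomialZ k (Fin.tail (Fin.tail y)) := by
      rw [monomialZ_cons]; rfl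
    have hS : stripSer s (Fin.tail v) k (Fin.tail y) = PowerSeries.X ^ e *
        (PowerSeries.C (monomialZ k (Fin.tail (Fin.tail y))) * (PowerSeries.C (y 1 ^ v 1) *
          (PowerSeries.C A + PowerSeries.C B * tailSer (y 1)))) := by
      have : stripSer s (Fin.tail v) k (Fin.tail y) = PowerSeries.X ^ e *
        (PowerSeries.C (monomialZ (Fin.cons (v 1) k) (Fin.tail y)) *
          (PowerSeries.C A + PowerSeries.C B * tailSer (y 1))) := rfl
      rw [this, hm, map_mul]
      ring
    rw [hR, hS, hL, hpre]
    simp only [map_mul, pow_add]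
    ring
  refine symSum_eq_of_swap s hx fun y _ => ?_
  have hpres : pre (y ∘ Equiv.swap 0 1) = pre y := by
    have : Fin.tail (Fin.tail (y ∘ Equiv.swap 0 1)) = Fin.tail (Fin.tail y) := by
      funext j
      have hj : Equiv.swap (0 : Fin (n + 2)) 1 j.succ.succ = j.succ.succ :=
        Equiv.swap_apply_of_ne_of_ne (Fin.succ_ne_zero _)
          (fun h => Fin.succ_ne_zero j (Fin.succ_injective _ h))
      simp only [Fin.tail, Function.comp_apply, hj]
    simp only [hpre, this, Function.comp_apply, Equiv.swap_apply_left, Equiv.swap_apply_right]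
    rw [mul_comm (y 1 ^ v 0)]
  rw [hdiff y, hdiff (y ∘ Equiv.swap 0 1), hpres]
  simp only [Function.comp_apply, Equiv.swap_apply_left, Equiv.swap_apply_right, Algebra.smul_def]
  have hsw := kernelSer_tailSer_swap s (y 0) (y 1)
  change PowerSeries.C _ * _ - PowerSeries.C _ * _ = PowerSeries.C _ * _ - PowerSeries.C _ * _
  linear_combination (pre y) * hsw

theorem symSum_fin_one (s : ℝ) {M : Type*} [AddCommGroup M] [Module ℝ M] (x : Fin 1 → ℝ)
    (F : (Fin 1 → ℝ) → M) : symSum s x F = F x := by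
  simp [symSum, crossProd, Finset.prod_eq_one]

/-- The Pieri rule for the symmetrizations of monomials, with all degrees collected in a
generating function. -/
theorem rowSer_mul_symSum {s : ℝ} (hs : |s| < 1) :
    ∀ {n : ℕ} {v : Fin (n + 1) → ℤ}, Antitone v → (∀ i, 0 ≤ v i) →
      ∀ {x : Fin (n + 1) → ℝ}, Function.Injective x →
        rowSer s x * symSum s x (fun y => PowerSeries.C (monomialZ v y)) =
          ∑ k ∈ lowerBox v, symSum s x (stripSer s v k) := by
  intro n
  induction n with
  | zero =>
    intro v hv h0 x hx
    have hbox : lowerBox v = {Fin.elim0} := by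
      ext k; simp [mem_lowerBox, Between, Subsingleton.elim k Fin.elim0]
    have hc : (Fin.cons (v 0) Fin.elim0 : Fin 1 → ℤ) = v := by
      funext i; rw [Fin.fin_one_eq_zero i]; rfl
    have hW0 : stripWeight s v v = 1 :=
      Finset.prod_eq_one fun a _ => localWeight_self hs _
    have hW1 : stripWeight s (Fin.cons (v 0 + 1) (Fin.elim0 : Fin 0 → ℤ) : Fin 1 → ℤ) v =
        1 - s := by
      rw [stripWeight_cons_left hs (fun i => i.elim0)
        (fun i => by rw [Fin.fin_one_eq_zero i]; omega)]
      have h1 : stripWeight s (Fin.elim0 : Fin 0 → ℤ) v =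
          stripWeight s (Fin.elim0 : Fin 0 → ℤ) (Fin.elim0 : Fin 0 → ℤ) := by
        refine stripWeight_congr hs fun a => ?_
        rw [← hc, count_cons]
        have : count (Fin.elim0 : Fin 0 → ℤ) a = 0 := rfl
        rw [this]
        split_ifs
        · rw [localWeight_succ_right hs, localWeight_self hs]
          simp [one_sub_ne_zero hs]
        · rfl
      rw [h1]
      simp [stripWeight]
    rw [hbox, Finset.sum_singleton, symSum_fin_one, symSum_fin_one, stripSer, hc, hW0, hW1]
    simp [rowSer, kernelSer]
    ring
  | succ n ih =>
    intro v hv h0 x hx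
    have hv1 : Antitone (Fin.tail v) := fun i j hij => hv (Fin.succ_le_succ_iff.mpr hij)
    calc rowSer s x * symSum s x (fun y => PowerSeries.C (monomialZ v y))
        = symSum s x (fun y => kernelSer s (y 0) * PowerSeries.C (y 0 ^ v 0) *
            ∑ k ∈ lowerBox (Fin.tail v), stripSer s (Fin.tail v) k (Fin.tail y)) := by
          rw [symSum_succ, symSum_succ, Finset.mul_sum]
          refine Finset.sum_congr rfl fun p _ => ?_
          rw [mul_smul_comm]
          congr 1
          simp only [Fin.cons_zero, Fin.tail_cons, monomialZ_succ v, map_mul]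
          rw [symSum_mul_left, symSum_mul_left, symSum_sum,
            ← ih hv1 (fun i => h0 _) (dropVar_injective p hx), rowSer,
            prod_eq_mul_prod_dropVar p x (kernelSer s), rowSer]
          ring
      _ = ∑ k ∈ lowerBox (Fin.tail v), symSum s x (fun y => kernelSer s (y 0) *
            PowerSeries.C (y 0 ^ v 0) * stripSer s (Fin.tail v) k (Fin.tail y)) := by
          simp only [Finset.mul_sum]
          rw [symSum_sum]
      _ = _ := by
          rw [sum_lowerBox_succ]
          refine Finset.sum_congr rfl fun k hk => ?_
          rw [symSum_stripSer_step hs hv h0 hx hk, symSum_sum]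

/-! ### The Pieri rule for Hall-Littlewood polynomials -/

theorem finite_above {n : ℕ} (nu : Signature n) (d : ℕ) :
    {lam : Signature n | (∀ i, nu.1 i ≤ lam.1 i) ∧ lam.size = nu.size + d}.Finite := by
  refine Set.Finite.of_finite_image (f := Subtype.val) ?_ Subtype.val_injective.injOn
  refine (Set.finite_Icc nu.1 (nu.1 + fun _ => (d : ℤ))).subset ?_
  rintro _ ⟨lam, ⟨h1, h2⟩, rfl⟩
  refine ⟨h1, fun i => ?_⟩
  have h3 : lam.1 i - nu.1 i ≤ ∑ j, (lam.1 j - nu.1 j) :=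
    Finset.single_le_sum (f := fun j => lam.1 j - nu.1 j) (fun j _ => sub_nonneg.mpr (h1 j))
      (Finset.mem_univ i)
  rw [Finset.sum_sub_distrib] at h3
  simp only [Signature.size] at h2
  simp only [Pi.add_apply]
  omega

/-- The signatures that contain `nu` and have `d` more boxes. -/
def above {n : ℕ} (nu : Signature n) (d : ℕ) : Finset (Signature n) := (finite_above nu d).toFinset

theorem mem_above {n : ℕ} {nu lam : Signature n} {d : ℕ} :
    lam ∈ above nu d ↔ (∀ i, nu.1 i ≤ lam.1 i) ∧ lam.size = nu.size + d := by
  simp [above]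

theorem above_zero {n : ℕ} (nu : Signature n) : above nu 0 = {nu} := by
  ext lam
  rw [mem_above, Finset.mem_singleton]
  constructor
  · rintro ⟨h1, h2⟩
    rw [Nat.cast_zero, add_zero] at h2
    refine Subtype.ext (funext fun i => ?_)
    exact ((Finset.sum_eq_sum_iff_of_le fun i _ => h1 i).mp h2.symm i (Finset.mem_univ i)).symm
  · rintro rfl
    simp

theorem Signature.size_mono {n : ℕ} {nu lam : Signature n} (h : ∀ i, nu.1 i ≤ lam.1 i) :
    nu.size ≤ lam.size := Finset.sum_le_sum fun i _ => h i

theorem Signature.IsNonneg.of_le {n : ℕ} {nu lam : Signature n} (hn : nu.IsNonneg)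
    (h : ∀ i, nu.1 i ≤ lam.1 i) : lam.IsNonneg := fun i => (hn i).trans (h i)

theorem hlVSig_eq_prod {s : ℝ} {n : ℕ} (lam : Signature n) {S : Finset ℤ}
    (hS : ∀ i, lam.1 i ∈ S) : hlVSig s lam = ∏ a ∈ S, hlV s (lam.mult a) := by
  refine Finset.prod_subset (fun a ha => ?_) fun a _ ha => ?_
  · obtain ⟨i, -, rfl⟩ := Finset.mem_image.mp ha
    exact hS i
  · have : lam.mult a = 0 := count_eq_zero fun i h =>
      ha (Finset.mem_image.mpr ⟨i, Finset.mem_univ i, h⟩)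
    rw [this, hlV_zero]

theorem hlVSig_ne_zero {s : ℝ} (hs : |s| < 1) {n : ℕ} (lam : Signature n) : hlVSig s lam ≠ 0 :=
  Finset.prod_ne_zero_iff.mpr fun _ _ => hlV_ne_zero hs _

theorem mult_pos_of_mem_parts {n : ℕ} {lam : Signature n} {a : ℤ} (ha : a ∈ lam.parts) :
    0 < lam.mult a := by
  obtain ⟨i, -, rfl⟩ := Finset.mem_image.mp ha
  exact Finset.card_pos.mpr ⟨i, by simp⟩

theorem branchPhi_ne_zero {s : ℝ} (hs : |s| < 1) {n : ℕ} (lam nu : Signature n) :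
    branchPhi s lam nu ≠ 0 := by
  refine Finset.prod_ne_zero_iff.mpr fun a ha => ?_
  obtain ⟨m, hm⟩ := Nat.exists_eq_succ_of_ne_zero
    (mult_pos_of_mem_parts (Finset.mem_filter.mp ha).1).ne'
  rw [hm]
  exact one_sub_pow_ne_zero hs m

theorem stripWeight_eq_branchPhi {s : ℝ} (hs : |s| < 1) {n : ℕ} (lam nu : Signature n) :
    stripWeight s lam.1 nu.1 = branchPhi s lam nu * hlVSig s nu / hlVSig s lam := by
  classical
  set S : Finset ℤ := Finset.univ.image lam.1 ∪ Finset.univ.image nu.1 with hS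
  rw [hlVSig_eq_prod lam (S := S) (by simp [hS]), hlVSig_eq_prod nu (S := S) (by simp [hS]),
    stripWeight_eq_prod hs _ _ (S := S) (by simp [hS]) (by simp [hS])]
  simp only [localWeight]
  rw [Finset.prod_div_distrib, Finset.prod_mul_distrib, branchPhi, Finset.prod_filter]
  congr 2
  symm
  refine Finset.prod_subset (fun a ha => ?_) fun a _ ha => ?_
  · rw [hS]; exact Finset.mem_union_left _ ha
  · have : lam.mult a = 0 := count_eq_zero fun i h =>
      ha (Finset.mem_image.mpr ⟨i, Finset.mem_univ i, h⟩)
    rw [this, if_neg (by omega)]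

theorem hlSymmetrization_eq (s : ℝ) {n : ℕ} (lam : Signature n) (x : Fin n → ℝ) :
    hlSymmetrization s lam x = (hlVSig s lam)⁻¹ * symSum s x (monomialZ lam.1) := by
  rw [hlSymmetrization, symSum]
  congr 1
  refine Finset.sum_congr rfl fun σ _ => ?_
  rw [smul_eq_mul, mul_comm]
  rfl

theorem coeff_stripSer (s : ℝ) (hs : |s| < 1) {n : ℕ} {v : Fin (n + 1) → ℤ} (hv : Antitone v)
    (h0 : ∀ i, 0 ≤ v i) {k : Fin n → ℤ} (hk : Between k v) (y : Fin (n + 1) → ℝ) (d : ℕ) :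
    PowerSeries.coeff d (stripSer s v k y) =
      if ∑ i, (k i - v i.succ) ≤ d then
        stripWeight s (Fin.cons (v 0 + (d - ∑ i, (k i - v i.succ))) k : Fin (n + 1) → ℤ) v *
          monomialZ (Fin.cons (v 0 + (d - ∑ i, (k i - v i.succ))) k) y else 0 := by
  have hE : 0 ≤ ∑ i, (k i - v i.succ) := Finset.sum_nonneg fun i _ => sub_nonneg.mpr (hk i).1
  obtain ⟨e, he⟩ := Int.eq_ofNat_of_zero_le hE
  have hkle : ∀ i, k i ≤ v 0 := fun i => (hk i).2.trans (hv (Fin.zero_le _))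
  rw [stripSer, he, Int.toNat_natCast, PowerSeries.coeff_X_pow_mul', PowerSeries.coeff_C_mul,
    map_add, PowerSeries.coeff_C_mul, PowerSeries.coeff_C, coeff_tailSer]
  simp only [Nat.cast_le]
  split_ifs with h1 h2
  · have : ((d : ℤ) - e) = 0 := by omega
    rw [this, add_zero]
    ring
  · have hde : ((d : ℤ) - e) = ((d - e : ℕ) : ℤ) := by omega
    rw [hde, monomialZ_cons, monomialZ_cons, zpow_add_of_nonneg _ (h0 0) (by positivity),
      zpow_natCast,
      stripWeight_cons_left hs (fun i => by have := hkle i; omega)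
        (fun i => by have := hv (Fin.zero_le i); omega),
      stripWeight_cons_left hs (fun i => by have := hkle i; omega)
        (fun i => by have := hv (Fin.zero_le i); omega)]
    ring
  · rfl

/-- The signatures that differ from `nu` by a horizontal strip of length `d`. -/
def strips {n : ℕ} (nu : Signature n) (d : ℕ) : Finset (Signature n) :=
  @Finset.filter _ nu.InterlacesQ (Classical.decPred _) (above nu d)

theorem mem_strips {n : ℕ} {nu lam : Signature n} {d : ℕ} :
    lam ∈ strips nu d ↔ nu.InterlacesQ lam ∧ lam.size = nu.size + d := by
  rw [strips, @Finset.mem_filter _ _ (Classical.decPred _), mem_above]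
  exact ⟨fun h => ⟨h.2, h.1.2⟩, fun h => ⟨⟨h.1.1, h.2⟩, h.1⟩⟩

theorem interlacesQ_iff_between {n : ℕ} {nu lam : Signature (n + 1)} :
    nu.InterlacesQ lam ↔ nu.1 0 ≤ lam.1 0 ∧ Between (Fin.tail lam.1) nu.1 := by
  constructor
  · rintro ⟨h1, h2⟩
    exact ⟨h1 0, fun i => ⟨h1 i.succ, h2 i.castSucc i.succ (by simp)⟩⟩
  · rintro ⟨h1, h2⟩
    refine ⟨fun i => Fin.cases h1 (fun i => (h2 i).1) i, fun i j hij => ?_⟩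
    obtain ⟨j, rfl⟩ := Fin.exists_succ_eq.mpr (show j ≠ 0 from fun h => by simp [h] at hij)
    have : i = j.castSucc := by ext; simpa using hij
    rw [this]
    exact (h2 j).2

theorem rowSer_mul_symSum_coeff {s : ℝ} (hs : |s| < 1) {n : ℕ} {nu : Signature (n + 1)}
    (hnu : nu.IsNonneg) {x : Fin (n + 1) → ℝ} (hx : Function.Injective x) (d : ℕ) :
    PowerSeries.coeff d (rowSer s x) * symSum s x (monomialZ nu.1) =
      ∑ lam ∈ strips nu d, stripWeight s lam.1 nu.1 * symSum s x (monomialZ lam.1) := by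
  classical
  have h := congrArg (PowerSeries.coeff d) (rowSer_mul_symSum hs nu.2 hnu hx)
  have hC : symSum s x (fun y => PowerSeries.C (monomialZ nu.1 y)) =
      PowerSeries.C (symSum s x (monomialZ nu.1)) :=
    (map_symSum (Algebra.linearMap ℝ ℝ⟦X⟧) s x (monomialZ nu.1)).symm
  rw [hC, PowerSeries.coeff_mul_C, map_sum] at h
  rw [h]
  have h2 : ∀ k ∈ lowerBox nu.1, PowerSeries.coeff d (symSum s x (stripSer s nu.1 k)) =
      if ∑ i, (k i - nu.1 i.succ) ≤ d then
        stripWeight s (Fin.cons (nu.1 0 + (d - ∑ i, (k i - nu.1 i.succ))) k :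
          Fin (n + 1) → ℤ) nu.1 *
          symSum s x (monomialZ (Fin.cons (nu.1 0 + (d - ∑ i, (k i - nu.1 i.succ))) k))
        else 0 := by
    intro k hk
    rw [map_symSum]
    simp only [coeff_stripSer s hs nu.2 hnu (mem_lowerBox.mp hk)]
    split_ifs
    · exact symSum_mul_left s x _ _
    · simp [symSum]
  rw [Finset.sum_congr rfl h2, ← Finset.sum_filter]
  symm
  have hlam : ∀ lam ∈ strips nu d,
      nu.1 0 + (d - ∑ i, (Fin.tail lam.1 i - nu.1 i.succ)) = lam.1 0 := by
    intro lam hl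
    have h3 := (mem_strips.mp hl).2
    simp only [Signature.size, Fin.sum_univ_succ] at h3
    have h4 : ∑ i, (Fin.tail lam.1 i - nu.1 i.succ) = ∑ i, (lam.1 (Fin.succ i) - nu.1 i.succ) :=
      rfl
    rw [h4, Finset.sum_sub_distrib]
    omega
  refine Finset.sum_nbij (fun lam => Fin.tail lam.1) ?_ ?_ ?_ ?_
  · intro lam hl
    have h3 := interlacesQ_iff_between.mp (mem_strips.mp hl).1
    rw [Finset.mem_filter, mem_lowerBox]
    refine ⟨h3.2, ?_⟩
    have := hlam lam hl
    omega
  · intro l1 hl1 l2 hl2 h12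
    simp only at h12
    refine Subtype.ext ?_
    rw [← Fin.cons_self_tail l1.1, ← Fin.cons_self_tail l2.1, ← hlam l1 hl1, ← hlam l2 hl2, h12]
  · intro k hk
    simp only [Finset.coe_filter, Set.mem_ofPred_eq, mem_lowerBox] at hk
    obtain ⟨hk1, hk2⟩ := hk
    set a := nu.1 0 + (d - ∑ i, (k i - nu.1 i.succ)) with ha
    have hanti : Antitone (Fin.cons a k : Fin (n + 1) → ℤ) := by
      rw [Fin.antitone_iff_succ_le]
      intro i
      rw [Fin.cons_succ]
      by_cases h : i.castSucc = 0
      · have h5 := (hk1 i).2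
        rw [h] at h5 ⊢
        rw [Fin.cons_zero]
        omega
      · obtain ⟨j, hj⟩ := Fin.exists_succ_eq.mpr h
        rw [← hj, Fin.cons_succ]
        have h5 := (hk1 i).2
        rw [← hj] at h5
        exact h5.trans (hk1 j).1
    refine ⟨⟨Fin.cons a k, hanti⟩, ?_, by simp⟩
    rw [Finset.mem_coe, mem_strips, interlacesQ_iff_between]
    refine ⟨⟨?_, by simpa using hk1⟩, ?_⟩
    · simp only [Fin.cons_zero]; omega
    · simp only [Signature.size, Fin.sum_univ_succ, Fin.cons_zero, Fin.cons_succ]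
      rw [ha, Finset.sum_sub_distrib]
      omega
  · intro lam hl
    rw [hlam lam hl, Fin.cons_self_tail]

/-- The Pieri rule `q_d(x) P_nu(x) = ∑ φ_{lam/nu} P_lam(x)`, the sum over horizontal strips of
length `d`, at points with distinct coordinates. -/
theorem coeff_rowSer_mul_hlSymmetrization {s : ℝ} (hs : |s| < 1) {n : ℕ} {nu : Signature n}
    (hnu : nu.IsNonneg) {x : Fin n → ℝ} (hx : Function.Injective x) (d : ℕ) :
    PowerSeries.coeff d (rowSer s x) * hlSymmetrization s nu x =
      ∑ lam ∈ strips nu d, branchPhi s lam nu * hlSymmetrization s lam x := by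
  cases n with
  | zero =>
    have hsub : ∀ lam : Signature 0, lam = nu := fun lam => Subtype.ext (Subsingleton.elim _ _)
    have hrow : rowSer s x = 1 := by simp [rowSer]
    have hphi : branchPhi s nu nu = 1 := by simp [branchPhi]
    rw [hrow, PowerSeries.coeff_one]
    split_ifs with h
    · have : strips nu d = {nu} := by
        ext lam
        rw [hsub lam]
        simp [mem_strips, h, Signature.InterlacesQ]
      rw [this, Finset.sum_singleton, hphi]
    · have : strips nu d = ∅ := by
        ext lam
        rw [hsub lam]
        simp [mem_strips, h]
      rw [this, Finset.sum_empty, zero_mul]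
  | succ n =>
    have h := rowSer_mul_symSum_coeff hs hnu hx d
    rw [hlSymmetrization_eq, mul_left_comm, h, Finset.mul_sum]
    refine Finset.sum_congr rfl fun lam _ => ?_
    rw [stripWeight_eq_branchPhi hs, hlSymmetrization_eq]
    have := hlVSig_ne_zero hs nu
    field_simp

/-! ### The Hall-Littlewood polynomial of the empty partition -/

theorem sum_prod_erase_of_ne_zero (s : ℝ) (S : Finset ℝ) (h0 : (0 : ℝ) ∉ S) :
    (1 - s) * ∑ p ∈ S, ∏ q ∈ S.erase p, (p - s * q) / (p - q) = 1 - s ^ S.card := by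
  classical
  -- The difference of two monic polynomials of degree `|S|` has smaller degree, so that Lagrange
  -- interpolation at the points of `S` recovers it; the identity is its value at `0`.
  set f : Polynomial ℝ := ∏ q ∈ S, (Polynomial.X - Polynomial.C (s * q)) -
    ∏ q ∈ S, (Polynomial.X - Polynomial.C q) with hf
  have hdeg : f.degree < S.card := by
    have m1 := Polynomial.monic_prod_X_sub_C (fun q => s * q) S
    have m2 := Polynomial.monic_prod_X_sub_C (fun q => q) S
    have d1 : (∏ q ∈ S, (Polynomial.X - Polynomial.C (s * q))).degree =
        (S.card : WithBot ℕ) := by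
      rw [Polynomial.degree_prod]; simp [-map_mul]
    have d2 : (∏ q ∈ S, (Polynomial.X - Polynomial.C q)).degree =
        (S.card : WithBot ℕ) := by
      rw [Polynomial.degree_prod]; simp
    have := Polynomial.degree_sub_lt_left (d1.trans d2.symm) m1.ne_zero (m1.trans m2.symm)
    rwa [d1] at this
  have hinj : Set.InjOn (id : ℝ → ℝ) S := Function.injective_id.injOn
  have hint := Lagrange.eq_interpolate (v := id) hinj hdeg
  have h1 := congrArg (Polynomial.eval 0) hint
  rw [Lagrange.eval_interpolate_not_at_node _ (fun i hi h => h0 (by rw [h]; exact hi)),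
    Lagrange.eval_nodal] at h1
  have hP : ∏ q ∈ S, (0 - id q) ≠ 0 := Finset.prod_ne_zero_iff.mpr fun q hq h =>
    h0 (by have : q = 0 := by simpa using h
           rwa [← this])
  have hf0 : f.eval 0 = (∏ q ∈ S, (0 - id q)) * (s ^ S.card - 1) := by
    rw [hf, Polynomial.eval_sub, Polynomial.eval_prod, Polynomial.eval_prod]
    have : ∀ q ∈ S, Polynomial.eval 0 (Polynomial.X - Polynomial.C (s * q)) = s * (0 - id q) := by
      intro q _; simp
    rw [Finset.prod_congr rfl this, Finset.prod_mul_distrib, Finset.prod_const]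
    simp only [Polynomial.eval_sub, Polynomial.eval_X, Polynomial.eval_C, id]
    ring
  rw [hf0] at h1
  have h2 := mul_left_cancel₀ hP h1
  have h3 : ∀ p ∈ S, Lagrange.nodalWeight S id p * (0 - id p)⁻¹ * f.eval (id p) =
      -((1 - s) * ∏ q ∈ S.erase p, (p - s * q) / (p - q)) := by
    intro p hp
    have hp0 : p ≠ 0 := fun h => h0 (h ▸ hp)
    have hz : ∏ q ∈ S, Polynomial.eval (id p) (Polynomial.X - Polynomial.C q) = 0 :=
      Finset.prod_eq_zero hp (by simp)
    rw [hf, Polynomial.eval_sub, Polynomial.eval_prod, Polynomial.eval_prod, hz, sub_zero,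
      ← Finset.mul_prod_erase _ _ hp, Lagrange.nodalWeight, Finset.prod_div_distrib,
      Finset.prod_inv_distrib]
    simp only [Polynomial.eval_sub, Polynomial.eval_X, Polynomial.eval_C, id]
    field_simp
    ring
  rw [Finset.sum_congr rfl h3, Finset.sum_neg_distrib, ← Finset.mul_sum] at h2
  linarith

theorem sum_prod_erase (s : ℝ) (S : Finset ℝ) :
    (1 - s) * ∑ p ∈ S, ∏ q ∈ S.erase p, (p - s * q) / (p - q) = 1 - s ^ S.card := by
  classical
  by_cases h0 : (0 : ℝ) ∈ S
  · have h := sum_prod_erase_of_ne_zero s (S.erase 0) (Finset.notMem_erase _ _)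
    have hcard : S.card = (S.erase 0).card + 1 := (Finset.card_erase_add_one h0).symm
    rw [← Finset.add_sum_erase _ _ h0, mul_add, hcard]
    have e1 : ∏ q ∈ S.erase 0, ((0 : ℝ) - s * q) / (0 - q) = s ^ (S.erase 0).card := by
      rw [← Finset.prod_const]
      refine Finset.prod_congr rfl fun q hq => ?_
      have := Finset.ne_of_mem_erase hq
      field_simp
      ring
    have e2 : ∀ p ∈ S.erase 0, ∏ q ∈ S.erase p, (p - s * q) / (p - q) =
        ∏ q ∈ (S.erase 0).erase p, (p - s * q) / (p - q) := by
      intro p hp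
      have hp0 := Finset.ne_of_mem_erase hp
      rw [← Finset.mul_prod_erase (S.erase p) _ (Finset.mem_erase.mpr ⟨hp0.symm, h0⟩),
        Finset.erase_right_comm]
      simp [hp0]
    rw [e1, Finset.sum_congr rfl e2, h]
    ring
  · exact sum_prod_erase_of_ne_zero s S h0

theorem sum_prod_dropVar {s : ℝ} (hs : |s| < 1) {n : ℕ} {x : Fin (n + 1) → ℝ}
    (hx : Function.Injective x) :
    ∑ p, ∏ j, (x p - s * dropVar p x j) / (x p - dropVar p x j) =
      (1 - s ^ (n + 1)) / (1 - s) := by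
  classical
  have h := sum_prod_erase s (Finset.univ.map ⟨x, hx⟩)
  rw [Finset.card_map, Finset.card_univ, Fintype.card_fin, Finset.sum_map] at h
  rw [eq_div_iff (one_sub_ne_zero hs), mul_comm, ← h]
  congr 1
  refine Finset.sum_congr rfl fun p _ => ?_
  rw [← Finset.map_erase, Finset.prod_map]
  have h1 := prod_eq_mul_prod_dropVar p x
    fun q => if q = x p then 1 else (x p - s * q) / (x p - q)
  rw [← Finset.mul_prod_erase _ _ (Finset.mem_univ p), if_pos rfl, one_mul, one_mul] at h1
  have h2 : ∀ j, dropVar p x j ≠ x p := fun j h => by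
    have h3 : Equiv.swap 0 p j.succ = p := hx h
    rw [Equiv.swap_apply_eq_iff, Equiv.swap_apply_right] at h3
    exact Fin.succ_ne_zero j h3
  simp only [h2, if_false] at h1
  rw [← h1]
  refine Finset.prod_congr rfl fun j hj => ?_
  rw [if_neg fun h => Finset.ne_of_mem_erase hj (hx h)]
  rfl

/-- The symmetrization of the constant `1` is the number `V_n(s)`. -/
theorem symSum_one {s : ℝ} (hs : |s| < 1) :
    ∀ {n : ℕ} {x : Fin n → ℝ}, Function.Injective x → symSum s x (fun _ => (1 : ℝ)) = hlV s n := by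
  intro n
  induction n with
  | zero => intro x _; simp [symSum, crossProd, hlV_zero]
  | succ n ih =>
    intro x hx
    rw [symSum_succ]
    simp only [ih (dropVar_injective _ hx), smul_eq_mul]
    rw [← Finset.sum_mul, sum_prod_dropVar hs hx, hlV_succ, mul_comm]

theorem hlSymmetrization_zero {s : ℝ} (hs : |s| < 1) {n : ℕ} {x : Fin n → ℝ}
    (hx : Function.Injective x) : hlSymmetrization s (Signature.zero n) x = 1 := by
  have h1 : hlVSig s (Signature.zero n) = hlV s n := by
    rw [hlVSig_eq_prod (Signature.zero n) (S := {0}) (by simp [Signature.zero]),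
      Finset.prod_singleton]
    simp [Signature.mult, Signature.zero]
  have h2 : monomialZ (Signature.zero n).1 = fun _ => (1 : ℝ) := by
    funext y; simp [monomialZ, Signature.zero]
  rw [hlSymmetrization_eq, h1, h2, symSum_one hs hx, inv_mul_cancel₀ (hlV_ne_zero hs n)]

/-! ### Hall-Littlewood polynomials as polynomials in the one-row functions -/

/-- The signature obtained by deleting the first part and appending a zero. -/
def dropFirst {n : ℕ} (lam : Signature (n + 1)) (h : lam.IsNonneg) : Signature (n + 1) :=
  ⟨Fin.snoc (α := fun _ => ℤ) (Fin.tail lam.1) 0, by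
    rw [Fin.antitone_iff_succ_le]
    intro i
    rw [Fin.snoc_castSucc]
    rcases Fin.eq_castSucc_or_eq_last i.succ with ⟨j, hj⟩ | hj
    · rw [hj, Fin.snoc_castSucc]
      refine lam.2 ?_
      rw [Fin.succ_le_succ_iff]
      have := congrArg Fin.val hj
      simp only [Fin.val_succ, Fin.val_castSucc] at this
      exact Fin.le_def.mpr (by omega)
    · rw [hj, Fin.snoc_last]
      exact h _⟩

theorem size_eq_head_add {n : ℕ} (lam : Signature (n + 1)) :
    lam.size = lam.1 0 + ∑ i, Fin.tail lam.1 i := Fin.sum_univ_succ _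

theorem dropFirst_castSucc {n : ℕ} (lam : Signature (n + 1)) (h : lam.IsNonneg) (i : Fin n) :
    (dropFirst lam h).1 i.castSucc = Fin.tail lam.1 i := 
  Fin.snoc_castSucc (α := fun _ => ℤ) ..

theorem size_dropFirst {n : ℕ} (lam : Signature (n + 1)) (h : lam.IsNonneg) :
    (dropFirst lam h).size = ∑ i, Fin.tail lam.1 i := by
  simp only [Signature.size, dropFirst, Fin.sum_univ_castSucc, Fin.snoc_castSucc, Fin.snoc_last,
    add_zero]

theorem dropFirst_isNonneg {n : ℕ} (lam : Signature (n + 1)) (h : lam.IsNonneg) :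
    (dropFirst lam h).IsNonneg := by
  intro i
  refine Fin.lastCases ?_ (fun i => ?_) i
  · simp [dropFirst]
  · rw [dropFirst_castSucc]; exact h _

theorem dropFirst_interlacesQ {n : ℕ} (lam : Signature (n + 1)) (h : lam.IsNonneg) :
    (dropFirst lam h).InterlacesQ lam := by
  refine ⟨fun i => ?_, fun i j hij => ?_⟩
  · refine Fin.lastCases ?_ (fun i => ?_) i
    · simpa [dropFirst] using h _
    · rw [dropFirst_castSucc]
      exact lam.2 (Fin.castSucc_lt_succ).le
  · obtain ⟨j, rfl⟩ := Fin.exists_succ_eq.mpr (show j ≠ 0 from fun h => by simp [h] at hij)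
    have : i = j.castSucc := by ext; simpa using hij
    rw [this, dropFirst_castSucc]
    exact le_rfl

/-- Every Hall-Littlewood polynomial of a nonnegative signature is a polynomial in the one-row
functions `q_d`. By the Pieri rule, `q_{lam₁} P_nu` with `nu = (lam₂, …, lamₙ, 0)` is a nonzero
multiple of `P_lam` up to terms whose first row is longer than that of `lam`. -/
theorem exists_eval_rowSer {s : ℝ} (hs : |s| < 1) {n : ℕ} (lam : Signature n)
    (hlam : lam.IsNonneg) : ∃ a : MvPolynomial ℕ ℝ, ∀ x : Fin n → ℝ, Function.Injective x →
      hlSymmetrization s lam x =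
        MvPolynomial.eval (fun d => PowerSeries.coeff d (rowSer s x)) a := by
  classical
  have hzero : ∀ lam : Signature n, lam = Signature.zero n → ∃ a : MvPolynomial ℕ ℝ,
      ∀ x : Fin n → ℝ, Function.Injective x → hlSymmetrization s lam x =
        MvPolynomial.eval (fun d => PowerSeries.coeff d (rowSer s x)) a := by
    rintro _ rfl
    exact ⟨1, fun x hx => by rw [hlSymmetrization_zero hs hx, map_one]⟩
  cases n with
  | zero => exact hzero lam (Subtype.ext (Subsingleton.elim _ _))
  | succ n =>
    -- Induction on the size and, for a given size, on the number of boxes below the first row.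
    obtain ⟨N, hN⟩ : ∃ N : ℕ, lam.size = N :=
      Int.eq_ofNat_of_zero_le (Finset.sum_nonneg fun i _ => hlam i)
    induction N using Nat.strong_induction_on generalizing lam with
    | _ N ih =>
      obtain ⟨T, hT⟩ : ∃ T : ℕ, ∑ i, Fin.tail lam.1 i = T :=
        Int.eq_ofNat_of_zero_le (Finset.sum_nonneg fun i _ => hlam (Fin.succ i))
      induction T using Nat.strong_induction_on generalizing lam with
      | _ T ihT =>
        have hsz := size_eq_head_add lam
        by_cases h0 : lam.1 0 = 0
        · refine hzero lam (Subtype.ext (funext fun i => le_antisymm ?_ (hlam i)))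
          have := lam.2 (Fin.zero_le i)
          rwa [h0] at this
        have hpos : 0 < lam.1 0 := lt_of_le_of_ne (hlam 0) (Ne.symm h0)
        set nu := dropFirst lam hlam with hnu
        have hnun := dropFirst_isNonneg lam hlam
        set d := (lam.1 0).toNat with hd
        have hdl : (d : ℤ) = lam.1 0 := Int.toNat_of_nonneg (hlam 0)
        have hsn : nu.size = _ := size_dropFirst lam hlam
        have hmem : lam ∈ strips nu d := by
          rw [mem_strips]
          exact ⟨dropFirst_interlacesQ lam hlam, by omega⟩
        obtain ⟨a, ha⟩ := ih T (by omega) nu hnun (by omega)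
        have hother : ∀ l ∈ (strips nu d).erase lam, ∃ a : MvPolynomial ℕ ℝ,
            ∀ x : Fin (n + 1) → ℝ, Function.Injective x → hlSymmetrization s l x =
              MvPolynomial.eval (fun d => PowerSeries.coeff d (rowSer s x)) a := by
          intro l hl
          rw [Finset.mem_erase, mem_strips] at hl
          obtain ⟨hne, hint, hsize⟩ := hl
          have hln : l.IsNonneg := hnun.of_le hint.1
          have htail : ∀ i, Fin.tail l.1 i ≤ Fin.tail lam.1 i := fun i => by
            rw [← dropFirst_castSucc lam hlam]
            exact ((interlacesQ_iff_between.mp hint).2 i).2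
          have hlsz := size_eq_head_add l
          obtain ⟨T', hT'⟩ : ∃ T' : ℕ, ∑ i, Fin.tail l.1 i = T' :=
            Int.eq_ofNat_of_zero_le (Finset.sum_nonneg fun i _ => hln (Fin.succ i))
          have hle : ∑ i, Fin.tail l.1 i ≤ ∑ i, Fin.tail lam.1 i :=
            Finset.sum_le_sum fun i _ => htail i
          refine ihT T' ?_ l hln (by omega) hT'
          rcases lt_or_eq_of_le hle with h | h
          · omega
          · exfalso
            have h1 := (Finset.sum_eq_sum_iff_of_le fun i _ => htail i).mp h
            refine hne (Subtype.ext ?_)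
            rw [← Fin.cons_self_tail l.1, ← Fin.cons_self_tail lam.1]
            have h2 : l.1 0 = lam.1 0 := by omega
            have h3 : Fin.tail l.1 = Fin.tail lam.1 := funext fun i => h1 i (Finset.mem_univ i)
            rw [h2, h3]
        choose! b hb using hother
        refine ⟨MvPolynomial.C (branchPhi s lam nu)⁻¹ * (MvPolynomial.X d * a -
          ∑ l ∈ (strips nu d).erase lam, MvPolynomial.C (branchPhi s l nu) * b l), ?_⟩
        intro x hx
        have hp := coeff_rowSer_mul_hlSymmetrization hs hnun hx d
        rw [← Finset.add_sum_erase _ _ hmem, ha x hx] at hp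
        simp only [map_mul, map_sub, map_sum, MvPolynomial.eval_C, MvPolynomial.eval_X]
        rw [hp, Finset.sum_congr rfl fun l hl => by rw [hb l hl x hx], add_sub_cancel_right,
          ← mul_assoc, inv_mul_cancel₀ (branchPhi_ne_zero hs lam nu), one_mul]

/-! ### Values at points with repeated or vanishing coordinates -/

theorem eventually_add_mul_ne_zero (a : ℝ) {b : ℝ} (hb : b ≠ 0) :
    ∀ᶠ ε in 𝓝[≠] (0 : ℝ), a + ε * b ≠ 0 := by
  by_cases ha : a = 0
  · filter_upwards [self_mem_nhdsWithin] with ε hε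
    simpa [ha, hb] using hε
  · have : Tendsto (fun ε : ℝ => a + ε * b) (𝓝[≠] 0) (𝓝 a) := by
      have : Tendsto (fun ε : ℝ => a + ε * b) (𝓝 0) (𝓝 (a + 0 * b)) :=
        (continuous_const.add (continuous_id.mul continuous_const)).tendsto 0
      rw [zero_mul, add_zero] at this
      exact this.mono_left nhdsWithin_le_nhds
    exact this.eventually_ne ha

/-- Points with distinct nonzero coordinates. -/
def Generic {n : ℕ} (x : Fin n → ℝ) : Prop := Function.Injective x ∧ ∀ i, x i ≠ 0

theorem dense_generic {n : ℕ} : Dense {x : Fin n → ℝ | Generic x} := by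
  intro x
  -- The points `x + ε (1, 2, …, n)` are generic for all but finitely many `ε`.
  have ht : Tendsto (fun ε : ℝ => fun i : Fin n => x i + ε * ((i : ℕ) + 1)) (𝓝[≠] 0) (𝓝 x) := by
    have hc : Continuous fun ε : ℝ => fun i : Fin n => x i + ε * ((i : ℕ) + 1 : ℝ) := by fun_prop
    have := hc.tendsto 0
    simp only [zero_mul, add_zero] at this
    exact this.mono_left nhdsWithin_le_nhds
  refine mem_closure_of_tendsto ht ?_
  have h1 : ∀ᶠ ε in 𝓝[≠] (0 : ℝ), ∀ i : Fin n, x i + ε * ((i : ℕ) + 1) ≠ 0 :=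
    eventually_all.mpr fun i => eventually_add_mul_ne_zero _ (by positivity)
  have h2 : ∀ᶠ ε in 𝓝[≠] (0 : ℝ), ∀ i j : Fin n, i ≠ j →
      (x i - x j) + ε * ((i : ℕ) - (j : ℕ)) ≠ 0 :=
    eventually_all.mpr fun i => eventually_all.mpr fun j => by
      by_cases hij : i = j
      · simp [hij]
      · have : ((i : ℕ) : ℝ) - (j : ℕ) ≠ 0 := by
          rw [sub_ne_zero, Ne, Nat.cast_inj]
          exact fun h => hij (Fin.ext h)
        filter_upwards [eventually_add_mul_ne_zero (x i - x j) this] with ε hε _ using hε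
  filter_upwards [h1, h2] with ε hε1 hε2
  refine ⟨fun i j hij => ?_, hε1⟩
  by_contra hne
  refine hε2 i j hne ?_
  simp only at hij
  linear_combination hij

instance neBot_nhdsWithin_injective {n : ℕ} (x : Fin n → ℝ) :
    (𝓝[{y | Function.Injective y}] x).NeBot :=
  mem_closure_iff_nhdsWithin_neBot.mp (closure_mono (fun _ h => h.1) (dense_generic x))

theorem continuous_coeff_rowSer (s : ℝ) {n : ℕ} (d : ℕ) :
    Continuous fun x : Fin n → ℝ => PowerSeries.coeff d (rowSer s x) := by
  simp only [rowSer, PowerSeries.coeff_prod, coeff_kernelSer]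
  refine continuous_finsetSum _ fun l _ => continuous_finsetProd _ fun i _ => ?_
  split_ifs <;> fun_prop

theorem exists_hlP_eq_eval {s : ℝ} (hs : |s| < 1) {n : ℕ} {lam : Signature n}
    (hlam : lam.IsNonneg) : ∃ a : MvPolynomial ℕ ℝ,
      (∀ x, hlP s lam x = MvPolynomial.eval (fun d => PowerSeries.coeff d (rowSer s x)) a) ∧
      ∀ x, Function.Injective x → hlP s lam x = hlSymmetrization s lam x := by
  obtain ⟨a, ha⟩ := exists_eval_rowSer hs lam hlam
  have hc : Continuous fun x : Fin n → ℝ =>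
      MvPolynomial.eval (fun d => PowerSeries.coeff d (rowSer s x)) a :=
    (MvPolynomial.continuous_eval a).comp (continuous_pi fun d => continuous_coeff_rowSer s d)
  have key : ∀ x, hlP s lam x =
      MvPolynomial.eval (fun d => PowerSeries.coeff d (rowSer s x)) a := by
    intro x
    refine Tendsto.limUnder_eq (((hc.tendsto x).mono_left nhdsWithin_le_nhds).congr' ?_)
    filter_upwards [self_mem_nhdsWithin] with y hy
    exact (ha y hy).symm
  exact ⟨a, key, fun x hx => (key x).trans (ha x hx).symm⟩

theorem hlP_eq_hlSymmetrization {s : ℝ} (hs : |s| < 1) {n : ℕ} {lam : Signature n}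
    (hlam : lam.IsNonneg) {x : Fin n → ℝ} (hx : Function.Injective x) :
    hlP s lam x = hlSymmetrization s lam x := by
  obtain ⟨a, -, h⟩ := exists_hlP_eq_eval hs hlam
  exact h x hx

theorem continuous_hlP {s : ℝ} (hs : |s| < 1) {n : ℕ} {lam : Signature n}
    (hlam : lam.IsNonneg) : Continuous fun x => hlP s lam x := by
  obtain ⟨a, h, -⟩ := exists_hlP_eq_eval hs hlam
  simp only [h]
  exact (MvPolynomial.continuous_eval a).comp
    (continuous_pi fun d => continuous_coeff_rowSer s d)

theorem hlP_zero {s : ℝ} (hs : |s| < 1) {n : ℕ} (x : Fin n → ℝ) :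
    hlP s (Signature.zero n) x = 1 := by
  have h0 : (Signature.zero n).IsNonneg := fun _ => le_rfl
  exact congrFun ((continuous_hlP hs h0).ext_on dense_generic continuous_const fun y hy => by
    simp only
    rw [hlP_eq_hlSymmetrization hs h0 hy.1, hlSymmetrization_zero hs hy.1]) x

theorem isNonneg_of_mem_strips {n : ℕ} {nu lam : Signature n} (hnu : nu.IsNonneg) {d : ℕ}
    (h : lam ∈ strips nu d) : lam.IsNonneg := hnu.of_le (mem_strips.mp h).1.1

/-- The Pieri rule at all points. -/
theorem coeff_rowSer_mul_hlP {s : ℝ} (hs : |s| < 1) {n : ℕ} {nu : Signature n}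
    (hnu : nu.IsNonneg) (x : Fin n → ℝ) (d : ℕ) :
    PowerSeries.coeff d (rowSer s x) * hlP s nu x =
      ∑ lam ∈ strips nu d, branchPhi s lam nu * hlP s lam x := by
  refine congrFun (Continuous.ext_on dense_generic
    ((continuous_coeff_rowSer s d).mul (continuous_hlP hs hnu))
    (continuous_finsetSum _ fun lam hl =>
      continuous_const.mul (continuous_hlP hs (isNonneg_of_mem_strips hnu hl)))
    fun y hy => ?_) x
  change _ * hlP s nu y = ∑ lam ∈ strips nu d, branchPhi s lam nu * hlP s lam y
  rw [hlP_eq_hlSymmetrization hs hnu hy.1, coeff_rowSer_mul_hlSymmetrization hs hnu hy.1]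
  exact Finset.sum_congr rfl fun lam hl => by
    rw [hlP_eq_hlSymmetrization hs (isNonneg_of_mem_strips hnu hl) hy.1]

theorem Generic.smul {n : ℕ} {x : Fin n → ℝ} (hx : Generic x) {r : ℝ} (hr : r ≠ 0) :
    Generic (r • x) :=
  ⟨fun _ _ h => hx.1 (mul_left_cancel₀ hr h), fun i => mul_ne_zero hr (hx.2 i)⟩

theorem zpow_sum {n : ℕ} {r : ℝ} (hr : r ≠ 0) (e : Fin n → ℤ) : ∏ i, r ^ e i = r ^ ∑ i, e i := by
  induction n with
  | zero => simp
  | succ n ih => rw [Fin.prod_univ_succ, ih, Fin.sum_univ_succ, zpow_add₀ hr]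

theorem symSum_smul (s : ℝ) {n : ℕ} (e : Fin n → ℤ) (x : Fin n → ℝ) {r : ℝ} (hr : r ≠ 0) :
    symSum s (r • x) (monomialZ e) = r ^ (∑ i, e i) * symSum s x (monomialZ e) := by
  rw [symSum, symSum, Finset.mul_sum]
  refine Finset.sum_congr rfl fun σ _ => ?_
  have h1 : crossProd s ((r • x) ∘ σ) = crossProd s (x ∘ σ) := by
    refine Finset.prod_congr rfl fun i _ => Finset.prod_congr rfl fun j _ => ?_
    simp only [Function.comp_apply, Pi.smul_apply, smul_eq_mul]
    rw [show r * x (σ i) - s * (r * x (σ j)) = r * (x (σ i) - s * x (σ j)) by ring, ← mul_sub,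
      mul_div_mul_left _ _ hr]
  have h2 : monomialZ e ((r • x) ∘ σ) = r ^ (∑ i, e i) * monomialZ e (x ∘ σ) := by
    rw [monomialZ, monomialZ, ← zpow_sum hr, ← Finset.prod_mul_distrib]
    refine Finset.prod_congr rfl fun i _ => ?_
    simp only [Function.comp_apply, Pi.smul_apply, smul_eq_mul]
    rw [mul_zpow]
  rw [h1, h2, smul_eq_mul, smul_eq_mul]
  ring

theorem hlSymmetrization_smul (s : ℝ) {n : ℕ} (lam : Signature n) (x : Fin n → ℝ) {r : ℝ}
    (hr : r ≠ 0) :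
    hlSymmetrization s lam (r • x) = r ^ lam.size * hlSymmetrization s lam x := by
  rw [hlSymmetrization_eq, hlSymmetrization_eq, symSum_smul s _ x hr, mul_left_comm]
  rfl

theorem hlP_smul {s : ℝ} (hs : |s| < 1) {n : ℕ} {lam : Signature n} (hlam : lam.IsNonneg)
    (x : Fin n → ℝ) {r : ℝ} (hr : r ≠ 0) : hlP s lam (r • x) = r ^ lam.size * hlP s lam x := by
  refine congrFun (Continuous.ext_on dense_generic
    ((continuous_hlP hs hlam).comp (continuous_const_smul r))
    (continuous_const.mul (continuous_hlP hs hlam)) fun y hy => ?_) x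
  change hlP s lam (r • y) = r ^ lam.size * hlP s lam y
  rw [hlP_eq_hlSymmetrization hs hlam (hy.smul hr).1, hlP_eq_hlSymmetrization hs hlam hy.1,
    hlSymmetrization_smul s lam y hr]

/-! ### Signatures with negative parts -/

/-- The signature with `c` added to all parts. -/
def shift {n : ℕ} (lam : Signature n) (c : ℤ) : Signature n :=
  ⟨fun i => lam.1 i + c, fun _ _ h => add_le_add_left (lam.2 h) c⟩

theorem hlVSig_shift (s : ℝ) {n : ℕ} (lam : Signature n) (c : ℤ) :
    hlVSig s (shift lam c) = hlVSig s lam := by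
  classical
  rw [hlVSig_eq_prod (shift lam c) (S := lam.parts.map (addRightEmbedding c)) fun i => by
    simp [shift, Signature.parts], Finset.prod_map, hlVSig]
  refine Finset.prod_congr rfl fun a _ => ?_
  congr 1
  simp [Signature.mult, shift]

theorem hlSymmetrization_shift (s : ℝ) {n : ℕ} (lam : Signature n) (c : ℤ) {x : Fin n → ℝ}
    (hx : ∀ i, x i ≠ 0) :
    hlSymmetrization s (shift lam c) x = (∏ i, x i) ^ c * hlSymmetrization s lam x := by
  rw [hlSymmetrization_eq, hlSymmetrization_eq, hlVSig_shift, mul_left_comm,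
    ← symSum_mul_left s x ((∏ i, x i) ^ c)]
  congr 1
  refine symSum_congr (M := ℝ) s fun σ => ?_
  rw [monomialZ, monomialZ, ← Equiv.prod_comp σ x, ← Finset.prod_zpow, ← Finset.prod_mul_distrib]
  refine Finset.prod_congr rfl fun i _ => ?_
  simp only [shift, Function.comp_apply]
  rw [zpow_add₀ (hx _), mul_comm]

theorem exists_shift_isNonneg {n : ℕ} (lam : Signature n) : ∃ c : ℕ, (shift lam c).IsNonneg := by
  refine ⟨∑ i, (lam.1 i).natAbs, fun i => ?_⟩
  have : (lam.1 i).natAbs ≤ ∑ i, (lam.1 i).natAbs :=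
    Finset.single_le_sum (f := fun i => (lam.1 i).natAbs) (fun _ _ => Nat.zero_le _)
      (Finset.mem_univ i)
  simp only [shift]
  omega

theorem hlP_eq_hlSymmetrization_of_generic {s : ℝ} (hs : |s| < 1) {n : ℕ} (lam : Signature n)
    {x : Fin n → ℝ} (hx : Generic x) : hlP s lam x = hlSymmetrization s lam x := by
  obtain ⟨c, hc⟩ := exists_shift_isNonneg lam
  have hprod : ∏ i, x i ≠ 0 := Finset.prod_ne_zero_iff.mpr fun i _ => hx.2 i
  -- `P_lam` is the quotient of a Hall-Littlewood polynomial with nonnegative exponents by a power of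
  -- `y₁ ⋯ yₙ`.
  have hform : ∀ y : Fin n → ℝ, (∀ i, y i ≠ 0) → Function.Injective y →
      hlSymmetrization s lam y = (∏ i, y i) ^ (-(c : ℤ)) * hlP s (shift lam c) y := by
    intro y hy hyi
    rw [hlP_eq_hlSymmetrization hs hc hyi, hlSymmetrization_shift s lam c hy, ← mul_assoc,
      ← zpow_add₀ (Finset.prod_ne_zero_iff.mpr fun i _ => hy i), neg_add_cancel, zpow_zero,
      one_mul]
  rw [hform x hx.2 hx.1]
  refine Tendsto.limUnder_eq (f := 𝓝[{y | Function.Injective y}] x) ?_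
  have hne : ∀ᶠ y in 𝓝[{y | Function.Injective y}] x, ∀ i, y i ≠ 0 :=
    eventually_all.mpr fun i => nhdsWithin_le_nhds
      ((continuous_apply i).tendsto x |>.eventually_ne (hx.2 i))
  have ht : Tendsto (fun y : Fin n → ℝ => (∏ i, y i) ^ (-(c : ℤ)) * hlP s (shift lam c) y)
      (𝓝[{y | Function.Injective y}] x)
      (𝓝 ((∏ i, x i) ^ (-(c : ℤ)) * hlP s (shift lam c) x)) := by
    refine Tendsto.mono_left (Tendsto.mul ?_ ((continuous_hlP hs hc).tendsto x))
      nhdsWithin_le_nhds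
    exact ((continuous_finsetProd _ fun i _ => continuous_apply i).tendsto x).zpow₀ _
      (Or.inl hprod)
  refine ht.congr' ?_
  filter_upwards [hne, self_mem_nhdsWithin] with y hy hyi
  exact (hform y hy hyi).symm

/-! ### Linear independence of Hall-Littlewood polynomials -/

theorem symSum_comp_perm (s : ℝ) {M : Type*} [AddCommGroup M] [Module ℝ M] {n : ℕ}
    (x : Fin n → ℝ) (π : Equiv.Perm (Fin n)) (F : (Fin n → ℝ) → M) :
    symSum s (x ∘ π) F = symSum s x F := by
  exact Equiv.sum_comp (Equiv.mulLeft π) fun σ => crossProd s (x ∘ σ) • F (x ∘ σ)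

theorem dropVar_cons_succ {n : ℕ} (a : ℝ) (x : Fin (n + 1) → ℝ) (q : Fin (n + 1)) :
    dropVar q.succ (Fin.cons a x : Fin (n + 2) → ℝ) ∘ Equiv.swap 0 q =
      Fin.cons a (dropVar q x) := by
  have h : ∀ i, dropVar q.succ (Fin.cons a x : Fin (n + 2) → ℝ) i = if i = q then a else x i := by
    intro i
    rw [dropVar]
    split_ifs with hi
    · rw [hi, Equiv.swap_apply_right, Fin.cons_zero]
    · rw [Equiv.swap_apply_of_ne_of_ne (Fin.succ_ne_zero i)
        (fun h => hi (Fin.succ_injective _ h)), Fin.cons_succ]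
  funext j
  rw [Function.comp_apply, h]
  refine Fin.cases ?_ (fun j => ?_) j
  · simp
  · rw [Fin.cons_succ, if_neg]
    · rfl
    · rw [Equiv.swap_apply_eq_iff, Equiv.swap_apply_right]
      exact Fin.succ_ne_zero j

theorem cons_zero_injective {n : ℕ} {x : Fin n → ℝ} (hx : Generic x) :
    Function.Injective (Fin.cons 0 x : Fin (n + 1) → ℝ) :=
  Fin.cons_injective_iff.mpr ⟨fun ⟨i, hi⟩ => hx.2 i hi, hx.1⟩

theorem Generic.dropVar {n : ℕ} {x : Fin (n + 1) → ℝ} (hx : Generic x) (p : Fin (n + 1)) :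
    Generic (dropVar p x) := ⟨dropVar_injective p hx.1, fun _ => hx.2 _⟩

/-- Setting a variable to zero in the symmetrization of a monomial whose last exponent is zero. -/
theorem symSum_cons_zero {s : ℝ} (hs : |s| < 1) :
    ∀ {n : ℕ} {v : Fin (n + 1) → ℤ}, Antitone v → v (Fin.last n) = 0 →
      ∀ {x : Fin n → ℝ}, Generic x →
        symSum s (Fin.cons 0 x : Fin (n + 1) → ℝ) (monomialZ v) =
          (1 - s ^ count v 0) / (1 - s) * symSum s x (monomialZ (Fin.init v)) := by
  intro n
  induction n with
  | zero =>
    intro v _ hv x _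
    have h0 : v 0 = 0 := hv
    have hc : count v 0 = 1 := by
      rw [count, Finset.filter_true_of_mem fun i _ => by rw [Fin.fin_one_eq_zero i, h0]]
      rfl
    rw [symSum_fin_one, hc, pow_one, div_self (one_sub_ne_zero hs)]
    simp [monomialZ, symSum, crossProd, h0]
  | succ n ih =>
    intro v hv hlast x hx
    by_cases h0 : v 0 = 0
    · have hall : v = fun _ => 0 := by
        funext i
        refine le_antisymm ?_ ?_
        · rw [← h0]; exact hv (Fin.zero_le i)
        · rw [← hlast]; exact hv (Fin.le_last i)
      have hinit : Fin.init v = fun _ => (0 : ℤ) := by rw [hall]; rfl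
      have hm : ∀ m : ℕ, monomialZ (fun _ : Fin m => (0 : ℤ)) = fun _ => (1 : ℝ) := fun m => by
        funext y; simp [monomialZ]
      have hc : count (fun _ : Fin (n + 2) => (0 : ℤ)) 0 = n + 2 := by simp [count]
      rw [hinit, hall, hm, hm, hc, symSum_one hs (cons_zero_injective hx), symSum_one hs hx.1,
        hlV_succ, mul_comm]
    · have hpos : 0 < v 0 := lt_of_le_of_ne (by rw [← hlast]; exact hv (Fin.zero_le _)) (Ne.symm h0)
      have hv1 : Antitone (Fin.tail v) := fun _ _ hij => hv (Fin.succ_le_succ_iff.mpr hij)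
      have hcount : count v 0 = count (Fin.tail v) 0 := by
        conv_lhs => rw [← Fin.cons_self_tail v]
        rw [count_cons_of_ne h0]
      rw [symSum_succ, Fin.sum_univ_succ, symSum_succ s x, Finset.mul_sum]
      -- The terms with the variable `0` in first place vanish since the first exponent is positive.
      have hz : symSum s (dropVar 0 (Fin.cons 0 x : Fin (n + 2) → ℝ)) (fun y =>
          monomialZ v (Fin.cons ((Fin.cons 0 x : Fin (n + 2) → ℝ) 0) y)) = 0 := by
        simp only [Fin.cons_zero, monomialZ_succ v, zero_zpow _ h0, zero_mul]
        simp [symSum]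
      rw [hz, smul_zero, zero_add]
      refine Finset.sum_congr rfl fun q _ => ?_
      rw [Fin.cons_succ, ← Equiv.prod_comp (Equiv.swap 0 q),
        ← symSum_comp_perm s _ (Equiv.swap 0 q)]
      have hd : ∀ j, dropVar q.succ (Fin.cons 0 x : Fin (n + 2) → ℝ) (Equiv.swap 0 q j) =
          (Fin.cons 0 (dropVar q x) : Fin (n + 1) → ℝ) j :=
        fun j => congrFun (dropVar_cons_succ 0 x q) j
      simp only [hd]
      rw [dropVar_cons_succ, Fin.prod_univ_succ]
      simp only [Fin.cons_zero, Fin.cons_succ, mul_zero, sub_zero, div_self (hx.2 q), one_mul,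
        monomialZ_succ v, Fin.tail_cons]
      rw [symSum_mul_left, ih hv1 hlast (hx.dropVar q), hcount]
      have hi : ∀ y : Fin n → ℝ, monomialZ (Fin.init v) (Fin.cons (x q) y) =
          x q ^ v 0 * monomialZ (Fin.init (Fin.tail v)) y := fun y => by
        rw [monomialZ_succ, Fin.tail_cons, Fin.cons_zero, Fin.tail_init_eq_init_tail]
        rfl
      simp only [hi]
      rw [symSum_mul_left, smul_eq_mul, smul_eq_mul]
      ring

/-- The signature without its last part. -/
def dropLast {n : ℕ} (lam : Signature (n + 1)) : Signature n :=
  ⟨Fin.init lam.1, fun _ _ h => lam.2 (Fin.castSucc_le_castSucc_iff.mpr h)⟩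

theorem mult_zero_dropLast {n : ℕ} (lam : Signature (n + 1)) (h : lam.1 (Fin.last n) = 0) :
    lam.mult 0 = (dropLast lam).mult 0 + 1 := by
  simp only [Signature.mult, Finset.card_filter, Fin.sum_univ_castSucc, h, if_true]
  rfl

theorem hlVSig_dropLast {s : ℝ} {n : ℕ} (lam : Signature (n + 1))
    (h : lam.1 (Fin.last n) = 0) :
    hlVSig s lam = hlVSig s (dropLast lam) * ((1 - s ^ lam.mult 0) / (1 - s)) := by
  classical
  have hmem : (0 : ℤ) ∈ lam.parts := Finset.mem_image.mpr ⟨_, Finset.mem_univ _, h⟩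
  rw [hlVSig_eq_prod (dropLast lam) (S := lam.parts)
    (fun i => Finset.mem_image_of_mem _ (Finset.mem_univ _)), hlVSig,
    ← Finset.mul_prod_erase _ _ hmem, ← Finset.mul_prod_erase _ _ hmem, mult_zero_dropLast lam h,
    hlV_succ]
  have : ∀ a ∈ lam.parts.erase 0, lam.mult a = (dropLast lam).mult a := by
    intro a ha
    have ha0 := Finset.ne_of_mem_erase ha
    simp only [Signature.mult, Finset.card_filter, Fin.sum_univ_castSucc, h]
    rw [if_neg ha0.symm, add_zero]
    rfl
  rw [Finset.prod_congr rfl fun a ha => by rw [this a ha]]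
  ring

/-- Stability: `P_lam(0, x₁, …, xₙ) = P_lam(x₁, …, xₙ)` if the last part of `lam` is zero. -/
theorem hlSymmetrization_cons_zero {s : ℝ} (hs : |s| < 1) {n : ℕ} (lam : Signature (n + 1))
    (h : lam.1 (Fin.last n) = 0) {x : Fin n → ℝ} (hx : Generic x) :
    hlSymmetrization s lam (Fin.cons 0 x) = hlSymmetrization s (dropLast lam) x := by
  have h1 := symSum_cons_zero hs lam.2 h hx
  have h2 : (1 - s ^ lam.mult 0) / (1 - s) ≠ 0 := by
    rw [mult_zero_dropLast lam h]
    exact div_ne_zero (one_sub_pow_ne_zero hs _) (one_sub_ne_zero hs)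
  have h3 := hlVSig_ne_zero hs (dropLast lam)
  rw [hlSymmetrization_eq, hlSymmetrization_eq, h1, hlVSig_dropLast lam h]
  change (hlVSig s (dropLast lam) * ((1 - s ^ lam.mult 0) / (1 - s)))⁻¹ *
    ((1 - s ^ lam.mult 0) / (1 - s) * symSum s x (monomialZ (dropLast lam).1)) = _
  rw [mul_inv, mul_assoc, inv_mul_cancel_left₀ h2]

theorem hlSymmetrization_cons_zero_of_pos {s : ℝ} {n : ℕ} (lam : Signature (n + 1))
    (h : 0 < lam.1 (Fin.last n)) (x : Fin n → ℝ) :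
    hlSymmetrization s lam (Fin.cons 0 x) = 0 := by
  rw [hlSymmetrization_eq]
  refine mul_eq_zero_of_right _ (Finset.sum_eq_zero fun σ _ => ?_)
  have : monomialZ lam.1 ((Fin.cons 0 x : Fin (n + 1) → ℝ) ∘ σ) = 0 := by
    refine Finset.prod_eq_zero (Finset.mem_univ (σ.symm 0)) ?_
    have : 0 < lam.1 (σ.symm 0) := h.trans_le (lam.2 (Fin.le_last _))
    simp [zero_zpow _ this.ne']
  rw [this, smul_zero]

/-- Hall-Littlewood polynomials of distinct signatures are linearly independent as functions on
generic points. Dividing by a power of `x₁ ⋯ xₙ` makes the smallest part that occurs equal to zero;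
then one variable is set to zero. -/
theorem eq_zero_of_sum_hlSymmetrization {s : ℝ} (hs : |s| < 1) {ι : Type} :
    ∀ {n : ℕ} (S : Finset ι) (f : ι → Signature n) (c : ι → ℝ), Set.InjOn f S →
      (∀ x : Fin n → ℝ, Generic x → ∑ i ∈ S, c i * hlSymmetrization s (f i) x = 0) →
        ∀ i ∈ S, c i = 0 := by
  classical
  intro n
  induction n with
  | zero =>
    intro S f c hinj h i hi
    have h1 := h Fin.elim0 ⟨fun i => i.elim0, fun i => i.elim0⟩
    have hS : S = {i} := by
      ext j
      rw [Finset.mem_singleton]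
      exact ⟨fun hj => hinj hj hi (Subtype.ext (Subsingleton.elim _ _)), fun h => h ▸ hi⟩
    have hf : f i = Signature.zero 0 := Subtype.ext (Subsingleton.elim _ _)
    rw [hS, Finset.sum_singleton, hf, hlSymmetrization_zero hs (fun i => i.elim0), mul_one] at h1
    exact h1
  | succ n ih =>
    intro S f c hinj h
    by_contra! hne
    obtain ⟨i1, hi1, hci1⟩ := hne
    -- Let `m` be the smallest last part among the signatures that occur, and subtract `m` from all
    -- parts.
    set S0 := S.filter fun i => c i ≠ 0 with hS0
    have hS0ne : S0.Nonempty := ⟨i1, Finset.mem_filter.mpr ⟨hi1, hci1⟩⟩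
    obtain ⟨i0, hi0, hmin⟩ := Finset.exists_min_image S0 (fun i => (f i).1 (Fin.last n)) hS0ne
    set m := (f i0).1 (Fin.last n) with hm
    set g : ι → Signature (n + 1) := fun i => shift (f i) (-m) with hg
    have hgn : ∀ i ∈ S0, (g i).IsNonneg := fun i hi j => by
      have h1 := hmin i hi
      have h2 := (f i).2 (Fin.le_last j)
      simp only [hg, shift]
      omega
    have hsum0 : ∀ x : Fin (n + 1) → ℝ, Generic x →
        ∑ i ∈ S0, c i * hlP s (g i) x = 0 := by
      intro x hx
      have h1 := h x hx
      rw [← Finset.sum_filter_add_sum_filter_not S (fun i => c i ≠ 0)] at h1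
      rw [Finset.sum_eq_zero (s := S.filter fun i => ¬ c i ≠ 0) fun i hi => by
        have : c i = 0 := not_not.mp (Finset.mem_filter.mp hi).2
        rw [this, zero_mul], add_zero] at h1
      rw [Finset.sum_congr rfl fun i hi => by
        rw [hlP_eq_hlSymmetrization hs (hgn i hi) hx.1, hlSymmetrization_shift s (f i) (-m) hx.2,
          mul_left_comm], ← Finset.mul_sum, h1, mul_zero]
    -- The relation extends by continuity to all points, in particular to those with a zero
    -- coordinate, where only the signatures with last part `m` survive.
    have hall : ∀ x : Fin (n + 1) → ℝ, ∑ i ∈ S0, c i * hlP s (g i) x = 0 := fun x =>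
      congrFun (Continuous.ext_on dense_generic
        (continuous_finsetSum _ fun i hi => continuous_const.mul (continuous_hlP hs (hgn i hi)))
        continuous_const fun y hy => hsum0 y hy) x
    set S1 := S0.filter fun i => (f i).1 (Fin.last n) = m with hS1
    have hi01 : i0 ∈ S1 := Finset.mem_filter.mpr ⟨hi0, rfl⟩
    have hlast : ∀ i ∈ S1, (g i).1 (Fin.last n) = 0 := fun i hi => by
      have := (Finset.mem_filter.mp hi).2
      simp only [hg, shift]
      omega
    refine (Finset.mem_filter.mp hi0).2 (ih S1 (fun i => dropLast (g i)) c ?_ ?_ i0 hi01)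
    · intro i hi j hj hij
      have hiS := Finset.mem_filter.mp (Finset.mem_filter.mp hi).1
      have hjS := Finset.mem_filter.mp (Finset.mem_filter.mp hj).1
      refine hinj hiS.1 hjS.1 (Subtype.ext (funext fun a => ?_))
      have hli := hlast i hi
      have hlj := hlast j hj
      simp only [hg, shift] at hli hlj
      refine Fin.lastCases ?_ (fun a => ?_) a
      · omega
      · have h5 := congrFun (congrArg Subtype.val hij) a
        have h6 : (f i).1 a.castSucc + -m = (f j).1 a.castSucc + -m := h5
        omega
    · intro x hx
      have h1 := hall (Fin.cons 0 x)
      rw [← Finset.sum_filter_add_sum_filter_not S0 (fun i => (f i).1 (Fin.last n) = m)] at h1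
      rw [Finset.sum_eq_zero (s := S0.filter fun i => ¬ (f i).1 (Fin.last n) = m) fun i hi => by
        have h2 := (Finset.mem_filter.mp hi).2
        have h3 := hmin i (Finset.mem_filter.mp hi).1
        rw [hlP_eq_hlSymmetrization hs (hgn i (Finset.mem_filter.mp hi).1)
          (cons_zero_injective hx), hlSymmetrization_cons_zero_of_pos, mul_zero]
        simp only [hg, shift]
        omega, add_zero] at h1
      rw [← h1]
      exact Finset.sum_congr rfl fun i hi => by
        rw [hlP_eq_hlSymmetrization hs (hgn i (Finset.mem_filter.mp hi).1)
          (cons_zero_injective hx), hlSymmetrization_cons_zero hs _ (hlast i hi) hx]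

/-- The coefficients of an expansion in Hall-Littlewood polynomials are unique. -/
theorem finsupp_eq_of_sum_hlP {s : ℝ} (hs : |s| < 1) {n : ℕ} {c c' : Signature n →₀ ℝ}
    (h : ∀ x : Fin n → ℝ, Generic x →
      (c.sum fun lam a => a * hlP s lam x) = c'.sum fun lam a => a * hlP s lam x) : c = c' := by
  rw [← sub_eq_zero]
  ext lam
  by_contra hlam
  refine hlam (eq_zero_of_sum_hlSymmetrization hs (c - c').support id (c - c')
    Function.injective_id.injOn (fun x hx => ?_) lam (Finsupp.mem_support_iff.mpr hlam))
  have h1 : ((c - c').sum fun lam a => a * hlP s lam x) = 0 := by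
    rw [Finsupp.sum_sub_index (fun _ _ _ => sub_mul _ _ _), h x hx, sub_self]
  rw [← h1]
  exact Finset.sum_congr rfl fun l _ => by
    rw [id, ← hlP_eq_hlSymmetrization_of_generic hs l hx]
    rfl

/-! ### Skew Hall-Littlewood polynomials and the Cauchy identity -/

theorem Signature.InterlacesQ.le {n : ℕ} {nu lam : Signature n} (h : nu.InterlacesQ lam) :
    nu ≤ lam := h.1

theorem GTQ.monotone {n r : ℕ} {lam nu : Signature n} (T : GTQ r lam nu) : Monotone T.1 :=
  Fin.monotone_iff_le_succ.mpr fun i => (T.2.2.2 i).le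

theorem GTQ.le_apply {n r : ℕ} {lam nu : Signature n} (T : GTQ r lam nu) (i : Fin (r + 1)) :
    nu ≤ T.1 i := T.2.1.symm.le.trans (T.monotone (Fin.zero_le i))

theorem GTQ.apply_le {n r : ℕ} {lam nu : Signature n} (T : GTQ r lam nu) (i : Fin (r + 1)) :
    T.1 i ≤ lam := (T.monotone (Fin.le_last i)).trans T.2.2.1.le

instance finite_GTQ {n r : ℕ} (lam nu : Signature n) : Finite (GTQ r lam nu) := by
  have hfin : (Set.Icc nu lam).Finite := by
    refine Set.Finite.of_finite_image (f := Subtype.val) ?_ Subtype.val_injective.injOn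
    refine (Set.finite_Icc nu.1 lam.1).subset ?_
    rintro _ ⟨k, hk, rfl⟩
    exact hk
  have := hfin.to_subtype
  refine Finite.of_injective
    (fun (T : GTQ r lam nu) (i : Fin (r + 1)) =>
      (⟨T.1 i, T.le_apply i, T.apply_le i⟩ : Set.Icc nu lam)) fun T T' h => ?_
  exact Subtype.ext (funext fun i => congrArg Subtype.val (congrFun h i))

theorem skewQFin_eq_zero (s : ℝ) {n r : ℕ} (x : Fin r → ℝ) {lam nu : Signature n}
    (h : ¬ ∀ i, nu.1 i ≤ lam.1 i) : skewQFin s x lam nu = 0 := by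
  have : IsEmpty (GTQ r lam nu) := ⟨fun T => h (by
    have := T.apply_le 0
    rw [T.2.1] at this
    exact this)⟩
  rw [skewQFin, finsum_of_isEmpty]

open Classical in
theorem skewQFin_zero_vars (s : ℝ) {n : ℕ} (x : Fin 0 → ℝ) (lam nu : Signature n) :
    skewQFin s x lam nu = if lam = nu then 1 else 0 := by
  rw [skewQFin]
  split_ifs with h
  · subst h
    let T0 : GTQ 0 lam lam := ⟨fun _ => lam, rfl, rfl, fun i => i.elim0⟩
    have : Unique (GTQ 0 lam lam) := ⟨⟨T0⟩, fun T => Subtype.ext (funext fun i => by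
      rw [Fin.fin_one_eq_zero i]; exact T.2.1)⟩
    rw [finsum_unique]
    simp
  · have : IsEmpty (GTQ 0 lam nu) := ⟨fun T => h (T.2.2.1.symm.trans T.2.1)⟩
    rw [finsum_of_isEmpty]

open Classical in
/-- The skew function `Q_{lam/nu}(a)` of one variable. -/
def rowQ (s a : ℝ) {n : ℕ} (lam nu : Signature n) : ℝ :=
  if nu.InterlacesQ lam then branchPhi s lam nu * a ^ (lam.size - nu.size) else 0

theorem above_disjoint {n : ℕ} (nu : Signature n) (S : Set ℕ) :
    S.PairwiseDisjoint (above nu) := by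
  intro a _ b _ hab
  rw [Function.onFun, Finset.disjoint_left]
  intro k hk hk'
  have h1 := (mem_above.mp hk).2
  have h2 := (mem_above.mp hk').2
  exact hab (by omega)

/-- Branching: splitting off the last variable of a skew Hall-Littlewood polynomial. -/
theorem skewQFin_succ (s : ℝ) {n r : ℕ} (x : Fin (r + 1) → ℝ) {lam nu : Signature n} {D : ℕ}
    (hlam : lam ∈ above nu D) :
    skewQFin s x lam nu = ∑ e ∈ Finset.range (D + 1), ∑ k ∈ above nu e,
      skewQFin s (Fin.init x) k nu * rowQ s (x (Fin.last r)) lam k := by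
  classical
  have := Fintype.ofFinite (GTQ (r + 1) lam nu)
  rw [← Finset.sum_biUnion (above_disjoint nu _), skewQFin, finsum_eq_sum_of_fintype,
    ← Finset.sum_fiberwise_of_maps_to
      (g := fun T : GTQ (r + 1) lam nu => T.1 (Fin.last r).castSucc)
      (t := (Finset.range (D + 1)).biUnion (above nu))]
  · refine Finset.sum_congr rfl fun k _ => ?_
    rw [rowQ]
    split_ifs with hk
    · have := Fintype.ofFinite (GTQ r k nu)
      rw [skewQFin, finsum_eq_sum_of_fintype, Finset.sum_mul]
      symm
      refine Finset.sum_bij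
        (fun T' _ => ⟨Fin.snoc (α := fun _ => Signature n) T'.1 lam, ?_, ?_, ?_⟩)
        ?_ ?_ ?_ ?_
      · change Fin.snoc (α := fun _ => Signature n) T'.1 lam (Fin.castSucc 0) = nu
        rw [Fin.snoc_castSucc]
        exact T'.2.1
      · rw [Fin.snoc_last]
      · intro i
        refine Fin.lastCases ?_ (fun i => ?_) i
        · rw [Fin.succ_last, Fin.snoc_last, Fin.snoc_castSucc, T'.2.2.1]
          exact hk
        · rw [Fin.succ_castSucc, Fin.snoc_castSucc, Fin.snoc_castSucc]
          exact T'.2.2.2 i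
      · intro T' _
        refine Finset.mem_filter.mpr ⟨Finset.mem_univ _, ?_⟩
        change Fin.snoc (α := fun _ => Signature n) T'.1 lam (Fin.last r).castSucc = k
        rw [Fin.snoc_castSucc]
        exact T'.2.2.1
      · intro T' _ T'' _ h
        refine Subtype.ext (funext fun i => ?_)
        have h1 := congrFun (congrArg Subtype.val h) i.castSucc
        change Fin.snoc (α := fun _ => Signature n) T'.1 lam i.castSucc =
          Fin.snoc (α := fun _ => Signature n) T''.1 lam i.castSucc at h1
        rwa [Fin.snoc_castSucc, Fin.snoc_castSucc] at h1
      · intro T hT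
        have hTk := (Finset.mem_filter.mp hT).2
        refine ⟨⟨Fin.init T.1, T.2.1, hTk, fun i => ?_⟩, Finset.mem_univ _, ?_⟩
        · have := T.2.2.2 i.castSucc
          rwa [Fin.succ_castSucc] at this
        · refine Subtype.ext ?_
          change Fin.snoc (α := fun _ => Signature n) (Fin.init T.1) lam = T.1
          conv_rhs => rw [← Fin.snoc_init_self T.1]
          rw [T.2.2.1]
      · intro T' _
        rw [Fin.prod_univ_castSucc]
        simp only [Fin.succ_castSucc, Fin.succ_last, Fin.snoc_castSucc, Fin.snoc_last, T'.2.2.1,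
          Fin.init]
    · rw [mul_zero]
      refine Finset.sum_eq_zero fun T hT => ?_
      refine absurd ?_ hk
      have := T.2.2.2 (Fin.last r)
      rwa [Fin.succ_last, T.2.2.1, (Finset.mem_filter.mp hT).2] at this
  · intro T _
    rw [Finset.mem_biUnion]
    have h1 := T.le_apply (Fin.last r).castSucc
    have h2 := T.apply_le (Fin.last r).castSucc
    have h3 := Signature.size_mono h1
    have h4 := Signature.size_mono h2
    have h5 := (mem_above.mp hlam).2
    refine ⟨((T.1 (Fin.last r).castSucc).size - nu.size).toNat, ?_, ?_⟩
    · rw [Finset.mem_range]; omega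
    · rw [mem_above]
      exact ⟨h1, by omega⟩

/-- The kernel `∏_{i,j} (1 - s x_i c_j X) / (1 - x_i c_j X)`. -/
def cauchySer (s : ℝ) {n r : ℕ} (x : Fin n → ℝ) (c : Fin r → ℝ) : ℝ⟦X⟧ :=
  ∏ j, PowerSeries.rescale (c j) (rowSer s x)

theorem sum_rowQ_mul_hlP {s : ℝ} (hs : |s| < 1) {n : ℕ} {nu k : Signature n} {e D : ℕ}
    (heD : e ≤ D) (hnu : nu.IsNonneg) (hk : k ∈ above nu e) (a : ℝ) (x : Fin n → ℝ) :
    ∑ lam ∈ above nu D, rowQ s a lam k * hlP s lam x =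
      a ^ (D - e) * PowerSeries.coeff (D - e) (rowSer s x) * hlP s k x := by
  have hk' := mem_above.mp hk
  rw [mul_assoc, coeff_rowSer_mul_hlP hs (hnu.of_le hk'.1), Finset.mul_sum]
  symm
  refine Finset.sum_subset_zero_on_sdiff (fun lam hl => ?_) (fun lam hl => ?_) fun lam hl => ?_
  · rw [mem_strips] at hl
    rw [mem_above]
    exact ⟨fun i => (hk'.1 i).trans (hl.1.1 i), by omega⟩
  · rw [Finset.mem_sdiff, mem_above, mem_strips] at hl
    rw [rowQ, if_neg, zero_mul]
    exact fun h => hl.2 ⟨h, by omega⟩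
  · rw [mem_strips] at hl
    have : lam.size - k.size = ((D - e : ℕ) : ℤ) := by omega
    rw [rowQ, if_pos hl.1, this, zpow_natCast]
    ring

/-- The skew Cauchy identity, degree by degree:
`∑ Q_{lam/nu}(c) P_lam(x) = Π(x; c) P_nu(x)`. -/
theorem sum_skewQFin_mul_hlP {s : ℝ} (hs : |s| < 1) {n : ℕ} {nu : Signature n}
    (hnu : nu.IsNonneg) (x : Fin n → ℝ) {r : ℕ} (c : Fin r → ℝ) (D : ℕ) :
    ∑ lam ∈ above nu D, skewQFin s c lam nu * hlP s lam x =
      PowerSeries.coeff D (cauchySer s x c) * hlP s nu x := by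
  classical
  induction r generalizing D with
  | zero =>
    simp only [skewQFin_zero_vars, cauchySer, Finset.univ_eq_empty, Finset.prod_empty,
      PowerSeries.coeff_one, ite_mul, one_mul, zero_mul]
    rw [Finset.sum_ite_eq' (above nu D) nu (fun l => hlP s l x)]
    congr 1
    rw [mem_above]
    simp
  | succ r ih =>
    have hser : cauchySer s x c = cauchySer s x (Fin.init c) *
        PowerSeries.rescale (c (Fin.last r)) (rowSer s x) := Fin.prod_univ_castSucc _
    calc ∑ lam ∈ above nu D, skewQFin s c lam nu * hlP s lam x
        = ∑ e ∈ Finset.range (D + 1), ∑ k ∈ above nu e, skewQFin s (Fin.init c) k nu *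
            ∑ lam ∈ above nu D, rowQ s (c (Fin.last r)) lam k * hlP s lam x := by
          rw [Finset.sum_congr rfl fun lam hl => by rw [skewQFin_succ s c hl, Finset.sum_mul]]
          rw [Finset.sum_comm]
          refine Finset.sum_congr rfl fun e _ => ?_
          simp only [Finset.sum_mul, Finset.mul_sum]
          rw [Finset.sum_comm]
          simp only [mul_assoc]
      _ = ∑ e ∈ Finset.range (D + 1), (c (Fin.last r) ^ (D - e) *
            PowerSeries.coeff (D - e) (rowSer s x)) *
            (PowerSeries.coeff e (cauchySer s x (Fin.init c)) * hlP s nu x) := by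
          refine Finset.sum_congr rfl fun e he => ?_
          have heD : e ≤ D := Nat.lt_succ_iff.mp (Finset.mem_range.mp he)
          rw [← ih (Fin.init c) e, Finset.mul_sum]
          refine Finset.sum_congr rfl fun k hk => ?_
          rw [sum_rowQ_mul_hlP hs heD hnu hk]
          ring
      _ = _ := by
          rw [hser, PowerSeries.coeff_mul, Finset.Nat.sum_antidiagonal_eq_sum_range_succ_mk,
            Finset.sum_mul]
          refine Finset.sum_congr rfl fun e _ => ?_
          rw [PowerSeries.coeff_rescale]
          ring

/-! ### Skew functions of infinite specializations -/

/-- The value of `Q_{lam/nu}` at the first `r` terms of a sequence. -/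
def truncQ (s : ℝ) (ψ : ℕ → ℝ) {n : ℕ} (lam nu : Signature n) (r : ℕ) : ℝ :=
  skewQFin s (fun i : Fin r => ψ i) lam nu

theorem rowQ_of_mem_above_same (s a : ℝ) {n : ℕ} {nu lam : Signature n} {D : ℕ}
    (hlam : lam ∈ above nu D) (f : Signature n → ℝ) :
    ∑ k ∈ above nu D, f k * rowQ s a lam k = f lam := by
  have hphi : branchPhi s lam lam = 1 := by
    rw [branchPhi, Finset.filter_false_of_mem fun a _ => by omega, Finset.prod_empty]
  have hself : rowQ s a lam lam = 1 := by
    rw [rowQ, if_pos ⟨fun _ => le_rfl, fun i j hij => lam.2 (Fin.le_def.mpr (by omega))⟩, hphi,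
      sub_self, zpow_zero, one_mul]
  rw [Finset.sum_eq_single_of_mem lam hlam, hself, mul_one]
  intro k hk hne
  rw [rowQ, if_neg, mul_zero]
  intro h
  have h1 : lam ∈ above k 0 := by
    rw [mem_above]
    exact ⟨h.1, by have := (mem_above.mp hk).2; have := (mem_above.mp hlam).2; omega⟩
  rw [above_zero, Finset.mem_singleton] at h1
  exact hne h1.symm

/-- The increment of `Q_{lam/nu}` when a variable is added. -/
theorem truncQ_succ (s : ℝ) (ψ : ℕ → ℝ) {n : ℕ} {lam nu : Signature n} {D : ℕ}
    (hlam : lam ∈ above nu D) (r : ℕ) :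
    truncQ s ψ lam nu (r + 1) = truncQ s ψ lam nu r +
      ∑ e ∈ Finset.range D, ∑ k ∈ above nu e, truncQ s ψ k nu r * rowQ s (ψ r) lam k := by
  have h := skewQFin_succ s (fun i : Fin (r + 1) => ψ i) hlam
  rw [Finset.sum_range_succ] at h
  have h2 := rowQ_of_mem_above_same s (ψ r) hlam (fun k => truncQ s ψ k nu r)
  rw [← h2, add_comm (∑ k ∈ above nu D, _)]
  exact h

theorem rowQ_eq_const_mul_pow (s : ℝ) {n : ℕ} {nu lam k : Signature n} {D e : ℕ}
    (hlam : lam ∈ above nu D) (hk : k ∈ above nu e) (he : e < D) :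
    ∃ (C : ℝ) (d : ℕ), ∀ a, rowQ s a lam k = C * a ^ (d + 1) := by
  by_cases h : k.InterlacesQ lam
  · refine ⟨branchPhi s lam k, D - e - 1, fun a => ?_⟩
    have h1 : lam.size - k.size = ((D - e - 1 + 1 : ℕ) : ℤ) := by
      have := (mem_above.mp hk).2; have := (mem_above.mp hlam).2; omega
    rw [rowQ, if_pos h, h1, zpow_natCast]
  · exact ⟨0, 0, fun a => by rw [rowQ, if_neg h, zero_mul]⟩

theorem summable_mul_pow {u a : ℕ → ℝ} {L : ℝ} (hu : Tendsto u atTop (𝓝 L)) (ha : Summable a)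
    (C : ℝ) (d : ℕ) : Summable fun r => u r * (C * a r ^ (d + 1)) := by
  have h1 : (fun r => u r * (C * a r ^ d)) =O[atTop] fun _ => (1 : ℝ) :=
    (hu.mul ((ha.tendsto_atTop_zero.pow d).const_mul C)).isBigO_one ℝ
  refine summable_of_isBigO_nat ha ?_
  have h2 := h1.mul (Asymptotics.isBigO_refl a atTop)
  simp only [one_mul] at h2
  refine h2.congr_left fun r => ?_
  ring

/-- Along a summable sequence the values of a skew function at the truncations converge. -/
theorem exists_tendsto_truncQ (s : ℝ) {ψ : ℕ → ℝ} (hψ : Summable ψ) {n : ℕ}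
    (lam nu : Signature n) : ∃ L, Tendsto (truncQ s ψ lam nu) atTop (𝓝 L) := by
  have key : ∀ (D : ℕ) (lam : Signature n), lam ∈ above nu D →
      ∃ L, Tendsto (truncQ s ψ lam nu) atTop (𝓝 L) := by
    intro D
    induction D using Nat.strong_induction_on with
    | _ D ih =>
      intro lam hlam
      -- Each increment is a bounded sequence times a positive power of `ψ r`.
      have hsum : Summable fun r => truncQ s ψ lam nu (r + 1) - truncQ s ψ lam nu r := by
        have heq : (fun r => truncQ s ψ lam nu (r + 1) - truncQ s ψ lam nu r) = fun r =>
            ∑ e ∈ Finset.range D, ∑ k ∈ above nu e, truncQ s ψ k nu r * rowQ s (ψ r) lam k := by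
          funext r
          rw [truncQ_succ s ψ hlam, add_sub_cancel_left]
        rw [heq]
        refine summable_sum fun e he => summable_sum fun k hk => ?_
        rw [Finset.mem_range] at he
        obtain ⟨C, d, hC⟩ := rowQ_eq_const_mul_pow s hlam hk he
        obtain ⟨L, hL⟩ := ih e he k hk
        simp only [hC]
        exact summable_mul_pow hL hψ C d
      have h1 := hsum.hasSum.tendsto_sum_nat
      simp only [Finset.sum_range_sub] at h1
      refine ⟨_, (h1.add_const (truncQ s ψ lam nu 0)).congr fun r => ?_⟩
      ring
  by_cases h : ∀ i, nu.1 i ≤ lam.1 i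
  · refine key (lam.size - nu.size).toNat lam (mem_above.mpr ⟨h, ?_⟩)
    have := Signature.size_mono h
    omega
  · refine ⟨0, tendsto_const_nhds.congr fun r => ?_⟩
    exact (skewQFin_eq_zero s _ h).symm

theorem tendsto_truncQ (s : ℝ) {ψ : ℕ → ℝ} (hψ : Summable ψ) {n : ℕ} (lam nu : Signature n) :
    Tendsto (truncQ s ψ lam nu) atTop (𝓝 (skewQ s ψ lam nu)) :=
  tendsto_nhds_limUnder (exists_tendsto_truncQ s hψ lam nu)

theorem skewQ_eq_zero (s : ℝ) (ψ : ℕ → ℝ) {n : ℕ} {lam nu : Signature n}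
    (h : ¬ ∀ i, nu.1 i ≤ lam.1 i) : skewQ s ψ lam nu = 0 :=
  Tendsto.limUnder_eq (tendsto_const_nhds.congr fun _ => (skewQFin_eq_zero s _ h).symm)

/-- If the values at the truncations of even length converge and the additional variable at odd
lengths tends to zero, then the values at all truncations converge. -/
theorem tendsto_truncQ_of_even (s : ℝ) {ψ : ℕ → ℝ}
    (hψ : Tendsto (fun r => ψ (2 * r)) atTop (𝓝 0)) {n : ℕ} {nu : Signature n}
    (heven : ∀ lam : Signature n, ∃ L, Tendsto (fun r => truncQ s ψ lam nu (2 * r)) atTop (𝓝 L))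
    (lam : Signature n) : Tendsto (truncQ s ψ lam nu) atTop (𝓝 (skewQ s ψ lam nu)) := by
  refine tendsto_nhds_limUnder ?_
  by_cases h : ∀ i, nu.1 i ≤ lam.1 i
  · have hlam : lam ∈ above nu (lam.size - nu.size).toNat := by
      have := Signature.size_mono h
      exact mem_above.mpr ⟨h, by omega⟩
    obtain ⟨L, hL⟩ := heven lam
    have hodd : Tendsto (fun r => truncQ s ψ lam nu (2 * r + 1)) atTop (𝓝 L) := by
      have hz : Tendsto (fun r => ∑ e ∈ Finset.range (lam.size - nu.size).toNat,
          ∑ k ∈ above nu e, truncQ s ψ k nu (2 * r) * rowQ s (ψ (2 * r)) lam k) atTop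
          (𝓝 (∑ e ∈ Finset.range (lam.size - nu.size).toNat, ∑ k ∈ above nu e, 0)) := by
        refine tendsto_finsetSum _ fun e he => tendsto_finsetSum _ fun k hk => ?_
        obtain ⟨C, d, hC⟩ := rowQ_eq_const_mul_pow s hlam hk (Finset.mem_range.mp he)
        obtain ⟨L', hL'⟩ := heven k
        have h1 := hL'.mul ((hψ.pow (d + 1)).const_mul C)
        rw [zero_pow (Nat.succ_ne_zero d), mul_zero, mul_zero] at h1
        simpa only [hC] using h1
      have h2 := hL.add hz
      simp only [Finset.sum_const_zero, add_zero] at h2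
      exact h2.congr fun r => (truncQ_succ s ψ hlam (2 * r)).symm
    refine ⟨L, ?_⟩
    rw [Metric.tendsto_atTop] at hL hodd ⊢
    intro ε hε
    obtain ⟨N1, h1⟩ := hL ε hε
    obtain ⟨N2, h2⟩ := hodd ε hε
    refine ⟨2 * (N1 + N2) + 1, fun r hr => ?_⟩
    obtain ⟨j, hj | hj⟩ := Nat.even_or_odd' r
    · rw [hj]; exact h1 j (by omega)
    · rw [hj]; exact h2 j (by omega)
  · exact ⟨0, tendsto_const_nhds.congr fun r => (skewQFin_eq_zero s _ h).symm⟩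

theorem hlQ_eq_zero (s : ℝ) (ψ : ℕ → ℝ) {n : ℕ} {lam : Signature n} (h : ¬ lam.IsNonneg) :
    hlQ s ψ lam = 0 := skewQ_eq_zero s ψ h

/-! ### Mixed Littlewood-Richardson coefficients -/

/-- The common setting of the two cases. The substitution `x ↦ Dm x` is homogeneous of degree `q`,
and the Cauchy kernel with parameter `s` at `Dm x` and `U b`, with `X^q` in place of `X`, is the
Cauchy kernel with parameter `s'` at `x` and `U' b`. Here `U b` and `U' b` are specializations
parametrized by a sequence `b`; one truncates `U b` at `r` and `U' b` at `q r`. -/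
structure KernelChange {m n : ℕ} (q : ℕ) (s s' : ℝ) (Dm : (Fin n → ℝ) → Fin m → ℝ)
    (U U' : (ℕ → ℝ) → ℕ → ℝ) : Prop where
  abs_left : |s| < 1
  abs_right : |s'| < 1
  pos : 0 < q
  continuous : Continuous Dm
  smul : ∀ (x : Fin n → ℝ) {r : ℝ}, r ≠ 0 → Dm (r • x) = r ^ q • Dm x
  kernel : ∀ (b : ℕ → ℝ) (r : ℕ) (x : Fin n → ℝ) (D : ℕ),
    PowerSeries.coeff (q * D) (cauchySer s' x fun i : Fin (q * r) => U' b i) =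
      PowerSeries.coeff D (cauchySer s (Dm x) fun i : Fin r => U b i)
  kernel_zero : ∀ (b : ℕ → ℝ) (r : ℕ) (x : Fin n → ℝ) (E : ℕ), ¬ q ∣ E →
    PowerSeries.coeff E (cauchySer s' x fun i : Fin (q * r) => U' b i) = 0
  one : U (fun _ => 1) 0 = 1

/-- The span of the functions `P_lam(x; s)` of nonnegative signatures. -/
def hlSpan (s : ℝ) (n : ℕ) : Submodule ℝ ((Fin n → ℝ) → ℝ) :=
  Submodule.span ℝ ((fun (lam : Signature n) (x : Fin n → ℝ) => hlP s lam x) ''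
    {lam | lam.IsNonneg})

theorem hlP_mem_hlSpan (s : ℝ) {n : ℕ} {lam : Signature n} (h : lam.IsNonneg) :
    (fun x => hlP s lam x) ∈ hlSpan s n := Submodule.subset_span ⟨lam, h, rfl⟩

theorem coeff_cauchySer_mul_mem_hlSpan {s : ℝ} (hs : |s| < 1) {n r : ℕ} (c : Fin r → ℝ) (D : ℕ)
    {f : (Fin n → ℝ) → ℝ} (hf : f ∈ hlSpan s n) :
    (fun x => PowerSeries.coeff D (cauchySer s x c) * f x) ∈ hlSpan s n := by
  induction hf using Submodule.span_induction with
  | mem f hf =>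
    obtain ⟨nu, hnu, rfl⟩ := hf
    have : (fun x => PowerSeries.coeff D (cauchySer s x c) * hlP s nu x) =
        ∑ lam ∈ above nu D, skewQFin s c lam nu • fun x => hlP s lam x := by
      funext x
      rw [← sum_skewQFin_mul_hlP hs hnu x c D, Finset.sum_apply]
      rfl
    rw [this]
    exact Submodule.sum_mem _ fun lam hl => Submodule.smul_mem _ _
      (hlP_mem_hlSpan s (hnu.of_le (mem_above.mp hl).1))
  | zero =>
    convert Submodule.zero_mem (hlSpan s n) using 1
    funext x
    simp
  | add f g _ _ hf hg =>
    convert Submodule.add_mem _ hf hg using 1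
    funext x
    simp only [Pi.add_apply]
    ring
  | smul a f _ hf =>
    have := Submodule.smul_mem _ a hf
    convert this using 1
    funext x
    simp only [Pi.smul_apply, smul_eq_mul]
    ring

namespace KernelChange

variable {m n q : ℕ} {s s' : ℝ} {Dm : (Fin n → ℝ) → Fin m → ℝ} {U U' : (ℕ → ℝ) → ℕ → ℝ}

/-- The span of the `P_lam(x; s')` is closed under multiplication by the functions
`P_mu(Dm x; s)`, since these are polynomials in coefficients of Cauchy kernels. -/
theorem exists_expansion (h : KernelChange q s s' Dm U U') {mu : Signature m} {nu : Signature n}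
    (hmu : mu.IsNonneg) (hnu : nu.IsNonneg) :
    ∃ c : Signature n →₀ ℝ, (∀ lam, c lam ≠ 0 → lam.IsNonneg) ∧
      ∀ x, hlP s mu (Dm x) * hlP s' nu x = c.sum fun lam a => a * hlP s' lam x := by
  -- `U (fun _ => 1)` begins with `1`, so that with one variable the kernel on the left is the
  -- generating function of the one-row functions at `Dm x`.
  obtain ⟨a, ha, -⟩ := exists_hlP_eq_eval h.abs_left hmu
  have hrow : ∀ (x : Fin n → ℝ) (d : ℕ), PowerSeries.coeff d (rowSer s (Dm x)) =
      PowerSeries.coeff (q * d) (cauchySer s' x fun i : Fin (q * 1) => U' (fun _ => 1) i) := by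
    intro x d
    rw [h.kernel]
    have : cauchySer s (Dm x) (fun i : Fin 1 => U (fun _ => 1) i) = rowSer s (Dm x) := by
      rw [cauchySer, Fin.prod_univ_one]
      have h1 : U (fun _ => 1) ((0 : Fin 1) : ℕ) = 1 := h.one
      rw [h1, PowerSeries.rescale_one, RingHom.id_apply]
    rw [this]
  have hmem : ∀ (p : MvPolynomial ℕ ℝ), ∀ f ∈ hlSpan s' n, (fun x => MvPolynomial.eval
      (fun d => PowerSeries.coeff d (rowSer s (Dm x))) p * f x) ∈ hlSpan s' n := by
    intro p
    induction p using MvPolynomial.induction_on with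
    | C r =>
      intro f hf
      convert Submodule.smul_mem _ r hf using 1
      funext x
      simp
    | add p p' hp hp' =>
      intro f hf
      convert Submodule.add_mem _ (hp f hf) (hp' f hf) using 1
      funext x
      simp only [map_add, Pi.add_apply]
      ring
    | mul_X p d hp =>
      intro f hf
      convert hp _ (coeff_cauchySer_mul_mem_hlSpan h.abs_right
        (fun i : Fin (q * 1) => U' (fun _ => 1) i) (q * d) hf) using 1
      funext x
      rw [map_mul, MvPolynomial.eval_X, hrow, mul_assoc]
  have h1 := hmem a _ (hlP_mem_hlSpan s' hnu)
  simp only [← ha] at h1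
  obtain ⟨c, hc, hcx⟩ := (Finsupp.mem_span_image_iff_linearCombination ℝ).mp h1
  refine ⟨c, fun lam hl => hc (Finsupp.mem_support_iff.mpr hl), fun x => ?_⟩
  have h2 := congrFun hcx x
  rw [Finsupp.linearCombination_apply, Finsupp.sum, Finset.sum_apply] at h2
  exact h2.symm

/-- `LR mu nu` is the family of coefficients of the expansion of `P_mu(Dm x; s) P_nu(x; s')` in the
`P_lam(x; s')`, for nonnegative `mu` and `nu`. -/
def IsCoeffs (s s' : ℝ) (Dm : (Fin n → ℝ) → Fin m → ℝ)
    (LR : Signature m → Signature n → Signature n →₀ ℝ) : Prop :=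
  ∀ mu nu, mu.IsNonneg → nu.IsNonneg → ∀ x : Fin n → ℝ, (∀ i, x i ≠ 0) →
    hlP s mu (Dm x) * hlP s' nu x = (LR mu nu).sum fun lam a => a * hlP s' lam x

variable {LR : Signature m → Signature n → Signature n →₀ ℝ}

theorem isNonneg_of_coeff_ne_zero (h : KernelChange q s s' Dm U U') (hLR : IsCoeffs s s' Dm LR)
    {mu : Signature m} {nu lam : Signature n} (hmu : mu.IsNonneg) (hnu : nu.IsNonneg)
    (hne : LR mu nu lam ≠ 0) : lam.IsNonneg := by
  obtain ⟨c, hc, hcx⟩ := h.exists_expansion hmu hnu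
  have : LR mu nu = c := finsupp_eq_of_sum_hlP h.abs_right fun x hx => by
    rw [← hcx x, hLR mu nu hmu hnu x hx.2]
  rw [this] at hne
  exact hc lam hne

/-- The coefficients are supported in the degree of the product. -/
theorem size_of_coeff_ne_zero (h : KernelChange q s s' Dm U U') (hLR : IsCoeffs s s' Dm LR)
    {mu : Signature m} {nu lam : Signature n} (hmu : mu.IsNonneg) (hnu : nu.IsNonneg)
    (hne : LR mu nu lam ≠ 0) : lam.size = nu.size + q * mu.size := by
  have h2 : (2 : ℝ) ≠ 0 := two_ne_zero
  -- Comparing the expansion at `x` and at `2 x`.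
  set N : ℤ := nu.size + q * mu.size with hN
  have key := eq_zero_of_sum_hlSymmetrization h.abs_right (LR mu nu).support id
    (fun l => LR mu nu l * ((2 : ℝ) ^ l.size - (2 : ℝ) ^ N)) Function.injective_id.injOn ?_ lam
    (Finsupp.mem_support_iff.mpr hne)
  · have h3 : (2 : ℝ) ^ lam.size = (2 : ℝ) ^ N :=
      sub_eq_zero.mp ((mul_eq_zero.mp key).resolve_left hne)
    exact zpow_right_injective₀ (by norm_num) (by norm_num) h3
  · intro x hx
    have e1 := hLR mu nu hmu hnu x hx.2
    have e2 := hLR mu nu hmu hnu ((2 : ℝ) • x) (hx.smul h2).2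
    rw [h.smul x h2, hlP_smul h.abs_left hmu _ (pow_ne_zero q h2), hlP_smul h.abs_right hnu _ h2]
      at e2
    have e3 : (((2 : ℝ) ^ q) ^ mu.size * hlP s mu (Dm x)) * (2 ^ nu.size * hlP s' nu x) =
        2 ^ N * (hlP s mu (Dm x) * hlP s' nu x) := by
      rw [hN, zpow_add₀ h2, zpow_mul, zpow_natCast]
      ring
    rw [e3, e1, Finsupp.sum, Finsupp.sum, Finset.mul_sum] at e2
    rw [← sub_eq_zero, ← Finset.sum_sub_distrib] at e2
    rw [← neg_eq_zero, ← e2, ← Finset.sum_neg_distrib]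
    refine Finset.sum_congr rfl fun l _ => ?_
    rw [id, hlP_eq_hlSymmetrization_of_generic h.abs_right l hx,
      hlP_eq_hlSymmetrization_of_generic h.abs_right l (hx.smul h2),
      hlSymmetrization_smul s' l x h2]
    ring

/-- The mixed Cauchy identity at finitely many variables: the sum of the coefficients against
`Q_mu(U b; s)` is a skew function with parameter `s'`. Both sides of the defining expansion, summed
against `Q_mu`, are the product of the Cauchy kernel and `P_nu`. -/
theorem sum_truncQ_smul_coeffs (h : KernelChange q s s' Dm U U') (hLR : IsCoeffs s s' Dm LR)
    {nu : Signature n} (hnu : nu.IsNonneg) (b : ℕ → ℝ) (r D : ℕ) :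
    ∑ mu ∈ above (Signature.zero m) D, truncQ s (U b) mu (Signature.zero m) r • LR mu nu =
      ∑ lam ∈ above nu (q * D), Finsupp.single lam (truncQ s' (U' b) lam nu (q * r)) := by
  have hz : (Signature.zero m).IsNonneg := fun _ => le_rfl
  refine finsupp_eq_of_sum_hlP h.abs_right fun x hx => ?_
  have hlc : ∀ c : Signature n →₀ ℝ, (c.sum fun lam a => a * hlP s' lam x) =
      Finsupp.linearCombination ℝ (fun lam => hlP s' lam x) c := fun c => rfl
  rw [hlc, hlc, map_sum, map_sum]
  simp only [map_smul, Finsupp.linearCombination_single, smul_eq_mul]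
  have h1 : ∀ mu ∈ above (Signature.zero m) D,
      truncQ s (U b) mu (Signature.zero m) r *
        Finsupp.linearCombination ℝ (fun lam => hlP s' lam x) (LR mu nu) =
      truncQ s (U b) mu (Signature.zero m) r * hlP s mu (Dm x) * hlP s' nu x := by
    intro mu hmu
    rw [← hlc, ← hLR mu nu (hz.of_le (mem_above.mp hmu).1) hnu x hx.2, mul_assoc]
  rw [Finset.sum_congr rfl h1, ← Finset.sum_mul]
  have h2 := sum_skewQFin_mul_hlP h.abs_left hz (Dm x) (fun i : Fin r => U b i) D
  have h3 := sum_skewQFin_mul_hlP h.abs_right hnu x (fun i : Fin (q * r) => U' b i) (q * D)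
  rw [hlP_zero h.abs_left, mul_one] at h2
  rw [h.kernel b r x D, ← h2] at h3
  exact h3.symm

theorem sum_truncQ_mul_coeffs (h : KernelChange q s s' Dm U U') (hLR : IsCoeffs s s' Dm LR)
    {nu lam : Signature n} (hnu : nu.IsNonneg) (b : ℕ → ℝ) (r : ℕ) {D : ℕ}
    (hsize : lam.size = nu.size + q * D) :
    ∑ mu ∈ above (Signature.zero m) D, truncQ s (U b) mu (Signature.zero m) r * LR mu nu lam =
      truncQ s' (U' b) lam nu (q * r) := by
  classical
  have h1 := DFunLike.congr_fun (h.sum_truncQ_smul_coeffs hLR hnu b r D) lam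
  rw [Finsupp.finsetSum_apply, Finsupp.finsetSum_apply] at h1
  simp only [Finsupp.smul_apply, smul_eq_mul, Finsupp.single_apply] at h1
  rw [h1, Finset.sum_ite_eq']
  split_ifs with h2
  · rfl
  · refine (skewQFin_eq_zero s' _ fun h3 => h2 (mem_above.mpr ⟨h3, ?_⟩)).symm
    rw [hsize]
    push_cast
    rfl

theorem truncQ_eq_zero (h : KernelChange q s s' Dm U U') {nu lam : Signature n}
    (hnu : nu.IsNonneg) (b : ℕ → ℝ) (r : ℕ) {E : ℕ} (hE : ¬ q ∣ E) (hlam : lam ∈ above nu E) :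
    truncQ s' (U' b) lam nu (q * r) = 0 := by
  classical
  refine eq_zero_of_sum_hlSymmetrization h.abs_right (above nu E) id
    (fun l => truncQ s' (U' b) l nu (q * r)) Function.injective_id.injOn (fun x hx => ?_) lam hlam
  have h3 := sum_skewQFin_mul_hlP h.abs_right hnu x (fun i : Fin (q * r) => U' b i) E
  rw [h.kernel_zero b r x E hE, zero_mul] at h3
  rw [← h3]
  exact Finset.sum_congr rfl fun l _ => by
    rw [hlP_eq_hlSymmetrization_of_generic h.abs_right l hx]
    rfl

/-- Convergence of the values of the skew functions along the truncations at multiples of `q`. -/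
theorem exists_tendsto_truncQ_mul (h : KernelChange q s s' Dm U U') (hLR : IsCoeffs s s' Dm LR)
    {b : ℕ → ℝ} (hU : ∀ mu : Signature m, Tendsto (truncQ s (U b) mu (Signature.zero m)) atTop
      (𝓝 (hlQ s (U b) mu))) {nu : Signature n} (hnu : nu.IsNonneg) (lam : Signature n) :
    ∃ L, Tendsto (fun r => truncQ s' (U' b) lam nu (q * r)) atTop (𝓝 L) := by
  by_cases hle : ∀ i, nu.1 i ≤ lam.1 i
  · have hs := Signature.size_mono hle
    obtain ⟨E, hE⟩ : ∃ E : ℕ, lam.size - nu.size = E := Int.eq_ofNat_of_zero_le (by omega)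
    by_cases hq : q ∣ E
    · obtain ⟨D, rfl⟩ := hq
      push_cast at hE
      refine ⟨_, (tendsto_finsetSum (above (Signature.zero m) D) fun mu _ =>
        (hU mu).mul_const (LR mu nu lam)).congr fun r => ?_⟩
      exact h.sum_truncQ_mul_coeffs hLR hnu b r (by omega)
    · exact ⟨0, tendsto_const_nhds.congr fun r =>
        (h.truncQ_eq_zero hnu b r hq (mem_above.mpr ⟨hle, by omega⟩)).symm⟩
  · exact ⟨0, tendsto_const_nhds.congr fun r => (skewQFin_eq_zero s' _ hle).symm⟩

end KernelChange

/-! ### Infinite specializations and Cauchy kernels -/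

/-- The values of the skew functions at the truncations of `ψ` (parameter `s`, starting from the
zero signature) and of `ψ'` (parameter `s'`) converge, so that the limits defining them are
genuine. -/
structure HasLimits (m n : ℕ) (s s' : ℝ) (ψ ψ' : ℕ → ℝ) : Prop where
  left : ∀ mu : Signature m,
    Tendsto (truncQ s ψ mu (Signature.zero m)) atTop (𝓝 (hlQ s ψ mu))
  right : ∀ nu lam : Signature n, nu.IsNonneg →
    Tendsto (truncQ s' ψ' lam nu) atTop (𝓝 (skewQ s' ψ' lam nu))

/-- The Cauchy kernel as a series of finite sums over the signatures of a given size. -/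
theorem hasSum_cauchyKernel {s : ℝ} {n : ℕ} {θ : Fin n → ℝ} {ψ : ℕ → ℝ}
    (h : CauchyFinite s θ ψ) :
    HasSum (fun D : ℕ => ∑ lam ∈ above (Signature.zero n) D, hlP s lam θ * hlQ s ψ lam)
      (cauchyKernel s θ ψ) := by
  classical
  have h1 := h.hasSum.tsum_fiberwise fun lam => lam.1.size.toNat
  have hfib : ∀ D : ℕ, ∑ lam ∈ above (Signature.zero n) D, hlP s lam θ * hlQ s ψ lam =
      ∑' lam : (fun lam : {lam : Signature n // lam.IsNonneg} => lam.1.size.toNat) ⁻¹' {D},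
        hlP s lam.1.1 θ * hlQ s ψ lam.1.1 := by
    intro D
    have hset : (fun lam : {lam : Signature n // lam.IsNonneg} => lam.1.size.toNat) ⁻¹' {D} =
        ↑((above (Signature.zero n) D).subtype Signature.IsNonneg) := by
      ext lam
      have h0 : 0 ≤ lam.1.size := Finset.sum_nonneg fun i _ => lam.2 i
      have hz : (Signature.zero n).size = 0 := by simp [Signature.size, Signature.zero]
      simp only [Set.mem_preimage, Set.mem_singleton_iff, Finset.mem_coe, Finset.mem_subtype,
        mem_above, hz]
      constructor
      · intro h; exact ⟨lam.2, by omega⟩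
      · rintro ⟨-, h⟩; omega
    rw [hset, Finset.tsum_subtype' (f := fun lam : {lam : Signature n // lam.IsNonneg} =>
      hlP s lam.1 θ * hlQ s ψ lam.1)]
    exact (Finset.sum_subtype_of_mem (p := Signature.IsNonneg)
      (fun lam => hlP s lam θ * hlQ s ψ lam) fun lam hl i => (mem_above.mp hl).1 i).symm
  rw [funext hfib]
  exact h1

namespace KernelChange

variable {m n q : ℕ} {s s' : ℝ} {Dm : (Fin n → ℝ) → Fin m → ℝ} {U U' : (ℕ → ℝ) → ℕ → ℝ}
  {LR : Signature m → Signature n → Signature n →₀ ℝ}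

theorem tendsto_mul_atTop (h : KernelChange q s s' Dm U U') :
    Tendsto (fun r => q * r) atTop atTop :=
  (strictMono_mul_left_of_pos h.pos).tendsto_atTop

theorem sum_hlQ_mul_coeffs (h : KernelChange q s s' Dm U U') (hLR : IsCoeffs s s' Dm LR)
    {b : ℕ → ℝ} (hb : HasLimits m n s s' (U b) (U' b)) {nu lam : Signature n}
    (hnu : nu.IsNonneg) {D : ℕ} (hsize : lam.size = nu.size + q * D) :
    ∑ mu ∈ above (Signature.zero m) D, hlQ s (U b) mu * LR mu nu lam =
      skewQ s' (U' b) lam nu := by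
  refine tendsto_nhds_unique (tendsto_finsetSum (above (Signature.zero m) D) fun mu _ =>
    (hb.left mu).mul_const (LR mu nu lam)) ?_
  refine ((hb.right nu lam hnu).comp h.tendsto_mul_atTop).congr fun r => ?_
  exact (h.sum_truncQ_mul_coeffs hLR hnu b r hsize).symm

theorem skewQ_eq_zero_of_not_dvd (h : KernelChange q s s' Dm U U') {b : ℕ → ℝ}
    (hb : HasLimits m n s s' (U b) (U' b)) {nu lam : Signature n} (hnu : nu.IsNonneg) {E : ℕ}
    (hE : ¬ q ∣ E) (hlam : lam ∈ above nu E) : skewQ s' (U' b) lam nu = 0 := by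
  refine tendsto_nhds_unique ((hb.right nu lam hnu).comp h.tendsto_mul_atTop)
    (tendsto_const_nhds.congr fun r => ?_)
  exact (h.truncQ_eq_zero hnu b r hE hlam).symm

/-- For given `nu` and `lam`, only finitely many `mu` have a nonzero coefficient, and the sum of
the coefficients against `Q_mu(U b; s)` is the skew function `Q_{lam/nu}(U' b; s')`. -/
theorem exists_finset_sum_hlQ (h : KernelChange q s s' Dm U U') (hLR : IsCoeffs s s' Dm LR)
    {b : ℕ → ℝ} (hb : HasLimits m n s s' (U b) (U' b)) {nu : Signature n} (hnu : nu.IsNonneg)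
    (lam : Signature n) : ∃ F : Finset {mu : Signature m // mu.IsNonneg},
      (∀ mu ∉ F, LR mu.1 nu lam = 0) ∧
        ∑ mu ∈ F, hlQ s (U b) mu.1 * LR mu.1 nu lam = skewQ s' (U' b) lam nu := by
  classical
  by_cases hD : ∃ D : ℕ, lam.size = nu.size + q * D
  · obtain ⟨D, hD⟩ := hD
    refine ⟨(above (Signature.zero m) D).subtype Signature.IsNonneg, fun mu hmu => ?_, ?_⟩
    · by_contra hne
      have h1 := h.size_of_coeff_ne_zero hLR mu.2 hnu hne
      have h2 : (q : ℤ) * mu.1.size = q * D := by linarith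
      have h3 := mul_left_cancel₀ (Nat.cast_ne_zero.mpr h.pos.ne') h2
      refine hmu (Finset.mem_subtype.mpr (mem_above.mpr ⟨mu.2, ?_⟩))
      simpa [Signature.size, Signature.zero] using h3
    · rw [← h.sum_hlQ_mul_coeffs hLR hb hnu hD]
      exact Finset.sum_subtype_of_mem (fun mu => hlQ s (U b) mu * LR mu nu lam)
        fun mu hmu i => (mem_above.mp hmu).1 i
  · refine ⟨∅, fun mu _ => ?_, ?_⟩
    · by_contra hne
      have h1 := h.size_of_coeff_ne_zero hLR mu.2 hnu hne
      obtain ⟨D, hD'⟩ : ∃ D : ℕ, mu.1.size = D :=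
        Int.eq_ofNat_of_zero_le (Finset.sum_nonneg fun i _ => mu.2 i)
      exact hD ⟨D, by rw [h1, hD']⟩
    · rw [Finset.sum_empty]
      by_cases hle : ∀ i, nu.1 i ≤ lam.1 i
      · have hsz := Signature.size_mono hle
        obtain ⟨E, hE⟩ : ∃ E : ℕ, lam.size - nu.size = E := Int.eq_ofNat_of_zero_le (by omega)
        refine (h.skewQ_eq_zero_of_not_dvd hb hnu (E := E) ?_ (mem_above.mpr ⟨hle, by omega⟩)).symm
        rintro ⟨D, rfl⟩
        exact hD ⟨D, by push_cast at hE; omega⟩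
      · exact (skewQ_eq_zero s' _ hle).symm

/-- The two Cauchy kernels agree, degree by degree. -/
theorem cauchyKernel_eq (h : KernelChange q s s' Dm U U') {b : ℕ → ℝ}
    (hb : HasLimits m n s s' (U b) (U' b)) {θ : Fin n → ℝ}
    (h1 : CauchyFinite s (Dm θ) (U b)) (h2 : CauchyFinite s' θ (U' b)) :
    cauchyKernel s (Dm θ) (U b) = cauchyKernel s' θ (U' b) := by
  have hz : (Signature.zero m).IsNonneg := fun _ => le_rfl
  have hz' : (Signature.zero n).IsNonneg := fun _ => le_rfl
  have k1 := hasSum_cauchyKernel h1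
  have k2 := hasSum_cauchyKernel h2
  -- In each degree the two sums are limits of coefficients of Cauchy kernels in finitely many
  -- variables.
  have lim2 : ∀ E, Tendsto (fun r => PowerSeries.coeff E
      (cauchySer s' θ fun i : Fin (q * r) => U' b i)) atTop
      (𝓝 (∑ lam ∈ above (Signature.zero n) E, hlP s' lam θ * hlQ s' (U' b) lam)) := by
    intro E
    have ht := (tendsto_finsetSum (above (Signature.zero n) E) fun lam _ =>
      (hb.right (Signature.zero n) lam hz').const_mul (hlP s' lam θ)).comp h.tendsto_mul_atTop
    refine ht.congr fun r => ?_
    have h3 := sum_skewQFin_mul_hlP h.abs_right hz' θ (fun i : Fin (q * r) => U' b i) E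
    rw [hlP_zero h.abs_right, mul_one] at h3
    rw [← h3]
    exact Finset.sum_congr rfl fun lam _ => mul_comm _ _
  have lim1 : ∀ D, Tendsto (fun r => PowerSeries.coeff D
      (cauchySer s (Dm θ) fun i : Fin r => U b i)) atTop
      (𝓝 (∑ mu ∈ above (Signature.zero m) D, hlP s mu (Dm θ) * hlQ s (U b) mu)) := by
    intro D
    have ht := (tendsto_finsetSum (above (Signature.zero m) D) fun mu _ =>
      (hb.left mu).const_mul (hlP s mu (Dm θ)))
    refine ht.congr fun r => ?_
    have h3 := sum_skewQFin_mul_hlP h.abs_left hz (Dm θ) (fun i : Fin r => U b i) D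
    rw [hlP_zero h.abs_left, mul_one] at h3
    rw [← h3]
    exact Finset.sum_congr rfl fun lam _ => mul_comm _ _
  have hinj : Function.Injective fun D : ℕ => q * D := fun _ _ h' =>
    Nat.eq_of_mul_eq_mul_left h.pos h'
  rw [← hinj.hasSum_iff] at k2
  · refine HasSum.unique k1 ?_
    convert k2 using 1
    funext D
    refine tendsto_nhds_unique (lim1 D) ((lim2 (q * D)).congr fun r => ?_)
    exact h.kernel b r θ D
  · intro E hE
    refine tendsto_nhds_unique (lim2 E) (tendsto_const_nhds.congr fun r => ?_)
    exact (h.kernel_zero b r θ E fun ⟨D, hD⟩ => hE ⟨D, hD.symm⟩).symm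

end KernelChange

/-! ### Masses of iterated product convolutions -/

/-- The one-step probabilities of a product convolution. -/
def convMass {m n : ℕ} (s s' : ℝ) (Dm : (Fin n → ℝ) → Fin m → ℝ)
    (LR : Signature m → Signature n → Signature n →₀ ℝ) (θ : Fin n → ℝ) (mu : Signature m)
    (nu lam : Signature n) : ℝ :=
  LR mu nu lam * hlP s' lam θ / (hlP s mu (Dm θ) * hlP s' nu θ)

/-- The transition mass of the Hall-Littlewood process from `nu` to `lam`. -/
def stepMass {n : ℕ} (s' : ℝ) (θ : Fin n → ℝ) (ψ' : ℕ → ℝ) (nu lam : Signature n) : ℝ :=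
  skewQ s' ψ' lam nu * hlP s' lam θ / (hlP s' nu θ * cauchyKernel s' θ ψ')

theorem exists_succ_not_isNonneg {n k : ℕ} {l : Fin (k + 1) → Signature n}
    (h0 : (l 0).IsNonneg) (h : ¬ ∀ i, (l i).IsNonneg) :
    ∃ i : Fin k, (l i.castSucc).IsNonneg ∧ ¬ (l i.succ).IsNonneg := by
  by_contra! hne
  exact h fun i => Fin.induction h0 hne i

/-- The transition masses multiply to the mass of the path: the values of `P` at the intermediate
signatures cancel. -/
theorem hlMass_mul_prod_stepMass {n k : ℕ} {s' : ℝ} {θ : Fin n → ℝ}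
    (hP : ∀ nu : Signature n, nu.IsNonneg → hlP s' nu θ ≠ 0) (ψ : ℕ → ℝ) (ψs : Fin k → ℕ → ℝ)
    (l : Fin (k + 1) → Signature n) :
    hlMass s' θ ψ (l 0) * ∏ i : Fin k, stepMass s' θ (ψs i) (l i.castSucc) (l i.succ) =
      hlProcessMass s' θ ψ ψs l := by
  by_cases hl : ∀ i, (l i).IsNonneg
  · have htel : hlP s' (l 0) θ * ∏ i : Fin k, hlP s' (l i.succ) θ =
        (∏ i : Fin k, hlP s' (l i.castSucc) θ) * hlP s' (l (Fin.last k)) θ := by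
      rw [← Fin.prod_univ_succ (fun i => hlP s' (l i) θ),
        ← Fin.prod_univ_castSucc (fun i => hlP s' (l i) θ)]
    have hA : ∏ i : Fin k, hlP s' (l i.castSucc) θ ≠ 0 :=
      Finset.prod_ne_zero_iff.mpr fun i _ => hP _ (hl _)
    simp only [stepMass]
    rw [Finset.prod_div_distrib, Finset.prod_mul_distrib, Finset.prod_mul_distrib, hlMass,
      hlProcessMass, div_mul_div_comm]
    set A := ∏ i : Fin k, hlP s' (l i.castSucc) θ
    set B := ∏ i : Fin k, hlP s' (l i.succ) θ
    set S := ∏ i : Fin k, skewQ s' (ψs i) (l i.succ) (l i.castSucc)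
    set K := ∏ i : Fin k, cauchyKernel s' θ (ψs i)
    symm
    rw [← mul_div_mul_left _ _ hA]
    congr 1
    · linear_combination (-hlQ s' ψ (l 0) * S) * htel
    · ring
  · by_cases h0 : (l 0).IsNonneg
    · obtain ⟨i, hn, hi⟩ := exists_succ_not_isNonneg h0 hl
      have hQ : skewQ s' (ψs i) (l i.succ) (l i.castSucc) = 0 :=
        skewQ_eq_zero s' _ fun hle => hi (hn.of_le hle)
      have e1 : ∏ i : Fin k, stepMass s' θ (ψs i) (l i.castSucc) (l i.succ) = 0 :=
        Finset.prod_eq_zero (Finset.mem_univ i) (by rw [stepMass, hQ, zero_mul, zero_div])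
      have e2 : ∏ i : Fin k, skewQ s' (ψs i) (l i.succ) (l i.castSucc) = 0 :=
        Finset.prod_eq_zero (Finset.mem_univ i) hQ
      rw [hlProcessMass, e1, e2]
      simp
    · rw [hlProcessMass, hlMass, hlQ_eq_zero s' ψ h0]
      simp

namespace KernelChange

variable {m n q : ℕ} {s s' : ℝ} {Dm : (Fin n → ℝ) → Fin m → ℝ} {U U' : (ℕ → ℝ) → ℕ → ℝ}
  {LR : Signature m → Signature n → Signature n →₀ ℝ}

/-- Averaging the one-step probabilities over a Hall-Littlewood distributed input gives the
transition mass. -/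
theorem exists_finset_sum_hlMass (h : KernelChange q s s' Dm U U') (hLR : IsCoeffs s s' Dm LR)
    {b : ℕ → ℝ} (hb : HasLimits m n s s' (U b) (U' b)) {θ : Fin n → ℝ}
    (h1 : CauchyFinite s (Dm θ) (U b)) (h2 : CauchyFinite s' θ (U' b))
    (hP : ∀ mu : Signature m, mu.IsNonneg → hlP s mu (Dm θ) ≠ 0) {nu : Signature n}
    (hnu : nu.IsNonneg) (lam : Signature n) :
    ∃ F : Finset {mu : Signature m // mu.IsNonneg},
      (∀ mu ∉ F, hlMass s (Dm θ) (U b) mu.1 * convMass s s' Dm LR θ mu.1 nu lam = 0) ∧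
        ∑ mu ∈ F, hlMass s (Dm θ) (U b) mu.1 * convMass s s' Dm LR θ mu.1 nu lam =
          stepMass s' θ (U' b) nu lam := by
  obtain ⟨F, hF, hsum⟩ := h.exists_finset_sum_hlQ hLR hb hnu lam
  refine ⟨F, fun mu hmu => by rw [convMass, hF mu hmu, zero_mul, zero_div, mul_zero], ?_⟩
  rw [stepMass, ← hsum, Finset.sum_mul, Finset.sum_div]
  refine Finset.sum_congr rfl fun mu _ => ?_
  rw [hlMass, convMass, h.cauchyKernel_eq hb h1 h2, div_mul_div_comm]
  rw [← mul_div_mul_left (hlQ s (U b) mu.1 * LR mu.1 nu lam * hlP s' lam θ) _ (hP mu.1 mu.2)]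
  congr 1 <;> ring

theorem convMass_eq_zero (h : KernelChange q s s' Dm U U') (hLR : IsCoeffs s s' Dm LR)
    {mu : Signature m} {nu lam : Signature n} (hmu : mu.IsNonneg) (hnu : nu.IsNonneg)
    (hlam : ¬ lam.IsNonneg) (θ : Fin n → ℝ) : convMass s s' Dm LR θ mu nu lam = 0 := by
  have : LR mu nu lam = 0 := by
    by_contra hne
    exact hlam (h.isNonneg_of_coeff_ne_zero hLR hmu hnu hne)
  rw [convMass, this, zero_mul, zero_div]

/-- The identity at the level of masses. -/
theorem hasSum_mass (h : KernelChange q s s' Dm U U') (hLR : IsCoeffs s s' Dm LR) {k : ℕ}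
    {bs : Fin k → ℕ → ℝ} (hb : ∀ i, HasLimits m n s s' (U (bs i)) (U' (bs i)))
    {θ : Fin n → ℝ} (h1 : ∀ i, CauchyFinite s (Dm θ) (U (bs i)))
    (h2 : ∀ i, CauchyFinite s' θ (U' (bs i)))
    (hP : ∀ mu : Signature m, mu.IsNonneg → hlP s mu (Dm θ) ≠ 0)
    (hP' : ∀ nu : Signature n, nu.IsNonneg → hlP s' nu θ ≠ 0) (ψ : ℕ → ℝ)
    (l : Fin (k + 1) → Signature n) :
    HasSum (fun M : Fin k → {mu : Signature m // mu.IsNonneg} =>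
        hlMass s' θ ψ (l 0) * ∏ i : Fin k, (hlMass s (Dm θ) (U (bs i)) (M i).1 *
          convMass s s' Dm LR θ (M i).1 (l i.castSucc) (l i.succ)))
      (hlProcessMass s' θ ψ (fun i => U' (bs i)) l) := by
  classical
  by_cases hl : ∀ i, (l i).IsNonneg
  · have hstep := fun i : Fin k => h.exists_finset_sum_hlMass hLR (hb i) (h1 i) (h2 i) hP
      (hl i.castSucc) (l i.succ)
    choose F hF hsum using hstep
    rw [← hlMass_mul_prod_stepMass hP' ψ (fun i => U' (bs i)) l]
    refine HasSum.mul_left _ ?_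
    simp only [← hsum]
    rw [Finset.prod_univ_sum]
    refine hasSum_sum_of_ne_finset_zero fun M hM => ?_
    rw [Fintype.mem_piFinset, not_forall] at hM
    obtain ⟨i, hi⟩ := hM
    exact Finset.prod_eq_zero (Finset.mem_univ i) (hF i (M i) hi)
  -- If a signature on the path has a negative part, then both sides vanish.
  · have hR : hlProcessMass s' θ ψ (fun i => U' (bs i)) l = 0 ∧
        ∀ M : Fin k → {mu : Signature m // mu.IsNonneg},
          hlMass s' θ ψ (l 0) * ∏ i : Fin k, (hlMass s (Dm θ) (U (bs i)) (M i).1 *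
            convMass s s' Dm LR θ (M i).1 (l i.castSucc) (l i.succ)) = 0 := by
      by_cases h0 : (l 0).IsNonneg
      · obtain ⟨i, hn, hi⟩ := exists_succ_not_isNonneg h0 hl
        constructor
        · have hQ : skewQ s' (U' (bs i)) (l i.succ) (l i.castSucc) = 0 :=
            skewQ_eq_zero s' _ fun hle => hi (hn.of_le hle)
          have e2 : ∏ i : Fin k, skewQ s' (U' (bs i)) (l i.succ) (l i.castSucc) = 0 :=
            Finset.prod_eq_zero (Finset.mem_univ i) hQ
          rw [hlProcessMass, e2]
          simp
        · intro M
          rw [Finset.prod_eq_zero (Finset.mem_univ i), mul_zero]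
          rw [h.convMass_eq_zero hLR (M i).2 hn hi, mul_zero]
      · rw [hlProcessMass, hlMass, hlQ_eq_zero s' ψ h0]
        simp
    rw [hR.1]
    simp only [hR.2]
    exact hasSum_zero

end KernelChange

/-! ### The law of the iterated product convolution -/

/-- Summing a joint law over the values of an input. -/
theorem hasSum_real_inter_eq {m : ℕ} {Ω : Type*} [MeasurableSpace Ω] (P : Measure Ω)
    [IsProbabilityMeasure P] {Y : Ω → Signature m} (hY : Measurable Y) {A : Set Ω}
    (hA : MeasurableSet A) : HasSum (fun mu => P.real (A ∩ {ω | Y ω = mu})) (P.real A) := by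
  have hmeas : ∀ mu, MeasurableSet (A ∩ {ω | Y ω = mu}) := fun mu =>
    hA.inter (hY (measurableSet_singleton mu))
  have hdisj : Pairwise (Function.onFun Disjoint fun mu => A ∩ {ω | Y ω = mu}) := by
    intro a b hab
    rw [Function.onFun, Set.disjoint_left]
    rintro ω ⟨-, h1⟩ ⟨-, h2⟩
    exact hab (h1.symm.trans h2)
  have hU : ⋃ mu, A ∩ {ω | Y ω = mu} = A := by
    ext ω; simp
  have h1 := measure_iUnion (μ := P) hdisj hmeas
  rw [hU] at h1
  have h2 := ENNReal.hasSum_toReal (h1 ▸ measure_ne_top P A)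
  rw [← ENNReal.tsum_toReal_eq fun _ => measure_ne_top _ _, ← h1] at h2
  exact h2

namespace KernelChange

variable {m n q : ℕ} {s s' : ℝ} {Dm : (Fin n → ℝ) → Fin m → ℝ} {U U' : (ℕ → ℝ) → ℕ → ℝ}
  {LR : Signature m → Signature n → Signature n →₀ ℝ}

/-- The law of the iterated product convolution, by induction on the number of steps: the joint
law of the history and the next value is summed over the values of the next input, which is
independent of the history. Histories that contain a signature with a negative part have
probability zero. -/
theorem law_eq (h : KernelChange q s s' Dm U U') (hLR : IsCoeffs s s' Dm LR) {k : ℕ}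
    {bs : Fin k → ℕ → ℝ} (hb : ∀ i, HasLimits m n s s' (U (bs i)) (U' (bs i)))
    {θ : Fin n → ℝ} (h1 : ∀ i, CauchyFinite s (Dm θ) (U (bs i)))
    (h2 : ∀ i, CauchyFinite s' θ (U' (bs i)))
    (hP : ∀ mu : Signature m, mu.IsNonneg → hlP s mu (Dm θ) ≠ 0)
    (hP' : ∀ nu : Signature n, nu.IsNonneg → hlP s' nu θ ≠ 0) (ψ : ℕ → ℝ)
    {Ω : Type*} [MeasurableSpace Ω] (P : Measure Ω) [IsProbabilityMeasure P]
    {Y : Fin k → Ω → Signature m} {X : Fin (k + 1) → Ω → Signature n}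
    (hX0 : HasHLLaw P (X 0) s' θ ψ) (hYlaw : ∀ i, HasHLLaw P (Y i) s (Dm θ) (U (bs i)))
    (hiter : IsIteratedOperation P (convMass s s' Dm LR θ) Y X)
    (l : Fin (k + 1) → Signature n) :
    P.real {ω | ∀ τ, X τ ω = l τ} = hlProcessMass s' θ ψ (fun i => U' (bs i)) l := by
  classical
  -- The second part covers histories with negative parts, at which the one-step probabilities are
  -- not controlled.
  have key : ∀ j : Fin (k + 1), P.real {ω | ∀ i ≤ j, X i ω = l i} =
      hlMass s' θ ψ (l 0) * ∏ i ∈ Finset.univ.filter (fun i : Fin k => i.castSucc < j),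
        stepMass s' θ (U' (bs i)) (l i.castSucc) (l i.succ) ∧
      (¬ (l j).IsNonneg → P.real {ω | ∀ i ≤ j, X i ω = l i} = 0) := by
    intro j
    induction j using Fin.induction with
    | zero =>
      have hset : {ω | ∀ i ≤ (0 : Fin (k + 1)), X i ω = l i} = {ω | X 0 ω = l 0} := by
        ext ω
        simp
      have hfil : Finset.univ.filter (fun i : Fin k => i.castSucc < (0 : Fin (k + 1))) = ∅ :=
        Finset.filter_false_of_mem fun i _ => not_lt.mpr (Fin.zero_le _)
      rw [hset, hfil, Finset.prod_empty, mul_one]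
      refine ⟨?_, hX0.2 (l 0)⟩
      by_cases h0 : (l 0).IsNonneg
      · exact hX0.1 _ h0
      · rw [hX0.2 _ h0, hlMass, hlQ_eq_zero s' ψ h0, mul_zero, zero_div]
    | succ i ih =>
      set A : Set Ω := {ω | ∀ j ≤ i.castSucc, X j ω = l j} with hA
      have hset : {ω | ∀ j ≤ i.succ, X j ω = l j} = A ∩ {ω | X i.succ ω = l i.succ} := by
        ext ω
        simp only [hA, Set.mem_ofPred_eq, Set.mem_inter_iff]
        constructor
        · intro hω
          exact ⟨fun j hj => hω j (hj.trans (Fin.castSucc_lt_succ).le), hω _ le_rfl⟩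
        · rintro ⟨ha, hb⟩ j hj
          rcases hj.lt_or_eq with hlt | rfl
          · exact ha j (Fin.le_castSucc_iff.mpr hlt)
          · exact hb
      have hfil : Finset.univ.filter (fun a : Fin k => a.castSucc < i.succ) =
          insert i (Finset.univ.filter fun a : Fin k => a.castSucc < i.castSucc) := by
        ext a
        simp only [Finset.mem_filter, Finset.mem_univ, true_and, Finset.mem_insert, Fin.lt_def,
          Fin.val_castSucc, Fin.val_succ, Fin.ext_iff]
        omega
      have hprod : P.real (A ∩ {ω | X i.succ ω = l i.succ}) = P.real A *
          stepMass s' θ (U' (bs i)) (l i.castSucc) (l i.succ) := by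
        by_cases hn : (l i.castSucc).IsNonneg
        · have hXm : ∀ (j : Fin (k + 1)) (a : Signature n), MeasurableSet {ω | X j ω = a} :=
            fun j a => hiter.measurable_value j (measurableSet_singleton a)
          have hAm : MeasurableSet A := by
            have : A = ⋂ j, ⋂ (_ : j ≤ i.castSucc), {ω | X j ω = l j} := by
              ext ω; simp [hA]
            rw [this]
            exact MeasurableSet.iInter fun j => MeasurableSet.iInter fun _ => hXm j _
          have hs := hasSum_real_inter_eq P (hiter.measurable_input i)
            (hAm.inter (hXm i.succ (l i.succ)))
          have hterm : ∀ mu, P.real (A ∩ {ω | X i.succ ω = l i.succ} ∩ {ω | Y i ω = mu}) =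
              P.real A * (P.real {ω | Y i ω = mu} *
                convMass s s' Dm LR θ mu (l i.castSucc) (l i.succ)) := by
            intro mu
            have e1 : A ∩ {ω | X i.succ ω = l i.succ} ∩ {ω | Y i ω = mu} =
                {ω | (∀ j ≤ i.castSucc, X j ω = l j) ∧ Y i ω = mu ∧ X i.succ ω = l i.succ} := by
              ext ω
              simp only [hA, Set.mem_ofPred_eq, Set.mem_inter_iff]
              tauto
            have e2 : {ω | (∀ j ≤ i.castSucc, X j ω = l j) ∧ Y i ω = mu} =
                Y i ⁻¹' {mu} ∩ (fun ω (j : Set.Iic i.castSucc) => X j.1 ω) ⁻¹'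
                  {fun j => l j.1} := by
              ext ω
              simp only [Set.mem_ofPred_eq, Set.mem_inter_iff, Set.mem_preimage,
                Set.mem_singleton_iff, funext_iff, Subtype.forall, Set.mem_Iic]
              tauto
            have e3 : A = (fun ω (j : Set.Iic i.castSucc) => X j.1 ω) ⁻¹' {fun j => l j.1} := by
              ext ω
              simp only [hA, Set.mem_ofPred_eq, Set.mem_preimage,
                Set.mem_singleton_iff, funext_iff, Subtype.forall, Set.mem_Iic]
            -- independence of the input and the history
            have e4 := (hiter.indep i).measure_inter_preimage_eq_mul {mu} {fun j => l j.1}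
              (measurableSet_singleton _) (measurableSet_singleton _)
            rw [e1, hiter.step i l mu (l i.succ), e2, Measure.real, e4, ENNReal.toReal_mul, ← e3]
            change P.real {ω | Y i ω = mu} * P.real A * _ = _
            ring
          simp only [hterm] at hs
          obtain ⟨F, hF, hsum⟩ := h.exists_finset_sum_hlMass hLR (hb i) (h1 i) (h2 i) hP hn
            (l i.succ)
          have hs2 : HasSum (fun mu => P.real {ω | Y i ω = mu} *
              convMass s s' Dm LR θ mu (l i.castSucc) (l i.succ))
              (stepMass s' θ (U' (bs i)) (l i.castSucc) (l i.succ)) := by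
            rw [← hsum]
            have e5 : ∑ mu ∈ F, hlMass s (Dm θ) (U (bs i)) mu.1 *
                convMass s s' Dm LR θ mu.1 (l i.castSucc) (l i.succ) =
                ∑ mu ∈ F.map (Function.Embedding.subtype _), P.real {ω | Y i ω = mu} *
                  convMass s s' Dm LR θ mu (l i.castSucc) (l i.succ) := by
              rw [Finset.sum_map]
              exact Finset.sum_congr rfl fun mu _ => by
                rw [Function.Embedding.subtype_apply, (hYlaw i).1 mu.1 mu.2]
            rw [e5]
            refine hasSum_sum_of_ne_finset_zero fun mu hmu => ?_
            by_cases hmun : mu.IsNonneg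
            · rw [(hYlaw i).1 mu hmun]
              exact hF ⟨mu, hmun⟩ fun hin => hmu (Finset.mem_map.mpr ⟨_, hin, rfl⟩)
            · rw [(hYlaw i).2 mu hmun, zero_mul]
          exact hs.unique (hs2.mul_left (P.real A))
        · have hz := ih.2 hn
          rw [hz, zero_mul]
          refine le_antisymm ?_ measureReal_nonneg
          rw [← hz]
          exact measureReal_mono Set.inter_subset_left
      rw [hset, hprod, hfil, Finset.prod_insert (by simp), ih.1]
      refine ⟨by ring, fun hns => ?_⟩
      rw [← ih.1]
      by_cases hn : (l i.castSucc).IsNonneg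
      · rw [stepMass, skewQ_eq_zero s' _ fun hle => hns (hn.of_le hle), zero_mul, zero_div,
          mul_zero]
      · rw [ih.2 hn, zero_mul]
  have hlast := (key (Fin.last k)).1
  have hset : {ω | ∀ i ≤ Fin.last k, X i ω = l i} = {ω | ∀ τ, X τ ω = l τ} := by
    ext ω; simp [Fin.le_last]
  have hfil : Finset.univ.filter (fun i : Fin k => i.castSucc < Fin.last k) = Finset.univ :=
    Finset.filter_true_of_mem fun i _ => Fin.castSucc_lt_last i
  rw [hset, hfil] at hlast
  rw [hlast, hlMass_mul_prod_stepMass hP' ψ (fun i => U' (bs i)) l]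

end KernelChange

/-! ### The two changes of kernel -/

theorem one_sub_C_mul_X_ne_zero (y : ℝ) :
    (1 - PowerSeries.C y * PowerSeries.X : ℝ⟦X⟧) ≠ 0 := by
  intro h
  have := congrArg (PowerSeries.coeff 0) h
  simp at this

/-- The telescoping `(1 - t y X)/(1 - y X) · (1 - t² y X)/(1 - t y X)`. -/
theorem kernelSer_mul_kernelSer (t y : ℝ) :
    kernelSer t y * kernelSer t (y * t) = kernelSer (t ^ 2) y := by
  refine mul_right_cancel₀ (mul_ne_zero (one_sub_C_mul_X_ne_zero y)
    (one_sub_C_mul_X_ne_zero (y * t))) ?_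
  have h1 := kernelSer_mul t y
  have h2 := kernelSer_mul t (y * t)
  have h3 := kernelSer_mul (t ^ 2) y
  calc kernelSer t y * kernelSer t (y * t) *
        ((1 - PowerSeries.C y * PowerSeries.X) * (1 - PowerSeries.C (y * t) * PowerSeries.X))
      = (kernelSer t y * (1 - PowerSeries.C y * PowerSeries.X)) *
        (kernelSer t (y * t) * (1 - PowerSeries.C (y * t) * PowerSeries.X)) := by ring
    _ = (kernelSer (t ^ 2) y * (1 - PowerSeries.C y * PowerSeries.X)) *
        (1 - PowerSeries.C (y * t) * PowerSeries.X) := by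
          rw [h1, h2, h3, show t * (y * t) = t ^ 2 * y by ring, mul_comm t y]
          ring
    _ = _ := by ring

theorem rowSer_altDouble (t : ℝ) {n : ℕ} (x : Fin n → ℝ) :
    rowSer t (altDouble t x) = rowSer (t ^ 2) x := by
  rw [rowSer, rowSer,
    ← (finProdFinEquiv.trans (finCongr (mul_comm n 2))).prod_comp, Fintype.prod_prod_type]
  refine Finset.prod_congr rfl fun i _ => ?_
  have hval : ∀ e : Fin 2,
      altDouble t x ((finProdFinEquiv.trans (finCongr (mul_comm n 2))) (i, e)) =
        x i * t ^ (e : ℕ) := by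
    intro e
    have h1 : ((e : ℕ) + 2 * i) / 2 = i := by omega
    have h2 : ((e : ℕ) + 2 * i) % 2 = e := by omega
    simp [altDouble, finProdFinEquiv, h1, h2]
  rw [Fin.prod_univ_two, hval, hval]
  simp only [Fin.val_zero, Fin.val_one, pow_zero, pow_one, mul_one]
  exact kernelSer_mul_kernelSer t (x i)

theorem cauchySer_eq_prod_range (s : ℝ) {n : ℕ} (x : Fin n → ℝ) (ψ : ℕ → ℝ) (r : ℕ) :
    (cauchySer s x fun i : Fin r => ψ i) =
      ∏ j ∈ Finset.range r, PowerSeries.rescale (ψ j) (rowSer s x) :=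
  (Finset.prod_range fun j => PowerSeries.rescale (ψ j) (rowSer s x)).symm

/-- The alternating case: `Π_t(x, x t; ψ) = Π_{t²}(x; ψ)`. -/
theorem kernelChange_alt {t : ℝ} (ht : |t| < 1) (n : ℕ) :
    KernelChange 1 t (t ^ 2) (altDouble (n := n) t) id id where
  abs_left := ht
  abs_right := by
    rw [abs_pow]
    exact pow_lt_one₀ (abs_nonneg t) ht two_ne_zero
  pos := one_pos
  continuous := continuous_pi fun j => (continuous_apply _).mul_const _
  smul x r _ := by
    funext j
    simp only [altDouble, Pi.smul_apply, smul_eq_mul, pow_one]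
    ring
  kernel b r x D := by
    simp only [cauchySer_eq_prod_range, one_mul, rowSer_altDouble]
  kernel_zero b r x E h := absurd (one_dvd E) h
  one := rfl

theorem rescale_kernelSer (s c y : ℝ) :
    PowerSeries.rescale c (kernelSer s y) = kernelSer s (c * y) := by
  ext d
  rw [PowerSeries.coeff_rescale, coeff_kernelSer, coeff_kernelSer]
  split_ifs with h
  · simp [h]
  · rw [mul_pow]
    ring

/-- The product of `(1 + t y X)/(1 - y X)` and `(1 - t y X)/(1 + y X)` is a function of `X²`. -/
theorem kernelSer_mul_kernelSer_neg (t y : ℝ) :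
    kernelSer (-t) y * kernelSer (-t) (-y) =
      PowerSeries.expand 2 two_ne_zero (kernelSer (t ^ 2) (y ^ 2)) := by
  refine mul_right_cancel₀ (mul_ne_zero (one_sub_C_mul_X_ne_zero y)
    (one_sub_C_mul_X_ne_zero (-y))) ?_
  have h1 := kernelSer_mul (-t) y
  have h2 := kernelSer_mul (-t) (-y)
  have h3 := congrArg (PowerSeries.expand 2 two_ne_zero) (kernelSer_mul (t ^ 2) (y ^ 2))
  simp only [map_mul, map_sub, map_one, PowerSeries.expand_C, PowerSeries.expand_X] at h3
  calc kernelSer (-t) y * kernelSer (-t) (-y) *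
        ((1 - PowerSeries.C y * PowerSeries.X) * (1 - PowerSeries.C (-y) * PowerSeries.X))
      = (kernelSer (-t) y * (1 - PowerSeries.C y * PowerSeries.X)) *
        (kernelSer (-t) (-y) * (1 - PowerSeries.C (-y) * PowerSeries.X)) := by ring
    _ = PowerSeries.expand 2 two_ne_zero (kernelSer (t ^ 2) (y ^ 2)) *
        (1 - PowerSeries.C (y ^ 2) * PowerSeries.X ^ 2) := by
          rw [h1, h2]
          simp only [map_pow, map_mul, map_neg] at h3 ⊢
          rw [h3]
          ring
    _ = _ := by
          simp only [map_pow, map_neg]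
          ring

theorem starSeq_even (b : ℕ → ℝ) (j : ℕ) : starSeq b (2 * j) = b j := by
  simp [starSeq, pow_mul]

theorem starSeq_odd (b : ℕ → ℝ) (j : ℕ) : starSeq b (2 * j + 1) = -b j := by
  have : (2 * j + 1) / 2 = j := by omega
  simp [starSeq, pow_add, pow_mul, this]

theorem cauchySer_starSeq (t : ℝ) {n : ℕ} (x : Fin n → ℝ) (b : ℕ → ℝ) (r : ℕ) :
    (cauchySer (-t) x fun i : Fin (2 * r) => starSeq b i) =
      PowerSeries.expand 2 two_ne_zero
        (cauchySer (t ^ 2) (fun i => x i ^ 2) fun i : Fin r => b i ^ 2) := by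
  rw [cauchySer_eq_prod_range, cauchySer_eq_prod_range _ _ fun j => b j ^ 2]
  induction r with
  | zero => simp
  | succ r ih =>
    rw [show 2 * (r + 1) = 2 * r + 1 + 1 by ring, Finset.prod_range_succ, Finset.prod_range_succ,
      ih, Finset.prod_range_succ, map_mul, mul_assoc, starSeq_even, starSeq_odd]
    congr 1
    simp only [rowSer, map_prod, rescale_kernelSer]
    rw [← Finset.prod_mul_distrib]
    refine Finset.prod_congr rfl fun i _ => ?_
    rw [neg_mul, kernelSer_mul_kernelSer_neg, mul_pow]

/-- The Hermitian case: `Π_{-t}(x; ψ*)` is `Π_{t²}(x²; ψ)` with `X²` in place of `X`. -/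
theorem kernelChange_her {t : ℝ} (ht : |t| < 1) (n : ℕ) :
    KernelChange 2 (t ^ 2) (-t) (fun (x : Fin n → ℝ) i => x i ^ 2) (fun b j => b j ^ 2)
      starSeq where
  abs_left := by
    rw [abs_pow]
    exact pow_lt_one₀ (abs_nonneg t) ht two_ne_zero
  abs_right := by rwa [abs_neg]
  pos := two_pos
  continuous := continuous_pi fun j => (continuous_apply j).pow 2
  smul x r _ := by
    funext j
    simp only [Pi.smul_apply, smul_eq_mul, mul_pow]
  kernel b r x D := by
    rw [cauchySer_starSeq, PowerSeries.coeff_expand_mul]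
  kernel_zero b r x E h := by
    rw [cauchySer_starSeq, PowerSeries.coeff_expand_of_not_dvd _ _ _ h]
  one := one_pow 2

theorem isCoeffs_altLR {t : ℝ} (ht : |t| < 1) (n : ℕ) :
    KernelChange.IsCoeffs t (t ^ 2) (altDouble (n := n) t) (altLR t) := by
  intro mu nu hmu hnu
  obtain ⟨c, -, hc⟩ := (kernelChange_alt ht n).exists_expansion hmu hnu
  have h : ∃ c, IsAltLR t mu nu c := ⟨c, fun x _ => hc x⟩
  rw [altLR, dif_pos h]
  exact h.choose_spec

theorem isCoeffs_herLR {t : ℝ} (ht : |t| < 1) (n : ℕ) :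
    KernelChange.IsCoeffs (t ^ 2) (-t) (fun (x : Fin n → ℝ) i => x i ^ 2) (herLR t) := by
  intro mu nu hmu hnu
  obtain ⟨c, -, hc⟩ := (kernelChange_her ht n).exists_expansion hmu hnu
  have h : ∃ c, IsHerLR t mu nu c := ⟨c, fun x _ => hc x⟩
  rw [herLR, dif_pos h]
  exact h.choose_spec

theorem hasLimits_alt (t : ℝ) (n : ℕ) {ψ : ℕ → ℝ} (hψ : Summable ψ) :
    HasLimits (2 * n) n t (t ^ 2) ψ ψ :=
  ⟨fun _ => tendsto_truncQ t hψ _ _, fun _ _ _ => tendsto_truncQ (t ^ 2) hψ _ _⟩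

/-- The sequence `b₁, -b₁, b₂, -b₂, …` need not be summable; its truncations at even lengths
converge by comparison with `b₁², b₂², …`, and those at odd lengths since `b_j → 0`. -/
theorem hasLimits_her {t : ℝ} (ht : |t| < 1) (n : ℕ) {b : ℕ → ℝ} (hb : Summable fun j => b j ^ 2) :
    HasLimits n n (t ^ 2) (-t) (fun j => b j ^ 2) (starSeq b) := by
  refine ⟨fun _ => tendsto_truncQ _ hb _ _, fun nu lam hnu => tendsto_truncQ_of_even _ ?_
    (fun lam => (kernelChange_her ht n).exists_tendsto_truncQ_mul (isCoeffs_herLR ht n)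
      (fun mu => tendsto_truncQ _ hb _ _) hnu lam) lam⟩
  simp only [starSeq_even]
  have h := hb.tendsto_atTop_zero.sqrt
  simp only [Real.sqrt_sq_eq_abs, Real.sqrt_zero] at h
  exact (tendsto_zero_iff_abs_tendsto_zero _).mpr h

end HallLittlewood

end

theorem mainTheorem1 (n k : ℕ) (t : ℝ) (ht : |t| < 1) (θ : Fin n → ℝ) :
    -- the alternating case
    (∀ (ψ : ℕ → ℝ) (ψs : Fin k → ℕ → ℝ),
      Summable ψ → (∀ i, Summable (ψs i)) →
      CauchyFinite (t ^ 2) θ ψ →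
      (∀ i, CauchyFinite t (altDouble t θ) (ψs i)) →
      (∀ i, CauchyFinite (t ^ 2) θ (ψs i)) →
      (∀ mu : Signature (2 * n), mu.IsNonneg → hlP t mu (altDouble t θ) ≠ 0) →
      (∀ nu : Signature n, nu.IsNonneg → hlP (t ^ 2) nu θ ≠ 0) →
      -- random signatures: the joint law of the iterated product convolutions
      (∀ (Ω : Type*) [MeasurableSpace Ω] (P : Measure Ω) [IsProbabilityMeasure P]
        (μ : Fin k → Ω → Signature (2 * n)) (X : Fin (k + 1) → Ω → Signature n),
        HasHLLaw P (X 0) (t ^ 2) θ ψ →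
        (∀ i, HasHLLaw P (μ i) t (altDouble t θ) (ψs i)) →
        IsIteratedOperation P (altConv t θ) μ X →
        ∀ l : Fin (k + 1) → Signature n,
          P.real {ω | ∀ τ, X τ ω = l τ} = hlProcessMass (t ^ 2) θ ψ ψs l) ∧
      -- the same for the masses, which need not be nonnegative
      (∀ l : Fin (k + 1) → Signature n,
        HasSum (fun m : Fin k → {mu : Signature (2 * n) // mu.IsNonneg} =>
            hlMass (t ^ 2) θ ψ (l 0) *
              ∏ i : Fin k, (hlMass t (altDouble t θ) (ψs i) (m i).1 *
                altConv t θ (m i).1 (l i.castSucc) (l i.succ)))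
          (hlProcessMass (t ^ 2) θ ψ ψs l))) ∧
    -- the Hermitian case
    (∀ (b : ℕ → ℝ) (bs : Fin k → ℕ → ℝ),
      Summable (fun j => b j ^ 2) → (∀ i, Summable (fun j => bs i j ^ 2)) →
      CauchyFinite (-t) θ (fun j => b j ^ 2) →
      (∀ i, CauchyFinite (t ^ 2) (fun j => θ j ^ 2) (fun j => bs i j ^ 2)) →
      (∀ i, CauchyFinite (-t) θ (starSeq (bs i))) →
      (∀ mu : Signature n, mu.IsNonneg → hlP (t ^ 2) mu (fun j => θ j ^ 2) ≠ 0) →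
      (∀ nu : Signature n, nu.IsNonneg → hlP (-t) nu θ ≠ 0) →
      -- random signatures: the joint law of the iterated product convolutions
      (∀ (Ω : Type*) [MeasurableSpace Ω] (P : Measure Ω) [IsProbabilityMeasure P]
        (μ : Fin k → Ω → Signature n) (X : Fin (k + 1) → Ω → Signature n),
        HasHLLaw P (X 0) (-t) θ (fun j => b j ^ 2) →
        (∀ i, HasHLLaw P (μ i) (t ^ 2) (fun j => θ j ^ 2) (fun j => bs i j ^ 2)) →
        IsIteratedOperation P (herConv t θ) μ X →
        ∀ l : Fin (k + 1) → Signature n,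
          P.real {ω | ∀ τ, X τ ω = l τ} =
            hlProcessMass (-t) θ (fun j => b j ^ 2) (fun i => starSeq (bs i)) l) ∧
      -- the same for the masses, which need not be nonnegative
      (∀ l : Fin (k + 1) → Signature n,
        HasSum (fun m : Fin k → {mu : Signature n // mu.IsNonneg} =>
            hlMass (-t) θ (fun j => b j ^ 2) (l 0) *
              ∏ i : Fin k, (hlMass (t ^ 2) (fun j => θ j ^ 2) (fun j => bs i j ^ 2) (m i).1 *
                herConv t θ (m i).1 (l i.castSucc) (l i.succ)))
          (hlProcessMass (-t) θ (fun j => b j ^ 2) (fun i => starSeq (bs i)) l))) := by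
  refine ⟨fun ψ ψs _ hψs _ h1 h2 hP hP' => ⟨fun Ω _ P _ μ X hX0 hμ hiter l => ?_, fun l => ?_⟩,
    fun b bs _ hbs _ h1 h2 hP hP' => ⟨fun Ω _ P _ μ X hX0 hμ hiter l => ?_, fun l => ?_⟩⟩
  · exact (kernelChange_alt ht n).law_eq (isCoeffs_altLR ht n)
      (fun i => hasLimits_alt t n (hψs i)) h1 h2 hP hP' ψ P hX0 hμ hiter l
  · exact (kernelChange_alt ht n).hasSum_mass (isCoeffs_altLR ht n)
      (fun i => hasLimits_alt t n (hψs i)) h1 h2 hP hP' ψ l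
  · exact (kernelChange_her ht n).law_eq (isCoeffs_herLR ht n)
      (fun i => hasLimits_her ht n (hbs i)) h1 h2 hP hP' (fun j => b j ^ 2) P hX0 hμ hiter l
  · exact (kernelChange_her ht n).hasSum_mass (isCoeffs_herLR ht n)
      (fun i => hasLimits_her ht n (hbs i)) h1 h2 hP hP' (fun j => b j ^ 2) l
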